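/- **Setting.** Consider tuples $(R, V, (a_{\pm i})_{i=1,2,3}, \langle\,,\rangle)$ where $R$ is a nonzero commutative $\mathbb{R}$-algebra, $V$ is a commutative (not necessarily associative) $R$-algebra generated by six marked elements $A=\{a_1,a_{-1},a_2,a_{-2},a_3,a_{-3}\}$, $\langle\,,\rangle: V\times V\to R$ is an $R$-bilinear form with $\langle u, v\cdot w\rangle=\langle u\cdot v,w\rangle$ for all $u,v,w \in V$, and $R$ is generated as an $\mathbb{R}$-algebra by the values of the form on the monomials in the $a_{\pm i}$. A morphism $(R,V)\to(R',V')$ is an $\mathbb{R}$-algebra homomorphism $\phi:R\to R'$ together with a $\phi$-semilinear multiplicative map $\psi:V\to V'$ such that $\psi(a_{\pm i})=a'_{\pm i}$ and $\langle\psi(u),\psi(v)\rangle=\phi(\langle u,v\rangle)$. (Morphisms are automatically surjective.) For $a \in V$ and $\lambda \in \mathbb{R}$ write $V_\lambda^{(a)}=\{v\in V : a\cdot v=\lambda v\}$. Let $\mathcal{C}_{4A}$ be the full subcategory of those tuples that are primitive Frobenius axial algebras of Monster type with property $\mathcal{P}$ and shape $4A$, that is: 1. (primitive, Monster type) each $a\in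 A$ is an idempotent with $\langle a,a\rangle=1$, $V=V_1^{(a)}\oplus V_0^{(a)}\oplus V_{1/4}^{(a)}\oplus V_{1/32}^{(a)}$, $V_1^{(a)}=Ra$, and $V_\lambda^{(a)}\cdot V_\mu^{(a)}\subseteq\bigoplus_{\nu\in\lambda*\mu}V_\nu^{(a)}$ for $\lambda,\mu \in \{1,0,\frac14,\frac1{32}\}$, where $*$ is the symmetric Monster fusion rule: $1*1=\{1\}$, $1*0=\emptyset$, $0*0=\{0\}$, $1*\frac14=0*\frac14=\{\frac14\}$, $\frac14*\frac14=\{1,0\}$, $\lambda*\frac1{32}=\{\frac1{32}\}$ for $\lambda\in\{1,0,\frac14\}$, and $\frac1{32}*\frac1{32}=\{1,0,\frac14\}$; 2. (property $\mathcal{P}$) the six elements of $A$ are distinct, and if $\tau(a)$ denotes the linear map which is $1$ on $V_1^{(a)}\oplus V_0^{(a)}\oplus V_{1/4}^{(a)}$ and $-1$ on $V_{1/32}^{(a)}$, then for each $i$ one has $\tau(a_i)=\tau(a_{-i})$, and this map fixes $a_{\pm i}$ and swaps $a_j$ and $a_{-j}$ for each $j\neq i$; 3. (shape $4A$) the subalgebra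 generated by $a_1,a_2$ is the dihedral algebra of type $4A$: writing $(b_0,b_1,b_2,b_3)=(a_1,a_2,a_{-1},a_{-2})$ with indices modulo $4$, it is free over $R$ with basis $b_0,b_1,b_2,b_3,v$ for some $v$ with $b_i\cdot b_i=b_i$, $b_i\cdot b_{i+1}=\frac1{2^6}(3b_i+3b_{i+1}+b_{i+2}+b_{i+3}-3v)$, $b_i\cdot b_{i+2}=0$, $b_i\cdot v=\frac1{2^4}(5b_i-2b_{i+1}-b_{i+2}-2b_{i+3}+3v)$, $v\cdot v=v$, $\langle b_i,b_i\rangle=1$, $\langle b_i,b_{i+1}\rangle=\frac1{2^5}$, $\langle b_i,b_{i+2}\rangle=0$, $\langle b_i,v\rangle=\frac38$, $\langle v,v\rangle=2$. **Theorem.** The category $\mathcal{C}_{4A}$ has a universal (initial) object $M_{4A}$, with coefficient ring $R_{4A}$. For $i\neq j$ in $\{1,2,3\}$ put $v_{(i,j)}=a_i+a_j+\frac13a_{-i}+\frac13a_{-j}-\frac{2^6}{3}a_i\cdot a_j$. Then $M_{4A}$ is $12$-dimensional, that is, a free $R_{4A}$-module of rank $12$, with basis $$a_1,\ a_{-1},\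 a_2,\ a_{-2},\ a_3,\ a_{-3},\ v_{(1,2)},\ v_{(1,3)},\ v_{(2,3)},\ a_1\cdot v_{(2,3)},\ a_2\cdot v_{(1,3)},\ a_3\cdot v_{(1,2)}.$$ Its coefficient ring is the polynomial ring $R_{4A}=\mathbb{R}[t]$ in $t=\langle a_1,v_{(2,3)}\rangle$; that is, the $\mathbb{R}$-algebra homomorphism $\mathbb{R}[X]\to R_{4A}$, $X\mapsto\langle a_1,v_{(2,3)}\rangle$, is an isomorphism. -/

import Mathlib

/-- The eigenvalues `1, 0, 1/4, 1/32` of the Monster fusion rule. -/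
inductive MonsterEigenvalue
  | one
  | zero
  | quarter
  | thirtySecond

namespace MonsterEigenvalue

/-- The real number that a symbol stands for. -/
noncomputable def val : MonsterEigenvalue → ℝ
  | one => 1
  | zero => 0
  | quarter => 1 / 4
  | thirtySecond => 1 / 32

/-- The Monster fusion rule. -/
def fusion : MonsterEigenvalue → MonsterEigenvalue → Set MonsterEigenvalue
  | one, one => {one}
  | one, zero => ∅
  | zero, one => ∅
  | zero, zero => {zero}
  | one, quarter => {quarter}
  | quarter, one => {quarter}
  | zero, quarter => {quarter}
  | quarter, zero => {quarter}
  | quarter, quarter => {one, zero}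
  | one, thirtySecond => {thirtySecond}
  | thirtySecond, one => {thirtySecond}
  | zero, thirtySecond => {thirtySecond}
  | thirtySecond, zero => {thirtySecond}
  | quarter, thirtySecond => {thirtySecond}
  | thirtySecond, quarter => {thirtySecond}
  | thirtySecond, thirtySecond => {one, zero, quarter}

end MonsterEigenvalue

/-- A commutative, not necessarily associative algebra `V` over a commutative `ℝ`-algebra `R`, with
six marked generators `a_{±1}, a_{±2}, a_{±3}` and a bilinear form that associates with the product.
The generator `a_{ε(i+1)}` is `ax i ε`, for `i : Fin 3` and a sign `ε : ℤˣ`.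
The coefficient ring `R` is nonzero (it contains `ℝ`), and it is generated over `ℝ` by the values of
the form on the monomials in the marked generators. So `R` and `V` are, up to isomorphism, quotients
of objects in `Type`, and nothing is lost by asking `R` and `V` to be in `Type`. -/
structure MarkedFrobeniusAlgebra where
  /-- the coefficient ring -/
  R : Type
  /-- the algebra -/
  V : Type
  [commRing : CommRing R]
  [nontrivial : Nontrivial R]
  [algebra : Algebra ℝ R]
  [mulRing : NonUnitalNonAssocCommRing V]
  [module : Module R V]
  [scalarTower : IsScalarTower R V V]
  [smulComm : SMulCommClass R V V]
  [realModule : Module ℝ V]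
  [realTower : IsScalarTower ℝ R V]
  /-- the marked generators -/
  ax : Fin 3 → ℤˣ → V
  /-- the bilinear form -/
  form : V →ₗ[R] V →ₗ[R] R
  form_assoc : ∀ u v w : V, form u (v * w) = form (u * v) w
  generated : NonUnitalAlgebra.adjoin R {x : V | ∃ i ε, x = ax i ε} = ⊤
  ring_generated : Algebra.adjoin ℝ
    {r : R | ∃ x ∈ Subsemigroup.closure {x : V | ∃ i ε, x = ax i ε},
      ∃ y ∈ Subsemigroup.closure {x : V | ∃ i ε, x = ax i ε}, r = form x y} = ⊤

namespace MarkedFrobeniusAlgebra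

attribute [instance] commRing nontrivial algebra mulRing module scalarTower smulComm realModule
  realTower

/-- A morphism: an `ℝ`-algebra homomorphism of the coefficient rings and a semilinear, multiplicative
map of the algebras which is compatible with the forms and maps marked generators to marked
generators. (Morphisms are automatically surjective, so the target is a quotient of the source.) -/
@[ext]
structure Hom (M N : MarkedFrobeniusAlgebra) where
  /-- the map of coefficient rings -/
  onRing : M.R →ₐ[ℝ] N.R
  /-- the map of algebras -/
  onAlg : M.V →ₙ+* N.V
  map_smul : ∀ (r : M.R) (x : M.V), onAlg (r • x) = onRing r • onAlg x
  map_form : ∀ x y : M.V, N.form (onAlg x) (onAlg y) = onRing (M.form x y)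
  map_ax : ∀ i ε, onAlg (M.ax i ε) = N.ax i ε

variable (M : MarkedFrobeniusAlgebra)

/-- The `μ`-eigenspace of the adjoint action of `a`. -/
def eigenspace (a : M.V) (μ : ℝ) : Submodule M.R M.V where
  carrier := {v | a * v = μ • v}
  add_mem' := by
    intro x y hx hy
    simp only [Set.mem_ofPred_eq] at *
    rw [mul_add, hx, hy, smul_add]
  zero_mem' := by simp
  smul_mem' := by
    intro r x hx
    simp only [Set.mem_ofPred_eq] at *
    rw [mul_smul_comm, hx, smul_comm]

/-- `a` is an axis for the Monster fusion rule: an idempotent such that `V` is the direct sum of the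
eigenspaces of `a` for `1, 0, 1/4, 1/32`, and these multiply according to the fusion rule. -/
structure IsMonsterAxis (a : M.V) : Prop where
  idem : a * a = a
  indep : iSupIndep fun e : MonsterEigenvalue => M.eigenspace a e.val
  span : ⨆ e : MonsterEigenvalue, M.eigenspace a e.val = ⊤
  fusion : ∀ e f : MonsterEigenvalue, ∀ x ∈ M.eigenspace a e.val, ∀ y ∈ M.eigenspace a f.val,
    x * y ∈ ⨆ g ∈ MonsterEigenvalue.fusion e f, M.eigenspace a g.val

/-- `V` is a primitive axial algebra of Monster type with respect to the marked generators, and the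
form has the customary normalization `⟨a, a⟩ = 1` on the axes. -/
structure IsPrimitiveMonster : Prop where
  axis : ∀ i ε, M.IsMonsterAxis (M.ax i ε)
  primitive : ∀ i ε, M.eigenspace (M.ax i ε) 1 = Submodule.span M.R {M.ax i ε}
  norm : ∀ i ε, M.form (M.ax i ε) (M.ax i ε) = 1

/-- `τ` is the Miyamoto involution `τ(a)` (it is unique if `a` is an axis). -/
def IsMiyamoto (a : M.V) (τ : M.V →ₗ[M.R] M.V) : Prop :=
  (∀ v ∈ M.eigenspace a 1, τ v = v) ∧ (∀ v ∈ M.eigenspace a 0, τ v = v) ∧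
    (∀ v ∈ M.eigenspace a (1 / 4), τ v = v) ∧ (∀ v ∈ M.eigenspace a (1 / 32), τ v = -v)

/-- Property P: the six marked axes are distinct, `τ(a_i) = τ(a_{-i})`, and this involution fixes
`a_i` and `a_{-i}` and swaps `a_j` and `a_{-j}` for `j ≠ i`. -/
def PropertyP : Prop :=
  (∀ i j ε δ, M.ax i ε = M.ax j δ → i = j ∧ ε = δ) ∧
  ∃ τ : Fin 3 → (M.V →ₗ[M.R] M.V), ∀ i ε, M.IsMiyamoto (M.ax i ε) (τ i) ∧
    ∀ δ, τ i (M.ax i δ) = M.ax i δ ∧ ∀ j, j ≠ i → τ i (M.ax j δ) = M.ax j (-δ)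

/-- The subalgebra generated by `b 0` and `b 1` is the dihedral algebra of type `4A`. Here `b` lists
the axes `b_0, b_1, b_2, b_3 = b_{-1}` in the cyclic order (the indices are modulo 4), and `v` is the
`4A`-axis. -/
def IsType4A (b : Fin 4 → M.V) : Prop :=
  ∃ v : M.V,
    LinearIndependent M.R ![b 0, b 1, b 2, b 3, v] ∧
    Submodule.span M.R {b 0, b 1, b 2, b 3, v} =
      (NonUnitalAlgebra.adjoin M.R {b 0, b 1}).toSubmodule ∧
    (∀ i, b i * b i = b i) ∧
    (∀ i, b i * b (i + 1) =
      (1 / 64 : ℝ) • ((3 : ℝ) • b i + (3 : ℝ) • b (i + 1) + b (i + 2) + b (i + 3) - (3 : ℝ) • v)) ∧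
    (∀ i, b i * b (i + 2) = 0) ∧
    (∀ i, b i * v =
      (1 / 16 : ℝ) • ((5 : ℝ) • b i - (2 : ℝ) • b (i + 1) - b (i + 2) - (2 : ℝ) • b (i + 3)
        + (3 : ℝ) • v)) ∧
    v * v = v ∧
    (∀ i, M.form (b i) (b i) = 1) ∧
    (∀ i, M.form (b i) (b (i + 1)) = algebraMap ℝ M.R (1 / 32)) ∧
    (∀ i, M.form (b i) (b (i + 2)) = 0) ∧
    (∀ i, M.form (b i) v = algebraMap ℝ M.R (3 / 8)) ∧
    M.form v v = 2

/-- Shape `4A`: the dihedral algebra generated by `a_1` and `a_2` is of type `4A`. The images of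
`a_1` and `a_2` under `τ(a_1)τ(a_2)` are `a_{-1}` and `a_{-2}`. -/
def HasShape4A : Prop :=
  M.IsType4A ![M.ax 0 1, M.ax 1 1, M.ax 0 (-1), M.ax 1 (-1)]

/-- `M` is a primitive Frobenius axial algebra of Monster type with property P and shape `4A`. -/
structure InC4A : Prop where
  monster : M.IsPrimitiveMonster
  propertyP : M.PropertyP
  shape : M.HasShape4A

/-- `M` is the universal primitive Frobenius axial algebra of Monster type with property P and
shape `4A`: the initial object among these algebras. -/
def IsUniversal4A : Prop :=
  M.InC4A ∧ ∀ N : MarkedFrobeniusAlgebra, N.InC4A → Nonempty (Unique (Hom M N))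

/-- The vector `v_{(i,j)} = a_i + a_j + (1/3) a_{-i} + (1/3) a_{-j} - (2^6/3) a_i a_j`. -/
noncomputable def v (i j : Fin 3) : M.V :=
  M.ax i 1 + M.ax j 1 + (1 / 3 : ℝ) • M.ax i (-1) + (1 / 3 : ℝ) • M.ax j (-1)
    - (2 ^ 6 / 3 : ℝ) • (M.ax i 1 * M.ax j 1)

/-- The twelve vectors `a_{±i}`, `v_{(1,2)}, v_{(1,3)}, v_{(2,3)}`, and
`a_1 v_{(2,3)}, a_2 v_{(1,3)}, a_3 v_{(1,2)}`. -/
noncomputable def basisVectors : Fin 12 → M.V :=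
  ![M.ax 0 1, M.ax 0 (-1), M.ax 1 1, M.ax 1 (-1), M.ax 2 1, M.ax 2 (-1),
    M.v 0 1, M.v 0 2, M.v 1 2,
    M.ax 0 1 * M.v 1 2, M.ax 1 1 * M.v 0 2, M.ax 2 1 * M.v 0 1]

/-- `t = ⟨a_1, v_{(2,3)}⟩`. -/
noncomputable def t : M.R := M.form (M.ax 0 1) (M.v 1 2)

end MarkedFrobeniusAlgebra

/-! Pass to c_i = a_i + a_{-i} and d_i = a_i - a_{-i}. Shape 4A is assumed for the first two pairs
only, and all that the construction of morphisms uses of it is a_1 a_{-1} = 0. Let x, x' and y, y'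
be pairs such that the involution of each swaps the axes of the other, with x x' = 0. An axis
satisfies a quadratic equation on the fixed vectors of its involution, and the flip that negates its
1/4-eigenspace is multiplicative there. Together these force ⟨x, y⟩ = 1/32 and then y y' = 0
(`form_eq`, `pair_mul_eq_zero`). So for all pairs c_i and d_i satisfy c_i c_i = c_i, d_i d_i = c_i
and d_i d_j = 0.

Consider the vectors fixed by all three involutions on which, for each i, the flips of a_i and
a_{-i} agree (`evenPart`). They form a subalgebra, as an equalizer of multiplicative maps, and it
contains the c_i. There d_i x = ⟨a_i, x⟩ d_i, and a common 1/4-eigenvector of a_i and a_{-i} is a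
1/2-eigenvector of c_i. So the c_i behave as idempotents of Jordan type 1/2, of length 1 and with
mutual inner products 1/16 for half the form. The identities in `JordanTriple` determine all
products of the nine vectors c_i, c_j c_k, c_i (c_j c_k) in terms of ψ = ⟨a_1, c_2 c_3⟩. With the
three d_i this gives twelve spanning vectors and one parameter, where t = 1/12 - (16/3) ψ.

Conversely, the table defines an algebra with ψ free (`JordanModel`). Its quadratic, flip and
associativity identities hold for every real ψ and therefore over ℝ[X]. Adjoining the d_i by the
rules above gives `MonsterModel`, in which the vectors (c_i ± d_i)/2 are checked to be axes with
property P and shape 4A. The same formulas map this model to every object of the category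
(`nonempty_hom`), and morphisms are unique because everything is generated by marked elements. Hence
the model is initial. The twelve vectors of the theorem are triangular with respect to its standard
basis, and any other initial object is isomorphic to it. -/

namespace MarkedFrobeniusAlgebra

variable (M : MarkedFrobeniusAlgebra)

/-! ### Generalities: eigenvector decomposition, Miyamoto involution and flip of an axis. -/

instance realScalarTower : IsScalarTower ℝ M.V M.V where
  smul_assoc r x y := by
    rw [smul_eq_mul, smul_eq_mul, ← algebraMap_smul M.R r x, ← algebraMap_smul M.R r (x * y),
      smul_mul_assoc]

instance realSMulComm : SMulCommClass ℝ M.V M.V where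
  smul_comm r x y := by
    rw [smul_eq_mul, smul_eq_mul, ← algebraMap_smul M.R r y, ← algebraMap_smul M.R r (x * y),
      mul_smul_comm]

variable {M}

theorem mem_eigenspace {a v : M.V} {μ : ℝ} : v ∈ M.eigenspace a μ ↔ a * v = μ • v := Iff.rfl

/-- The form is symmetric on products, since it associates with the commutative product. -/
theorem form_mul_comm (x y u : M.V) : M.form (x * y) u = M.form u (x * y) := by
  rw [M.form_assoc u x y, ← M.form_assoc x y u, mul_comm y u, M.form_assoc x u y, mul_comm x u]

theorem form_real_smul_right (r : ℝ) (x y : M.V) : M.form x (r • y) = r • M.form x y := by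
  rw [← algebraMap_smul M.R r y, map_smul, algebraMap_smul]

theorem form_real_smul_left (r : ℝ) (x y : M.V) : M.form (r • x) y = r • M.form x y := by
  rw [← algebraMap_smul M.R r x, map_smul, LinearMap.smul_apply, algebraMap_smul]

theorem real_smul_cancel {E : Type*} [AddCommGroup E] [Module ℝ E] {r : ℝ} (hr : r ≠ 0) {x : E}
    (h : r • x = 0) : x = 0 := (smul_eq_zero.mp h).resolve_left hr

/-- Vectors in eigenspaces for distinct eigenvalues are orthogonal. -/
theorem form_eigen_eigen {a x y : M.V} {μ ν : ℝ} (hx : x ∈ M.eigenspace a μ)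
    (hy : y ∈ M.eigenspace a ν) (h : μ ≠ ν) : M.form x y = 0 := by
  rw [mem_eigenspace] at hx hy
  have h1 := M.form_assoc x a y
  rw [mul_comm x a, hx, hy, form_real_smul_left, form_real_smul_right] at h1
  refine real_smul_cancel (sub_ne_zero.mpr h) ?_
  rw [sub_smul, h1, sub_self]

/-- An axis that spans its `1`-eigenspace and has length one. -/
structure IsUnitAxis (a : M.V) : Prop extends M.IsMonsterAxis a where
  primitive : M.eigenspace a 1 = Submodule.span M.R {a}
  norm : M.form a a = 1

theorem IsPrimitiveMonster.isUnitAxis (h : M.IsPrimitiveMonster) (i : Fin 3) (ε : ℤˣ) :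
    IsUnitAxis (M.ax i ε) := ⟨h.axis i ε, h.primitive i ε, h.norm i ε⟩

/-- The form is symmetric as soon as the algebra is generated by idempotents. -/
theorem form_comm (h : ∀ i ε, M.ax i ε * M.ax i ε = M.ax i ε) (x y : M.V) :
    M.form x y = M.form y x := by
  have hx : x ∈ NonUnitalAlgebra.adjoin M.R {x : M.V | ∃ i ε, x = M.ax i ε} := by
    rw [M.generated]; trivial
  induction hx using NonUnitalAlgebra.adjoin_induction with
  | mem x hx =>
    obtain ⟨i, ε, rfl⟩ := hx
    rw [← h i ε, form_mul_comm]
  | add x y _ _ hx hy => simp [hx, hy]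
  | zero => simp
  | mul x y _ _ _ _ => rw [form_mul_comm]
  | smul r x _ hx => simp [hx]

section Axis

variable {a : M.V} (ha : IsUnitAxis a)
include ha

/-- The other eigenspaces are orthogonal to `a`, so pairing with `a` reads off the coefficient in
the 1-eigenspace. -/
theorem IsUnitAxis.exists_decomp (x : M.V) : ∃ x₀ ∈ M.eigenspace a 0, ∃ x₁ ∈ M.eigenspace a (1 / 4),
    ∃ x₂ ∈ M.eigenspace a (1 / 32), x = M.form a x • a + x₀ + x₁ + x₂ := by
  have hx : x ∈ ⨆ e : MonsterEigenvalue, M.eigenspace a e.val := by rw [ha.span]; trivial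
  have haa : a ∈ M.eigenspace a 1 := by rw [mem_eigenspace, ha.idem, one_smul]
  induction hx using Submodule.iSup_induction' with
  | mem e x hx =>
    cases e with
    | one =>
      have h1 : x ∈ M.eigenspace a 1 := hx
      rw [ha.primitive, Submodule.mem_span_singleton] at h1
      obtain ⟨r, rfl⟩ := h1
      exact ⟨0, zero_mem _, 0, zero_mem _, 0, zero_mem _, by simp [ha.norm]⟩
    | zero =>
      exact ⟨x, hx, 0, zero_mem _, 0, zero_mem _, by
        rw [form_eigen_eigen haa hx (by norm_num [MonsterEigenvalue.val])]; simp⟩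
    | quarter =>
      exact ⟨0, zero_mem _, x, hx, 0, zero_mem _, by
        rw [form_eigen_eigen haa hx (by norm_num [MonsterEigenvalue.val])]; simp⟩
    | thirtySecond =>
      exact ⟨0, zero_mem _, 0, zero_mem _, x, hx, by
        rw [form_eigen_eigen haa hx (by norm_num [MonsterEigenvalue.val])]; simp⟩
  | zero => exact ⟨0, zero_mem _, 0, zero_mem _, 0, zero_mem _, by simp⟩
  | add x y _ _ hx hy =>
    obtain ⟨x₀, h₀, x₁, h₁, x₂, h₂, hx⟩ := hx
    obtain ⟨y₀, k₀, y₁, k₁, y₂, k₂, hy⟩ := hy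
    refine ⟨x₀ + y₀, add_mem h₀ k₀, x₁ + y₁, add_mem h₁ k₁, x₂ + y₂, add_mem h₂ k₂, ?_⟩
    rw [map_add, add_smul]
    nth_rewrite 1 [hx, hy]
    abel

variable {τ : M.V →ₗ[M.R] M.V} (hτ : M.IsMiyamoto a τ)
include hτ

/-- The involution negates the 1/32-component, so for a fixed vector twice that component is zero.
-/
theorem IsUnitAxis.exists_decomp_of_fixed {x : M.V} (hx : τ x = x) : ∃ x₀ x₁ : M.V,
    a * x₀ = 0 ∧ a * x₁ = (1 / 4 : ℝ) • x₁ ∧ x = M.form a x • a + x₀ + x₁ := by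
  obtain ⟨x₀, h₀, x₁, h₁, x₂, h₂, h⟩ := ha.exists_decomp x
  have haa : a ∈ M.eigenspace a 1 := by rw [mem_eigenspace, ha.idem, one_smul]
  have h3 : τ x = M.form a x • a + x₀ + x₁ - x₂ := by
    nth_rewrite 1 [h]
    rw [map_add, map_add, map_add, map_smul, hτ.1 a haa, hτ.2.1 _ h₀, hτ.2.2.1 _ h₁, hτ.2.2.2 _ h₂]
    abel
  have h4 : x₂ = 0 := by
    refine real_smul_cancel (r := 2) (by norm_num) ?_
    rw [two_smul]
    have : τ x + 2 • x₂ = x := by rw [h3, two_smul]; nth_rewrite 2 [h]; abel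
    rw [hx, two_smul] at this
    exact left_eq_add.mp this.symm
  refine ⟨x₀, x₁, by simpa using mem_eigenspace.mp h₀, h₁, ?_⟩
  nth_rewrite 1 [h]
  rw [h4, add_zero]

theorem IsUnitAxis.mul_of_negated {x : M.V} (hx : τ x = -x) : a * x = (1 / 32 : ℝ) • x := by
  obtain ⟨x₀, h₀, x₁, h₁, x₂, h₂, h⟩ := ha.exists_decomp x
  have haa : a ∈ M.eigenspace a 1 := by rw [mem_eigenspace, ha.idem, one_smul]
  have h3 : τ x = M.form a x • a + x₀ + x₁ - x₂ := by
    nth_rewrite 1 [h]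
    rw [map_add, map_add, map_add, map_smul, hτ.1 a haa, hτ.2.1 _ h₀, hτ.2.2.1 _ h₁, hτ.2.2.2 _ h₂]
    abel
  have h4 : M.form a x • a + x₀ + x₁ = 0 := by
    refine real_smul_cancel (r := 2) (by norm_num) ?_
    have : τ x + x = (2 : ℝ) • (M.form a x • a + x₀ + x₁) := by
      rw [h3, two_smul]; nth_rewrite 2 [h]; abel
    rw [← this, hx, neg_add_cancel]
  rw [h4, zero_add] at h
  rw [h]
  exact h₂

/-- The sign of the Miyamoto involution on an eigenspace. -/
def _root_.MonsterEigenvalue.sign : MonsterEigenvalue → ℤˣ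
  | .thirtySecond => -1
  | _ => 1

omit ha in
theorem IsMiyamoto.apply_eigen {e : MonsterEigenvalue} {x : M.V} (hx : x ∈ M.eigenspace a e.val) :
    τ x = e.sign • x := by
  cases e with
  | one => simpa [MonsterEigenvalue.sign] using hτ.1 x hx
  | zero => simpa [MonsterEigenvalue.sign] using hτ.2.1 x hx
  | quarter => simpa [MonsterEigenvalue.sign] using hτ.2.2.1 x hx
  | thirtySecond => simpa [MonsterEigenvalue.sign] using hτ.2.2.2 x hx

omit ha hτ in
-- The fusion rule is graded by a group of order two, with 1/32 as the odd part. This grading is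
-- what makes the Miyamoto involution multiplicative.
theorem _root_.MonsterEigenvalue.sign_fusion {e f g : MonsterEigenvalue}
    (h : g ∈ MonsterEigenvalue.fusion e f) : g.sign = e.sign * f.sign := by
  cases e <;> cases f <;> cases g <;>
    simp_all [MonsterEigenvalue.sign, MonsterEigenvalue.fusion]

theorem IsUnitAxis.miyamoto_mul (x y : M.V) : τ (x * y) = τ x * τ y := by
  have hx : x ∈ ⨆ e : MonsterEigenvalue, M.eigenspace a e.val := by rw [ha.span]; trivial
  have hy : y ∈ ⨆ e : MonsterEigenvalue, M.eigenspace a e.val := by rw [ha.span]; trivial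
  induction hx using Submodule.iSup_induction' with
  | zero => simp
  | add x x' _ _ hx hx' => rw [add_mul, map_add, hx, hx', map_add, add_mul]
  | mem e x hx =>
    induction hy using Submodule.iSup_induction' with
    | zero => simp
    | add x x' _ _ hx hx' => rw [mul_add, map_add, hx, hx', map_add, mul_add]
    | mem f y hy =>
      rw [hτ.apply_eigen hx, hτ.apply_eigen hy, smul_mul_smul_comm]
      suffices h : ⨆ g ∈ MonsterEigenvalue.fusion e f, M.eigenspace a g.val ≤
          LinearMap.eqLocus τ ((e.sign * f.sign) • LinearMap.id) from
        h (ha.fusion e f x hx y hy)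
      refine iSup₂_le fun g hg z hz => ?_
      rw [LinearMap.mem_eqLocus, hτ.apply_eigen hz, MonsterEigenvalue.sign_fusion hg]
      rfl

/-- Distinct eigenspaces are orthogonal, and on a single one the two signs cancel. -/
theorem IsUnitAxis.form_miyamoto (x y : M.V) : M.form (τ x) (τ y) = M.form x y := by
  have hx : x ∈ ⨆ e : MonsterEigenvalue, M.eigenspace a e.val := by rw [ha.span]; trivial
  have hy : y ∈ ⨆ e : MonsterEigenvalue, M.eigenspace a e.val := by rw [ha.span]; trivial
  induction hx using Submodule.iSup_induction' with
  | zero => simp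
  | add x x' _ _ hx hx' => simp [hx, hx']
  | mem e x hx =>
    induction hy using Submodule.iSup_induction' with
    | zero => simp
    | add x x' _ _ hx hx' => simp [hx, hx']
    | mem f y hy =>
      rw [hτ.apply_eigen hx, hτ.apply_eigen hy]
      by_cases hef : e = f
      · subst hef
        rcases Int.units_eq_one_or e.sign with h | h <;> simp [h]
      · have h0 : M.form x y = 0 := by
          refine form_eigen_eigen hx hy ?_
          cases e <;> cases f <;> simp_all [MonsterEigenvalue.val]
        rcases Int.units_eq_one_or e.sign with h | h <;>
          rcases Int.units_eq_one_or f.sign with h' | h' <;> simp [h, h', h0]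

/-- The quadratic equation that an axis satisfies on the fixed vectors of its involution. -/
theorem IsUnitAxis.mul_mul_of_fixed {x : M.V} (hx : τ x = x) :
    a * (a * x) = (1 / 4 : ℝ) • (a * x) + (3 / 4 : ℝ) • (M.form a x • a) := by
  obtain ⟨x₀, x₁, h₀, h₁, h⟩ := ha.exists_decomp_of_fixed hτ hx
  have h2 : a * x = M.form a x • a + (1 / 4 : ℝ) • x₁ := by
    nth_rewrite 1 [h]
    rw [mul_add, mul_add, mul_smul_comm, ha.idem, h₀, h₁, add_zero]
  rw [h2, mul_add, mul_smul_comm, ha.idem, mul_smul_comm, h₁]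
  match_scalars <;> algebra

/-- On the fixed vectors of the Miyamoto involution, the map that negates the `1/4`-eigenspace and
is the identity on the other eigenspaces is multiplicative. -/
theorem IsUnitAxis.flip_mul {x y : M.V} (hx : τ x = x) (hy : τ y = y) :
    x * y - (8 : ℝ) • (a * (x * y)) + (8 : ℝ) • (M.form a (x * y) • a) =
      (x - (8 : ℝ) • (a * x) + (8 : ℝ) • (M.form a x • a)) *
        (y - (8 : ℝ) • (a * y) + (8 : ℝ) • (M.form a y • a)) := by
  obtain ⟨x₀, x₁, h₀, h₁, h⟩ := ha.exists_decomp_of_fixed hτ hx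
  obtain ⟨y₀, y₁, k₀, k₁, k⟩ := ha.exists_decomp_of_fixed hτ hy
  generalize M.form a x = r at *
  generalize M.form a y = s at *
  subst h k
  have e0 {z : M.V} (hz : a * z = 0) : z ∈ M.eigenspace a MonsterEigenvalue.zero.val := by
    rw [mem_eigenspace, hz]; simp [MonsterEigenvalue.val]
  have e1 {z : M.V} (hz : a * z = (1 / 4 : ℝ) • z) :
      z ∈ M.eigenspace a MonsterEigenvalue.quarter.val := hz
  have haa : a ∈ M.eigenspace a 1 := by rw [mem_eigenspace, ha.idem, one_smul]
  have q00 : a * (x₀ * y₀) = 0 := by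
    have := ha.fusion _ _ _ (e0 h₀) _ (e0 k₀)
    simpa [MonsterEigenvalue.fusion, mem_eigenspace, MonsterEigenvalue.val] using this
  have q01 : a * (x₀ * y₁) = (1 / 4 : ℝ) • (x₀ * y₁) := by
    have := ha.fusion _ _ _ (e0 h₀) _ (e1 k₁)
    simpa [MonsterEigenvalue.fusion, mem_eigenspace, MonsterEigenvalue.val] using this
  have q10 : a * (x₁ * y₀) = (1 / 4 : ℝ) • (x₁ * y₀) := by
    have := ha.fusion _ _ _ (e1 h₁) _ (e0 k₀)
    simpa [MonsterEigenvalue.fusion, mem_eigenspace, MonsterEigenvalue.val] using this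
  -- The product is a multiple of `a` plus a 0-eigenvector. The latter is killed by `a` and
  -- orthogonal to it, so the multiple is the inner product with `a`.
  have q11 : a * (x₁ * y₁) = M.form a (x₁ * y₁) • a := by
    have := ha.fusion _ _ _ (e1 h₁) _ (e1 k₁)
    simp only [MonsterEigenvalue.fusion, Set.mem_insert_iff, Set.mem_singleton_iff, iSup_or,
      iSup_sup_eq, iSup_iSup_eq_left, Submodule.mem_sup] at this
    obtain ⟨u, hu, w, hw, huw⟩ := this
    have hu' : u ∈ M.eigenspace a 1 := hu
    have hw' : w ∈ M.eigenspace a 0 := hw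
    rw [ha.primitive, Submodule.mem_span_singleton] at hu'
    obtain ⟨p, rfl⟩ := hu'
    rw [← huw, map_add, form_eigen_eigen haa hw' (by norm_num), mul_add, mem_eigenspace.mp hw',
      mul_smul_comm, ha.idem, map_smul, ha.norm]
    simp
  have f00 : M.form a (x₀ * y₀) = 0 := by
    have h1 := M.form_assoc a x₀ y₀
    rwa [h₀, map_zero, LinearMap.zero_apply] at h1
  have f01 : M.form a (x₀ * y₁) = 0 := by
    have h1 := M.form_assoc a x₀ y₁
    rwa [h₀, map_zero, LinearMap.zero_apply] at h1
  have f10 : M.form a (x₁ * y₀) = 0 := by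
    have h1 := M.form_assoc a y₀ x₁
    rwa [k₀, map_zero, LinearMap.zero_apply, mul_comm] at h1
  have f1 : M.form a x₁ = 0 := form_eigen_eigen haa (e1 h₁) (by norm_num [MonsterEigenvalue.val])
  have g1 : M.form a y₁ = 0 := form_eigen_eigen haa (e1 k₁) (by norm_num [MonsterEigenvalue.val])
  have h₀' : x₀ * a = 0 := by rw [mul_comm, h₀]
  have h₁' : x₁ * a = (1 / 4 : ℝ) • x₁ := by rw [mul_comm, h₁]
  simp only [mul_add, add_mul, mul_sub, sub_mul, smul_mul_assoc, mul_smul_comm, map_add, map_smul,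
    form_real_smul_right, ha.idem, h₀, h₁, h₀', h₁', k₀, k₁, q00, q01, q10, q11, f00, f01, f10, f1,
    g1, ha.norm, smul_zero, add_zero, zero_add, smul_eq_mul]
  match_scalars <;> algebra

end Axis

end MarkedFrobeniusAlgebra

/-! ### Two pairs of axes that are swapped by each other's involutions. -/

namespace MarkedFrobeniusAlgebra

variable {M : MarkedFrobeniusAlgebra}

/-- The part of a product of two axes that is invariant under both involutions. -/
noncomputable def cross (x y : M.V) : M.V := x * y - (1 / 32 : ℝ) • (x + y)

theorem cross_comm (x y : M.V) : cross x y = cross y x := by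
  rw [cross, cross, mul_comm, add_comm]

/-- Two pairs of axes such that the involution of either pair swaps the axes of the other pair. -/
structure SwappedPairs (x x' y y' : M.V) (τ σ : M.V →ₗ[M.R] M.V) : Prop where
  symm : ∀ u v : M.V, M.form u v = M.form v u
  axis_x : IsUnitAxis x
  axis_x' : IsUnitAxis x'
  axis_y : IsUnitAxis y
  axis_y' : IsUnitAxis y'
  miyamoto_x : M.IsMiyamoto x τ
  miyamoto_x' : M.IsMiyamoto x' τ
  miyamoto_y : M.IsMiyamoto y σ
  miyamoto_y' : M.IsMiyamoto y' σ
  τx : τ x = x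
  τx' : τ x' = x'
  τy : τ y = y'
  τy' : τ y' = y
  σy : σ y = y
  σy' : σ y' = y'
  σx : σ x = x'
  σx' : σ x' = x

namespace SwappedPairs

section

variable {x x' y y' : M.V} {τ σ : M.V →ₗ[M.R] M.V} (h : SwappedPairs x x' y y' τ σ)
include h

theorem flip : SwappedPairs y y' x x' σ τ where
  symm := h.symm
  axis_x := h.axis_y
  axis_x' := h.axis_y'
  axis_y := h.axis_x
  axis_y' := h.axis_x'
  miyamoto_x := h.miyamoto_y
  miyamoto_x' := h.miyamoto_y'
  miyamoto_y := h.miyamoto_x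
  miyamoto_y' := h.miyamoto_x'
  τx := h.σy
  τx' := h.σy'
  τy := h.σx
  τy' := h.σx'
  σy := h.τx
  σy' := h.τx'
  σx := h.τy
  σx' := h.τy'

theorem neg_left : SwappedPairs x' x y y' τ σ where
  symm := h.symm
  axis_x := h.axis_x'
  axis_x' := h.axis_x
  axis_y := h.axis_y
  axis_y' := h.axis_y'
  miyamoto_x := h.miyamoto_x'
  miyamoto_x' := h.miyamoto_x
  miyamoto_y := h.miyamoto_y
  miyamoto_y' := h.miyamoto_y'
  τx := h.τx'
  τx' := h.τx
  τy := h.τy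
  τy' := h.τy'
  σy := h.σy
  σy' := h.σy'
  σx := h.σx'
  σx' := h.σx

theorem neg_right : SwappedPairs x x' y' y τ σ := h.flip.neg_left.flip

theorem form_x'y : M.form x' y = M.form x y := by
  have := h.axis_y.form_miyamoto h.miyamoto_y x y
  rwa [h.σx, h.σy] at this

theorem form_xy' : M.form x y' = M.form x y := by
  have := h.axis_x.form_miyamoto h.miyamoto_x x y
  rwa [h.τx, h.τy] at this

theorem form_x'y' : M.form x' y' = M.form x y := by
  rw [h.neg_left.form_xy', h.form_x'y]

/-- The difference y - y' is negated by `τ`, hence is a 1/32-eigenvector of `x`. -/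
theorem mul_xy' : x * y' = x * y - (1 / 32 : ℝ) • y + (1 / 32 : ℝ) • y' := by
  have h1 := h.axis_x.mul_of_negated h.miyamoto_x (x := y - y')
    (by rw [map_sub, h.τy, h.τy', neg_sub])
  rw [mul_sub, smul_sub] at h1
  linear_combination (norm := abel) -h1

theorem mul_x'y : x' * y = x * y - (1 / 32 : ℝ) • x + (1 / 32 : ℝ) • x' := by
  rw [mul_comm, h.flip.mul_xy', mul_comm]

/-- Since y + y' is fixed by `τ` and x (y + y') is twice the cross vector plus a combination of
axes, the quadratic equation of `x` on y + y' can be solved for this product. -/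
theorem mul_cross : x * cross x y = (7 / 32 : ℝ) • cross x y + (3 / 4 : ℝ) • (M.form x y • x)
    - (25 / 1024 : ℝ) • x + (7 / 2048 : ℝ) • y + (7 / 2048 : ℝ) • y' := by
  have h1 := h.axis_x.mul_mul_of_fixed h.miyamoto_x (x := y + y')
    (by rw [map_add, h.τy, h.τy', add_comm])
  rw [mul_add, h.mul_xy', map_add, h.form_xy'] at h1
  simp only [cross, mul_add, mul_sub, smul_add, mul_smul_comm, h.mul_xy', h.axis_x.idem] at h1 ⊢
  linear_combination (norm := skip) (1 / 2 : ℝ) • h1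
  match_scalars <;> algebra

theorem cross_neg_left : cross x' y = cross x y := by
  rw [cross, cross, h.mul_x'y]
  match_scalars <;> algebra

theorem cross_neg_right : cross x y' = cross x y := by
  rw [cross, cross, h.mul_xy']
  match_scalars <;> algebra

theorem cross_neg_neg : cross x' y' = cross x y := by
  rw [h.neg_left.cross_neg_right, h.cross_neg_left]

theorem form_cross : M.form x (cross x y) = (31 / 32 : ℝ) • M.form x y
    - algebraMap ℝ M.R (1 / 32) := by
  rw [cross, map_sub, form_real_smul_right, map_add, M.form_assoc, h.axis_x.idem, h.axis_x.norm]
  algebra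

/-- The square of `x * y - (1 / 32) (x + y)`, from the multiplicativity of the flip of `y`. -/
theorem cross_mul_cross (h0 : x * x' = 0) : cross x y * cross x y =
    ((1 / 4 : ℝ) • M.form x y - algebraMap ℝ M.R (15 / 512)) • cross x y
    + ((19 / 256 : ℝ) • M.form x y - algebraMap ℝ M.R (55 / 32768)) • (x + x')
    + ((1 / 2 : ℝ) • M.form x y ^ 2 + (3 / 128 : ℝ) • M.form x y
        - algebraMap ℝ M.R (19 / 32768)) • y
    + (21 / 32768 : ℝ) • y' := by
  have hz : (x + x') * (x + x') = x + x' := by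
    rw [add_mul, mul_add, mul_add, h0, mul_comm x' x, h0, h.axis_x.idem, h.axis_x'.idem, zero_add,
      add_zero]
  have hσ : σ (x + x') = x + x' := by rw [map_add, h.σx, h.σx', add_comm]
  have hf : M.form y (x + x') = 2 * M.form x y := by
    rw [map_add, h.symm y, h.symm y, h.form_x'y, two_mul]
  -- The vector x + x' is an idempotent fixed by `σ`. Its flip contains the cross vector with
  -- coefficient -16, so the square that is sought enters with the factor 256.
  have h1 := h.axis_y.flip_mul h.miyamoto_y hσ hσ
  rw [hz, hf] at h1
  have e1 : y * x = cross x y + (1 / 32 : ℝ) • (x + y) := by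
    rw [mul_comm, cross, sub_add_cancel]
  have e2 : y * x' = cross x y + (1 / 32 : ℝ) • (x' + y) := by
    rw [← h.cross_neg_left, mul_comm, cross, sub_add_cancel]
  have f1 := h.mul_cross
  have f2 := h.neg_left.mul_cross
  have f3 := h.flip.mul_cross
  rw [h.cross_neg_left, h.form_x'y] at f2
  rw [cross_comm, h.symm y] at f3
  have g0 : x' * x = 0 := by rw [mul_comm, h0]
  have g1 := mul_comm x y ▸ e1
  have g2 := mul_comm x' y ▸ e2
  generalize cross x y = s at *
  have k1 := mul_comm x s ▸ f1
  have k2 := mul_comm x' s ▸ f2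
  have k3 := mul_comm y s ▸ f3
  generalize M.form x y = l at *
  simp only [mul_add, add_mul, mul_sub, sub_mul, smul_mul_assoc, mul_smul_comm, smul_add, smul_sub,
    h.axis_x.idem, h.axis_x'.idem, h.axis_y.idem, h0, g0, e1, e2, f1, f2, f3, g1, g2, k1, k2,
    k3, smul_zero, add_zero, zero_add] at h1
  linear_combination (norm := skip) (-1 / 256 : ℝ) • h1
  match_scalars <;> algebra

/-- Associativity turns the left side into ⟨x y, y'⟩, and the cross vector is the same for `y` and
`y'`, so its inner product with `y'` is known. -/
theorem form_mul_pair : M.form x (y * y') = M.form x y + (1 / 32 : ℝ) • M.form y y'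
    - algebraMap ℝ M.R (1 / 32) := by
  have e1 : x * y = cross x y + (1 / 32 : ℝ) • (x + y) := by rw [cross, sub_add_cancel]
  have e2 : M.form (cross x y) y' = (31 / 32 : ℝ) • M.form x y - algebraMap ℝ M.R (1 / 32) := by
    rw [← h.cross_neg_right, h.symm, cross_comm, h.neg_right.flip.form_cross, h.symm, h.form_xy']
  rw [M.form_assoc, e1, map_add, LinearMap.add_apply, e2, form_real_smul_left, map_add,
    LinearMap.add_apply, h.form_xy']
  algebra

/-- The flip of `x` is applied to the square of y + y', which is y + y' + 2 y y'. With the square of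
the cross vector known, x (y y') is the only unknown. -/
theorem mul_mul_pair (h0 : x * x' = 0) : x * (y * y') =
    (8 * M.form x y ^ 2 + (3 / 16 : ℝ) • M.form x y + (1 / 32 : ℝ) • M.form y y'
      - algebraMap ℝ M.R (7 / 512)) • x
    + (algebraMap ℝ M.R (19 / 512) - (19 / 16 : ℝ) • M.form x y) • x'
    + (-8 * M.form x y ^ 2 + (13 / 16 : ℝ) • M.form x y - algebraMap ℝ M.R (9 / 512)) • y
    + ((19 / 16 : ℝ) • M.form x y - algebraMap ℝ M.R (19 / 512)) • y'
    + (7 / 128 : ℝ) • (y * y') := by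
  have hτ : τ (y + y') = y + y' := by rw [map_add, h.τy, h.τy', add_comm]
  have h1 := h.axis_x.flip_mul h.miyamoto_x hτ hτ
  have e1 : x * y = cross x y + (1 / 32 : ℝ) • (x + y) := by rw [cross, sub_add_cancel]
  have e2 : x * y' = cross x y + (1 / 32 : ℝ) • (x + y') := by
    rw [← h.cross_neg_right, cross, sub_add_cancel]
  have f1 := h.mul_cross
  have f2 := h.flip.mul_cross
  have f3 := h.flip.neg_left.mul_cross
  rw [cross_comm, h.symm y] at f2
  rw [cross_comm, h.symm y', h.form_xy', h.cross_neg_right] at f3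
  have p1 : y' * y = y * y' := mul_comm _ _
  have p2 := h.form_mul_pair
  have p3 := h.form_xy'
  have p4 := h.cross_mul_cross h0
  simp only [mul_add, add_mul, h.axis_y.idem, h.axis_y'.idem, map_add, p1, p2, p3] at h1
  generalize cross x y = s at *
  have g1 := mul_comm x y ▸ e1
  have g2 := mul_comm x y' ▸ e2
  have k1 := mul_comm x s ▸ f1
  have k2 := mul_comm y s ▸ f2
  have k3 := mul_comm y' s ▸ f3
  generalize M.form x y = l at *
  generalize M.form y y' = n at *
  simp only [mul_add, add_mul, mul_sub, sub_mul, smul_mul_assoc, mul_smul_comm, smul_add, smul_sub,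
    h.axis_x.idem, h.axis_y.idem, h.axis_y'.idem, e1, e2, f1, f2, f3, g1, g2, k1, k2,
    k3, p1, p4] at h1
  linear_combination (norm := skip) (-1 / 16 : ℝ) • h1
  match_scalars <;> algebra

/-- The product of the axes of a pair is spanned by the axes and the invariant vector. -/
theorem pair_eq (h0 : x * x' = 0) : (175 / 16384 : ℝ) • (y * y') =
    ((99 / 16 : ℝ) • M.form x y ^ 2 - (1099 / 2048 : ℝ) • M.form x y
      + (7 / 4096 : ℝ) • M.form y y' + algebraMap ℝ M.R (703 / 65536)) • x
    + ((475 / 2048 : ℝ) • M.form x y - algebraMap ℝ M.R (475 / 65536)) • x'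
    + ((21 / 16 : ℝ) • M.form x y ^ 2 - (273 / 2048 : ℝ) • M.form x y
      + algebraMap ℝ M.R (189 / 65536)) • y
    + (algebraMap ℝ M.R (399 / 65536) - (399 / 2048 : ℝ) • M.form x y) • y'
    + (-8 * M.form x y ^ 2 + 2 * M.form x y - algebraMap ℝ M.R (7 / 128)) • cross x y := by
  have hτ : τ (y * y') = y * y' := by
    rw [h.axis_x.miyamoto_mul h.miyamoto_x, h.τy, h.τy', mul_comm]
  -- Multiplication by `x` sends y y' to (7/128) y y' plus axes. The quadratic equation does not
  -- cancel y y', as (1/4)(7/128) - (7/128)² = 175/16384.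
  have h1 := h.axis_x.mul_mul_of_fixed h.miyamoto_x hτ
  have e1 : x * y = cross x y + (1 / 32 : ℝ) • (x + y) := by rw [cross, sub_add_cancel]
  have e2 : x * y' = cross x y + (1 / 32 : ℝ) • (x + y') := by
    rw [← h.cross_neg_right, cross, sub_add_cancel]
  simp only [h.mul_mul_pair h0, h.form_mul_pair, mul_add, mul_smul_comm, h.axis_x.idem, h0, e1, e2,
    smul_zero, add_zero] at h1
  generalize cross x y = s at *
  generalize M.form x y = l at *
  generalize M.form y y' = n at *
  linear_combination (norm := skip) (-1 : ℝ) • h1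
  match_scalars <;> algebra

/-- The formula for y y' is not symmetric in `x` and `x'`. Exchanging them gives a second
expression, and the two are compared by pairing with `x`. -/
theorem form_pair_relation (h0 : x * x' = 0) : 405504 * M.form x y ^ 2 - 50368 * M.form x y
    + 112 * M.form y y' + 1178 = 0 := by
  have h1 := h.pair_eq h0
  have h2 := h.neg_left.pair_eq (by rw [mul_comm, h0])
  rw [h.cross_neg_left, h.form_x'y] at h2
  have hf : M.form x x' = 0 := by
    have := M.form_assoc x x x'
    rwa [h0, map_zero, h.axis_x.idem, eq_comm] at this
  have h3 := congrArg (M.form x) (h1.symm.trans h2)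
  simp only [map_add, map_smul, h.axis_x.norm, hf, smul_eq_mul, h.form_cross,
    h.form_xy'] at h3
  generalize M.form x y = l at *
  generalize M.form y y' = n at *
  linear_combination (norm := algebra) (65536 : ℝ) • h3

theorem form_pair (h0 : x * x' = 0) : M.form y y' = (3148 / 7 : ℝ) • M.form x y
    - (25344 / 7 : ℝ) • M.form x y ^ 2 - algebraMap ℝ M.R (589 / 56) := by
  linear_combination (norm := algebra) (1 / 112 : ℝ) • h.form_pair_relation h0

/-- If the axes of one pair annihilate each other, the dihedral algebra is of type `4A`. -/
theorem form_eq (h0 : x * x' = 0) : M.form x y = algebraMap ℝ M.R (1 / 32) := by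
  have hf : M.form x x' = 0 := by
    have := M.form_assoc x x x'
    rwa [h0, map_zero, h.axis_x.idem, eq_comm] at this
  have hy : M.form y (y * y') = M.form y y' := by rw [M.form_assoc, h.axis_y.idem]
  have hs : M.form y (cross x y) = (31 / 32 : ℝ) • M.form x y - algebraMap ℝ M.R (1 / 32) := by
    rw [cross_comm, h.flip.form_cross, h.symm]
  have h1 := congrArg (M.form x) (h.pair_eq h0)
  have h2 := congrArg (M.form y) (h.pair_eq h0)
  simp only [map_add, map_smul, form_real_smul_right, h.axis_x.norm, hf, smul_eq_mul, h.form_cross,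
    h.form_xy', h.form_mul_pair, h.form_pair h0] at h1
  simp only [map_add, map_smul, form_real_smul_right, h.axis_y.norm, smul_eq_mul, hs, hy,
    h.symm y x, h.symm y x', h.form_x'y, h.form_pair h0] at h2
  generalize M.form x y = l at *
  -- The two pairings are polynomial equations in `l` alone. These Bézout coefficients show that l -
  -- 1/32 lies in the ideal that they generate.
  linear_combination (norm := algebra)
    (algebraMap ℝ M.R (256356463542272 / 9012683342163)
      - (3181320045854720 / 9012683342163 : ℝ) • l) * h1
    + (algebraMap ℝ M.R (43803901952 / 29167260007)
      - (285013442560 / 87501780021 : ℝ) • l) * h2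

/-- At ⟨x, y⟩ = 1/32 also ⟨y, y'⟩ = 0, and every coefficient on the right of `pair_eq` vanishes. -/
theorem pair_mul_eq_zero (h0 : x * x' = 0) : y * y' = 0 := by
  have h1 := h.pair_eq h0
  rw [h.form_pair h0, h.form_eq h0] at h1
  refine real_smul_cancel (r := 175 / 16384) (by norm_num) (h1.trans ?_)
  match_scalars <;> algebra

end

end SwappedPairs

end MarkedFrobeniusAlgebra

/-! ### The multiplication table forced on three idempotents of Jordan type 1/2. -/

/-- Three idempotents of Jordan type `1/2` in a subalgebra `S` of a commutative algebra, with mutual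
inner products `1/16`. -/
structure JordanTriple {R V : Type*} [CommRing R] [Algebra ℝ R] [NonUnitalNonAssocCommRing V]
    [Module R V] [Module ℝ V] (S : NonUnitalSubalgebra R V) (β : V →ₗ[R] V →ₗ[R] R) (a b c : V)
    (ψ : R) : Prop where
  symm : ∀ x y, β x y = β y x
  assoc : ∀ x y z, β x (y * z) = β (x * y) z
  mem_a : a ∈ S
  mem_b : b ∈ S
  mem_c : c ∈ S
  norm_a : β a a = 1
  norm_b : β b b = 1
  norm_c : β c c = 1
  form_ab : β a b = algebraMap ℝ R (1 / 16)
  form_ac : β a c = algebraMap ℝ R (1 / 16)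
  form_bc : β b c = algebraMap ℝ R (1 / 16)
  form_abc : β a (b * c) = ψ
  idem_a : a * a = a
  idem_b : b * b = b
  idem_c : c * c = c
  quad : ∀ u, u = a ∨ u = b ∨ u = c → ∀ x ∈ S,
    u * (u * x) = (1 / 2 : ℝ) • (u * x) + (1 / 2 : ℝ) • (β u x • u)
  flip : ∀ u, u = a ∨ u = b ∨ u = c → ∀ x ∈ S, ∀ y ∈ S,
    (4 : ℝ) • ((u * x) * (u * y)) = x * (u * y) + y * (u * x) - u * (x * y) + β u y • (u * x)
      + β u x • (u * y) + β u (x * y) • u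

namespace JordanTriple

set_option linter.unusedSectionVars false

variable {R V : Type*} [CommRing R] [Algebra ℝ R] [NonUnitalNonAssocCommRing V]
  [Module R V] [Module ℝ V] [IsScalarTower ℝ R V] [IsScalarTower ℝ V V] [SMulCommClass ℝ V V]
  [IsScalarTower R V V] [SMulCommClass R V V]
  {S : NonUnitalSubalgebra R V} {β : V →ₗ[R] V →ₗ[R] R} {a b c : V} {ψ : R}
  (h : JordanTriple S β a b c ψ)
include h

theorem rotate : JordanTriple S β b c a ψ where
  symm := h.symm
  assoc := h.assoc
  mem_a := h.mem_b
  mem_b := h.mem_c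
  mem_c := h.mem_a
  norm_a := h.norm_b
  norm_b := h.norm_c
  norm_c := h.norm_a
  form_ab := h.form_bc
  form_ac := by rw [h.symm, h.form_ab]
  form_bc := by rw [h.symm, h.form_ac]
  form_abc := by rw [h.assoc, h.symm, h.form_abc]
  idem_a := h.idem_b
  idem_b := h.idem_c
  idem_c := h.idem_a
  quad u hu := h.quad u (by tauto)
  flip u hu := h.flip u (by tauto)

/-- With `rotate` this yields all permutations; `h.rotate.swap.rotate.rotate` exchanges `b` and `c`.
-/
theorem swap : JordanTriple S β b a c ψ where
  symm := h.symm
  assoc := h.assoc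
  mem_a := h.mem_b
  mem_b := h.mem_a
  mem_c := h.mem_c
  norm_a := h.norm_b
  norm_b := h.norm_a
  norm_c := h.norm_c
  form_ab := by rw [h.symm, h.form_ab]
  form_ac := h.form_bc
  form_bc := h.form_ac
  form_abc := by rw [h.assoc, mul_comm, ← h.assoc, h.form_abc]
  idem_a := h.idem_b
  idem_b := h.idem_a
  idem_c := h.idem_c
  quad u hu := h.quad u (by tauto)
  flip u hu := h.flip u (by tauto)

theorem form_smul (r : ℝ) (x y : V) : β x (r • y) = r • β x y := by
  rw [← algebraMap_smul R r y, map_smul, algebraMap_smul]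

theorem mem_ab : a * b ∈ S := S.mul_mem h.mem_a h.mem_b

theorem mul_ab : a * (a * b) = (1 / 2 : ℝ) • (a * b) + (1 / 32 : ℝ) • a := by
  rw [h.quad a (by simp) b h.mem_b, h.form_ab]
  match_scalars <;> algebra

theorem mul_ac : a * (a * c) = (1 / 2 : ℝ) • (a * c) + (1 / 32 : ℝ) • a :=
  h.rotate.swap.rotate.rotate.mul_ab

theorem mul_a_bc : a * (a * (b * c)) = (1 / 2 : ℝ) • (a * (b * c)) + (1 / 2 : ℝ) • (ψ • a) := by
  rw [h.quad a (by simp) _ (S.mul_mem h.mem_b h.mem_c), h.form_abc]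

theorem form_a_ab : β a (a * b) = algebraMap ℝ R (1 / 16) := by
  rw [h.assoc, h.idem_a, h.form_ab]

theorem form_a_ac : β a (a * c) = algebraMap ℝ R (1 / 16) := by
  rw [h.assoc, h.idem_a, h.form_ac]

theorem form_a_a_bc : β a (a * (b * c)) = ψ := by
  rw [h.assoc, h.idem_a, h.form_abc]

theorem form_b_ac : β b (a * c) = ψ := h.swap.form_abc

theorem form_c_ab : β c (a * b) = ψ := h.rotate.rotate.form_abc

theorem form_a_b_ac : β a (b * (a * c)) = algebraMap ℝ R (1 / 512) + (1 / 2 : ℝ) • ψ := by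
  rw [h.assoc, mul_comm a b, ← h.assoc, h.mul_ac, map_add, h.form_smul, h.form_smul, h.form_b_ac, h.symm, h.form_ab]
  algebra

theorem mul_ab_ac : (a * b) * (a * c) = (1 / 4 : ℝ) • (ψ • a) + (1 / 64 : ℝ) • (a * b)
    + (1 / 64 : ℝ) • (a * c) - (1 / 4 : ℝ) • (a * (b * c)) + (1 / 4 : ℝ) • (b * (a * c))
    + (1 / 4 : ℝ) • (c * (a * b)) := by
  have h1 := h.flip a (by simp) b h.mem_b c h.mem_c
  rw [h.form_ab, h.form_ac, h.form_abc] at h1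
  linear_combination (norm := skip) (1 / 4 : ℝ) • h1
  match_scalars <;> algebra

/-- In the flip identity of `a` at b and a c, the factor a (a c) collapses by the quadratic
equation, so this fourfold product is the only new term. -/
theorem mul_b_ac : a * (b * (a * c)) = (1 / 4 : ℝ) • (ψ • a) + (1 / 64 : ℝ) • (a * b)
    + (1 / 64 : ℝ) • (a * c) + (1 / 4 : ℝ) • (a * (b * c)) + (1 / 4 : ℝ) • (b * (a * c))
    - (1 / 4 : ℝ) • (c * (a * b)) := by
  have h1 := h.flip a (by simp) b h.mem_b (a * c) (S.mul_mem h.mem_a h.mem_c)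
  have k1 : (a * b) * a = a * (a * b) := mul_comm _ _
  rw [h.form_a_b_ac, h.mul_ac, h.form_ab, h.form_a_ac] at h1
  simp only [mul_add, mul_smul_comm, mul_comm b a, mul_comm (a * c) (a * b), k1, h.mul_ab,
    h.mul_ab_ac] at h1
  linear_combination (norm := skip) h1
  match_scalars <;> algebra

theorem mul_c_ab : a * (c * (a * b)) = (1 / 4 : ℝ) • (ψ • a) + (1 / 64 : ℝ) • (a * b)
    + (1 / 64 : ℝ) • (a * c) + (1 / 4 : ℝ) • (a * (b * c)) - (1 / 4 : ℝ) • (b * (a * c))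
    + (1 / 4 : ℝ) • (c * (a * b)) := by
  rw [h.rotate.swap.rotate.rotate.mul_b_ac, mul_comm c b]
  abel

theorem mul_ab_ab : (a * b) * (a * b) = (1 / 64 : ℝ) • a + (1 / 64 : ℝ) • b
    + (1 / 32 : ℝ) • (a * b) := by
  have h1 := h.flip a (by simp) b h.mem_b b h.mem_b
  have k := h.swap.mul_ab
  rw [mul_comm b a] at k
  rw [h.form_ab, h.idem_b, h.form_ab, k] at h1
  linear_combination (norm := skip) (1 / 4 : ℝ) • h1
  match_scalars <;> algebra

/-- This is the left side of the flip identity of `a` at b and b c; the terms on the right reduce by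
earlier cases with `a` and `b` exchanged. -/
theorem mul_ab_a_bc : (a * b) * (a * (b * c)) =
    (algebraMap ℝ R (1 / 2048) + (1 / 8 : ℝ) • ψ) • a + (1 / 8 : ℝ) • (ψ • b)
    + (1 / 4 : ℝ) • (ψ • (a * b)) + (1 / 128 : ℝ) • (b * c)
    + (1 / 64 : ℝ) • (a * (b * c)) := by
  have h1 := h.flip a (by simp) b h.mem_b (b * c) (S.mul_mem h.mem_b h.mem_c)
  have k1 := h.swap.mul_b_ac
  have k2 := h.swap.mul_ab_ac
  have k3 := h.swap.mul_ac
  have k4 : β a (b * (b * c)) = algebraMap ℝ R (1 / 512) + (1 / 2 : ℝ) • ψ := by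
    rw [k3, map_add, h.form_smul, h.form_smul, h.form_abc, h.form_ab]
    algebra
  rw [mul_comm b a] at k1 k2
  rw [k4, mul_comm (b * c) (a * b), k2, k1, k3, h.form_ab, h.form_abc] at h1
  simp only [mul_add, mul_smul_comm] at h1
  linear_combination (norm := skip) (1 / 4 : ℝ) • h1
  match_scalars <;> algebra

theorem mul_ab_b_ac : (a * b) * (b * (a * c)) =
    (algebraMap ℝ R (1 / 2048) + (1 / 8 : ℝ) • ψ) • b + (1 / 8 : ℝ) • (ψ • a)
    + (1 / 4 : ℝ) • (ψ • (a * b)) + (1 / 128 : ℝ) • (a * c)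
    + (1 / 64 : ℝ) • (b * (a * c)) := by
  rw [mul_comm a b, h.swap.mul_ab_a_bc]

/-- In the flip identity of `a` at b and b (a c), the vector a (b (a c)) contains c (a b) with
coefficient -1/4. This brings in the wanted product with coefficient -1; all other terms are known.
-/
theorem mul_ab_c_ab : (a * b) * (c * (a * b)) =
    (1 / 2048 : ℝ) • a + (1 / 2048 : ℝ) • b + (1 / 2 : ℝ) • (ψ • (a * b))
    + (1 / 128 : ℝ) • (a * c) + (1 / 128 : ℝ) • (b * c) + (1 / 32 : ℝ) • (c * (a * b))
    - (1 / 64 : ℝ) • (a * (b * c)) - (1 / 64 : ℝ) • (b * (a * c)) := by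
  have h1 := h.flip a (by simp) b h.mem_b (b * (a * c))
    (S.mul_mem h.mem_b (S.mul_mem h.mem_a h.mem_c))
  have k1 := h.swap.mul_b_ac
  have k2 := h.swap.mul_c_ab
  have k3 := h.swap.mul_a_bc
  have k4 := h.swap.mul_ab
  have k5 := h.swap.mul_ac
  have k6 : (a * b) * a = a * (a * b) := mul_comm _ _
  rw [mul_comm b a] at k1 k2 k4
  rw [k3, h.mul_b_ac, h.form_ab, h.form_a_b_ac, mul_comm (b * (a * c)) (a * b), h.mul_ab_b_ac,
    map_add, h.form_smul, h.form_smul, map_smul, smul_eq_mul, h.form_ab, h.form_a_b_ac] at h1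
  simp only [mul_add, mul_sub, mul_smul_comm, mul_comm b a, k1, k2, k3, k4, k5, k6, h.mul_ab_ab,
    h.mul_ab, h.mul_ab_ac, h.mul_ab_a_bc, h.mul_ab_b_ac, h.mul_b_ac] at h1
  linear_combination (norm := skip) (-1 : ℝ) • h1
  match_scalars <;> algebra

theorem sq_c_ab : (c * (a * b)) * (c * (a * b)) =
    (algebraMap ℝ R (1 / 2048) + (1 / 128 : ℝ) • ψ) • c + (1 / 4096 : ℝ) • a
    + (1 / 4096 : ℝ) • b + (1 / 4 : ℝ) • (ψ • (a * b))
    + (algebraMap ℝ R (1 / 128) + (1 / 2 : ℝ) • ψ) • (c * (a * b))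
    - (1 / 128 : ℝ) • (a * (b * c)) - (1 / 128 : ℝ) • (b * (a * c)) := by
  have h1 := h.flip c (by simp) (a * b) h.mem_ab (a * b) h.mem_ab
  rw [h.mul_ab_c_ab, h.mul_ab_ab, h.form_c_ab] at h1
  simp only [map_add, h.form_smul, h.form_c_ab, h.symm c a, h.symm c b, h.form_ac, h.form_bc,
    mul_add, mul_smul_comm, mul_comm c a, mul_comm c b] at h1
  linear_combination (norm := skip) (1 / 4 : ℝ) • h1
  match_scalars <;> algebra

theorem sq_a_bc : (a * (b * c)) * (a * (b * c)) =
    (algebraMap ℝ R (1 / 2048) + (1 / 128 : ℝ) • ψ) • a + (1 / 4096 : ℝ) • b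
    + (1 / 4096 : ℝ) • c + (1 / 4 : ℝ) • (ψ • (b * c))
    + (algebraMap ℝ R (1 / 128) + (1 / 2 : ℝ) • ψ) • (a * (b * c))
    - (1 / 128 : ℝ) • (b * (a * c)) - (1 / 128 : ℝ) • (c * (a * b)) := by
  rw [h.rotate.sq_c_ab, mul_comm c a, mul_comm b a]

theorem mul_bc_b_ac : (b * c) * (b * (a * c)) =
    (algebraMap ℝ R (1 / 2048) + (1 / 8 : ℝ) • ψ) • b + (1 / 8 : ℝ) • (ψ • c)
    + (1 / 4 : ℝ) • (ψ • (b * c)) + (1 / 128 : ℝ) • (a * c)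
    + (1 / 64 : ℝ) • (b * (a * c)) := by
  rw [mul_comm a c, h.rotate.mul_ab_a_bc]

theorem mul_bc_c_ab : (b * c) * (c * (a * b)) =
    (algebraMap ℝ R (1 / 2048) + (1 / 8 : ℝ) • ψ) • c + (1 / 8 : ℝ) • (ψ • b)
    + (1 / 4 : ℝ) • (ψ • (b * c)) + (1 / 128 : ℝ) • (a * b)
    + (1 / 64 : ℝ) • (c * (a * b)) := by
  rw [mul_comm a b, h.rotate.mul_ab_b_ac]

theorem mul_bc_a_bc : (b * c) * (a * (b * c)) =
    (1 / 2048 : ℝ) • b + (1 / 2048 : ℝ) • c + (1 / 2 : ℝ) • (ψ • (b * c))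
    + (1 / 128 : ℝ) • (a * b) + (1 / 128 : ℝ) • (a * c) + (1 / 32 : ℝ) • (a * (b * c))
    - (1 / 64 : ℝ) • (b * (a * c)) - (1 / 64 : ℝ) • (c * (a * b)) := by
  rw [h.rotate.mul_ab_c_ab, mul_comm b a, mul_comm c a]

/-- The flip identity of `a` at b c and b (a c) contains two products of distinct triple products.
The one of a (b c) and b (a c) occurs equally on both sides and cancels, leaving this one. -/
theorem mul_a_bc_c_ab : (a * (b * c)) * (c * (a * b)) =
    (algebraMap ℝ R (1 / 4096) + (1 / 256 : ℝ) • ψ) • a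
    + (algebraMap ℝ R (1 / 4096) + (1 / 256 : ℝ) • ψ) • c + (1 / 256 : ℝ) • (ψ • b)
    + (algebraMap ℝ R (1 / 2048) + (1 / 8 : ℝ) • ψ) • (b * c)
    + (algebraMap ℝ R (1 / 2048) + (1 / 8 : ℝ) • ψ) • (a * b) + (1 / 8 : ℝ) • (ψ • (a * c))
    + ((1 / 4 : ℝ) • ψ - algebraMap ℝ R (1 / 256)) • (a * (b * c))
    + ((1 / 4 : ℝ) • ψ - algebraMap ℝ R (1 / 256)) • (c * (a * b))
    - (algebraMap ℝ R (1 / 256) + (1 / 4 : ℝ) • ψ) • (b * (a * c)) := by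
  have h1 := h.flip a (by simp) (b * c) (S.mul_mem h.mem_b h.mem_c) (b * (a * c))
    (S.mul_mem h.mem_b (S.mul_mem h.mem_a h.mem_c))
  have k1 : (a * (b * c)) * a = a * (a * (b * c)) := mul_comm _ _
  have k2 : (a * (b * c)) * (a * b) = (a * b) * (a * (b * c)) := mul_comm _ _
  have k3 := h.rotate.swap.rotate.rotate.mul_ab_a_bc
  have k4 : (a * (b * c)) * (a * c) = (a * c) * (a * (b * c)) := mul_comm _ _
  have k5 : (b * c) * a = a * (b * c) := mul_comm _ _
  have k6 := h.swap.mul_ab_ac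
  have k7 : (b * (a * c)) * (a * (b * c)) = (a * (b * c)) * (b * (a * c)) := mul_comm _ _
  have k8 := h.rotate.rotate.mul_ab_ac
  rw [mul_comm c b] at k3
  rw [mul_comm b a, mul_comm (a * b) (b * c)] at k6
  rw [mul_comm c a, mul_comm c b, mul_comm (a * c) (b * c)] at k8
  rw [h.form_a_b_ac, h.form_abc, h.mul_bc_b_ac, k7] at h1
  simp only [map_add, map_smul, smul_eq_mul, h.form_smul, h.form_ab, h.form_ac, h.form_abc, h.form_a_ac,
    h.form_a_b_ac, mul_add, mul_sub, mul_smul_comm, k1, k2, k3, k4, k5, k6, k8, h.sq_a_bc,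
    h.mul_b_ac, h.mul_ab_a_bc, h.mul_bc_a_bc, h.mul_bc_b_ac, h.mul_bc_c_ab, h.mul_ac, h.mul_a_bc] at h1
  linear_combination (norm := skip) (-1 : ℝ) • h1
  match_scalars <;> algebra

end JordanTriple

/-! ### The nine-dimensional Jordan model and its identities over ℝ. -/

/-- The free module with basis `c i`, `m i`, `n i` (`i : Fin 3`), which carries the universal algebra
of Jordan type `1/2` generated by three idempotents `c i` with mutual inner products `1/16`.
Here `m i` is the product of the two idempotents other than `c i`, and `n i` is `c i * m i`; the
parameter `ψ` is the inner product of `c i` and `m i`. -/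
@[ext]
structure JordanModel (S : Type) (ψ : S) where
  /-- the coordinates on the idempotents -/
  c : Fin 3 → S
  /-- the coordinates on the products of two idempotents -/
  m : Fin 3 → S
  /-- the coordinates on the products of three idempotents -/
  n : Fin 3 → S

namespace JordanModel

set_option linter.unusedSectionVars false

/-- The symmetrized product of two coordinates. -/
def sym {S : Type} [CommRing S] (f f' g g' : Fin 3 → S) (i j : Fin 3) : S := f i * g' j + g j * f' i

section Basic

variable {S : Type} [CommRing S] [Algebra ℝ S] {ψ : S}

instance : Zero (JordanModel S ψ) := ⟨⟨0, 0, 0⟩⟩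
instance : Add (JordanModel S ψ) := ⟨fun x y => ⟨x.c + y.c, x.m + y.m, x.n + y.n⟩⟩
instance : Neg (JordanModel S ψ) := ⟨fun x => ⟨-x.c, -x.m, -x.n⟩⟩
instance : Sub (JordanModel S ψ) := ⟨fun x y => ⟨x.c - y.c, x.m - y.m, x.n - y.n⟩⟩
instance {K : Type} [SMul K S] : SMul K (JordanModel S ψ) := ⟨fun r x => ⟨r • x.c, r • x.m, r • x.n⟩⟩

/-- The coordinates of a product on the idempotents. -/
noncomputable def mulC (x y : JordanModel S ψ) (i : Fin 3) : S :=
  x.c i * y.c i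
  + (1 / 32 : ℝ) • (sym x.c y.c x.m y.m i (i + 1) + sym x.c y.c x.m y.m i (i + 2))
  + (1 / 2 : ℝ) • (ψ * sym x.c y.c x.n y.n i i)
  + (1 / 4 : ℝ) • (ψ * (sym x.c y.c x.n y.n i (i + 1) + sym x.c y.c x.n y.n i (i + 2)))
  + (1 / 64 : ℝ) • (x.m (i + 1) * y.m (i + 1) + x.m (i + 2) * y.m (i + 2))
  + (1 / 4 : ℝ) • (ψ * sym x.m y.m x.m y.m (i + 1) (i + 2))
  + (1 / 2048 : ℝ) • (sym x.m y.m x.n y.n (i + 1) (i + 1) + sym x.m y.m x.n y.n (i + 2) (i + 2))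
  + (algebraMap ℝ S (1 / 2048) + (1 / 8 : ℝ) • ψ)
    * (sym x.m y.m x.n y.n (i + 1) i + sym x.m y.m x.n y.n (i + 2) i)
  + (1 / 8 : ℝ) • (ψ * (sym x.m y.m x.n y.n (i + 1) (i + 2)
    + sym x.m y.m x.n y.n (i + 2) (i + 1)))
  + (algebraMap ℝ S (1 / 2048) + (1 / 128 : ℝ) • ψ) * (x.n i * y.n i)
  + (1 / 4096 : ℝ) • (x.n (i + 1) * y.n (i + 1) + x.n (i + 2) * y.n (i + 2))
  + (algebraMap ℝ S (1 / 4096) + (1 / 256 : ℝ) • ψ)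
    * (sym x.n y.n x.n y.n i (i + 1) + sym x.n y.n x.n y.n i (i + 2))
  + (1 / 256 : ℝ) • (ψ * sym x.n y.n x.n y.n (i + 1) (i + 2))

/-- The coordinates of a product on the products of two idempotents. -/
noncomputable def mulM (x y : JordanModel S ψ) (i : Fin 3) : S :=
  sym x.c y.c x.c y.c (i + 1) (i + 2)
  + (1 / 2 : ℝ) • (sym x.c y.c x.m y.m (i + 1) i + sym x.c y.c x.m y.m (i + 2) i)
  + (1 / 64 : ℝ) • (sym x.c y.c x.n y.n (i + 1) i + sym x.c y.c x.n y.n (i + 1) (i + 2)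
    + sym x.c y.c x.n y.n (i + 2) i + sym x.c y.c x.n y.n (i + 2) (i + 1))
  + (1 / 32 : ℝ) • (x.m i * y.m i)
  + (1 / 64 : ℝ) • (sym x.m y.m x.m y.m i (i + 1) + sym x.m y.m x.m y.m i (i + 2))
  + (1 / 2 : ℝ) • (ψ * sym x.m y.m x.n y.n i i)
  + (1 / 128 : ℝ) • (sym x.m y.m x.n y.n (i + 1) (i + 1) + sym x.m y.m x.n y.n (i + 2) (i + 2))
  + (1 / 4 : ℝ) • (ψ * (sym x.m y.m x.n y.n i (i + 1) + sym x.m y.m x.n y.n i (i + 2)))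
  + (1 / 128 : ℝ) • (sym x.m y.m x.n y.n (i + 1) i + sym x.m y.m x.n y.n (i + 2) i)
  + (1 / 4 : ℝ) • (ψ * (x.n i * y.n i))
  + (algebraMap ℝ S (1 / 2048) + (1 / 8 : ℝ) • ψ)
    * (sym x.n y.n x.n y.n i (i + 1) + sym x.n y.n x.n y.n i (i + 2))
  + (1 / 8 : ℝ) • (ψ * sym x.n y.n x.n y.n (i + 1) (i + 2))

/-- The coordinates of a product on the products of three idempotents. -/
noncomputable def mulN (x y : JordanModel S ψ) (i : Fin 3) : S :=
  sym x.c y.c x.m y.m i i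
  + (1 / 2 : ℝ) • sym x.c y.c x.n y.n i i
  + (1 / 4 : ℝ) • (sym x.c y.c x.n y.n i (i + 1) + sym x.c y.c x.n y.n i (i + 2)
    + sym x.c y.c x.n y.n (i + 1) i + sym x.c y.c x.n y.n (i + 2) i
    - sym x.c y.c x.n y.n (i + 1) (i + 2) - sym x.c y.c x.n y.n (i + 2) (i + 1))
  + (1 / 4 : ℝ) • (sym x.m y.m x.m y.m i (i + 1) + sym x.m y.m x.m y.m i (i + 2)
    - sym x.m y.m x.m y.m (i + 1) (i + 2))
  + (1 / 32 : ℝ) • sym x.m y.m x.n y.n i i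
  - (1 / 64 : ℝ) • (sym x.m y.m x.n y.n (i + 1) (i + 1) + sym x.m y.m x.n y.n (i + 2) (i + 2))
  + (1 / 64 : ℝ) • (sym x.m y.m x.n y.n (i + 1) i + sym x.m y.m x.n y.n (i + 2) i)
  + (algebraMap ℝ S (1 / 128) + (1 / 2 : ℝ) • ψ) * (x.n i * y.n i)
  - (1 / 128 : ℝ) • (x.n (i + 1) * y.n (i + 1) + x.n (i + 2) * y.n (i + 2))
  + ((1 / 4 : ℝ) • ψ - algebraMap ℝ S (1 / 256))
    * (sym x.n y.n x.n y.n i (i + 1) + sym x.n y.n x.n y.n i (i + 2))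
  - ((1 / 4 : ℝ) • ψ + algebraMap ℝ S (1 / 256)) * sym x.n y.n x.n y.n (i + 1) (i + 2)

/-- The structure constants are those forced in `JordanTriple`. -/
noncomputable instance : Mul (JordanModel S ψ) := ⟨fun x y => ⟨mulC x y, mulM x y, mulN x y⟩⟩

theorem mul_c (x y : JordanModel S ψ) : (x * y).c = mulC x y := rfl
theorem mul_m (x y : JordanModel S ψ) : (x * y).m = mulM x y := rfl
theorem mul_n (x y : JordanModel S ψ) : (x * y).n = mulN x y := rfl

@[simp] theorem zero_c : (0 : JordanModel S ψ).c = 0 := rfl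
@[simp] theorem zero_m : (0 : JordanModel S ψ).m = 0 := rfl
@[simp] theorem zero_n : (0 : JordanModel S ψ).n = 0 := rfl
@[simp] theorem add_c (x y : JordanModel S ψ) : (x + y).c = x.c + y.c := rfl
@[simp] theorem add_m (x y : JordanModel S ψ) : (x + y).m = x.m + y.m := rfl
@[simp] theorem add_n (x y : JordanModel S ψ) : (x + y).n = x.n + y.n := rfl
@[simp] theorem neg_c (x : JordanModel S ψ) : (-x).c = -x.c := rfl
@[simp] theorem neg_m (x : JordanModel S ψ) : (-x).m = -x.m := rfl
@[simp] theorem neg_n (x : JordanModel S ψ) : (-x).n = -x.n := rfl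
@[simp] theorem sub_c (x y : JordanModel S ψ) : (x - y).c = x.c - y.c := rfl
@[simp] theorem sub_m (x y : JordanModel S ψ) : (x - y).m = x.m - y.m := rfl
@[simp] theorem sub_n (x y : JordanModel S ψ) : (x - y).n = x.n - y.n := rfl
@[simp] theorem smul_c {K : Type} [SMul K S] (r : K) (x : JordanModel S ψ) :
    (r • x).c = r • x.c := rfl
@[simp] theorem smul_m {K : Type} [SMul K S] (r : K) (x : JordanModel S ψ) :
    (r • x).m = r • x.m := rfl
@[simp] theorem smul_n {K : Type} [SMul K S] (r : K) (x : JordanModel S ψ) :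
    (r • x).n = r • x.n := rfl

omit [Algebra ℝ S] in
theorem ext_coords {x y : JordanModel S ψ} (c0 : x.c 0 = y.c 0) (c1 : x.c 1 = y.c 1)
    (c2 : x.c 2 = y.c 2) (m0 : x.m 0 = y.m 0) (m1 : x.m 1 = y.m 1) (m2 : x.m 2 = y.m 2)
    (n0 : x.n 0 = y.n 0) (n1 : x.n 1 = y.n 1) (n2 : x.n 2 = y.n 2) : x = y := by
  refine JordanModel.ext (funext fun i => ?_) (funext fun i => ?_) (funext fun i => ?_) <;>
    fin_cases i <;> assumption

/-- The coordinates as a product of functions. -/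
def coords (x : JordanModel S ψ) : (Fin 3 → S) × (Fin 3 → S) × (Fin 3 → S) := (x.c, x.m, x.n)

theorem coords_injective : Function.Injective (coords (ψ := ψ)) := by
  intro x y h
  simp only [coords, Prod.mk.injEq] at h
  exact JordanModel.ext h.1 h.2.1 h.2.2

instance : AddCommGroup (JordanModel S ψ) := fast_instance%
  coords_injective.addCommGroup coords rfl (fun _ _ => rfl) (fun _ => rfl) (fun _ _ => rfl)
    (fun _ _ => rfl) (fun _ _ => rfl)

/-- The coordinates as an additive homomorphism. -/
def coordsHom : JordanModel S ψ →+ (Fin 3 → S) × (Fin 3 → S) × (Fin 3 → S) where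
  toFun := coords
  map_zero' := rfl
  map_add' _ _ := rfl

instance {K : Type} [Semiring K] [Module K S] : Module K (JordanModel S ψ) := fast_instance%
  coords_injective.module K coordsHom (fun _ _ => rfl)

instance {K : Type} [Semiring K] [Algebra ℝ K] [Module K S] [IsScalarTower ℝ K S] :
    IsScalarTower ℝ K (JordanModel S ψ) where
  smul_assoc r k x := by ext <;> simp

variable (ψ) in
/-- The normalized form. -/
noncomputable def formFun (x y : JordanModel S ψ) : S :=
  -- The constants are forced by associativity: for instance (ab, ab) = (a, b (ab)) = 1/32 + 1/512 =
  -- 17/512.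
  ∑ i, (x.c i * y.c i + (17 / 512 : ℝ) • (x.m i * y.m i) + ψ * sym x.c y.c x.m y.m i i
    + ψ * sym x.c y.c x.n y.n i i
    + (algebraMap ℝ S (1 / 512) + (1 / 32 : ℝ) • ψ) * sym x.m y.m x.n y.n i i
    + (algebraMap ℝ S (1 / 1024) + (1 / 64 : ℝ) • ψ + (1 / 2 : ℝ) • ψ ^ 2) * (x.n i * y.n i)
    + (1 / 16 : ℝ) • sym x.c y.c x.c y.c i (i + 1)
    + (1 / 16 : ℝ) • (sym x.c y.c x.m y.m i (i + 1) + sym x.c y.c x.m y.m i (i + 2))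
    + (algebraMap ℝ S (1 / 512) + (1 / 2 : ℝ) • ψ)
      * (sym x.c y.c x.n y.n i (i + 1) + sym x.c y.c x.n y.n i (i + 2)
        + sym x.m y.m x.m y.m i (i + 1))
    + (algebraMap ℝ S (1 / 1024) + (9 / 32 : ℝ) • ψ)
      * (sym x.m y.m x.n y.n i (i + 1) + sym x.m y.m x.n y.n i (i + 2))
    + (algebraMap ℝ S (9 / 16384) + (3 / 128 : ℝ) • ψ + (1 / 4 : ℝ) • ψ ^ 2)
      * sym x.n y.n x.n y.n i (i + 1))

/-- The generating idempotents. -/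
def gen (ψ : S) (i : Fin 3) : JordanModel S ψ := ⟨Pi.single i 1, 0, 0⟩

end Basic

section Real

variable {ψ : ℝ}

theorem real_gen_zero_mul (x : JordanModel ℝ ψ) : gen ψ 0 * x =
    { c := ![x.c 0 + (1 / 32) * (x.m 1 + x.m 2) + (1 / 2) * ψ * x.n 0
        + (1 / 4) * ψ * (x.n 1 + x.n 2), 0, 0]
      m := ![0, x.c 2 + (1 / 2) * x.m 1 + (1 / 64) * (x.n 1 + x.n 2),
        x.c 1 + (1 / 2) * x.m 2 + (1 / 64) * (x.n 1 + x.n 2)]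
      n := ![x.m 0 + (1 / 2) * x.n 0 + (1 / 4) * (x.n 1 + x.n 2), (1 / 4) * (x.n 1 - x.n 2),
        (1 / 4) * (x.n 2 - x.n 1)] } := by
  ext j <;> fin_cases j <;>
  simp [mul_c, mul_m, mul_n, mulC, mulM, mulN, gen, sym] <;> ring

theorem real_form_gen_zero (x : JordanModel ℝ ψ) : formFun ψ (gen ψ 0) x =
    x.c 0 + (1 / 16) * (x.c 1 + x.c 2 + x.m 1 + x.m 2) + ψ * (x.m 0 + x.n 0)
      + (1 / 512 + (1 / 2) * ψ) * (x.n 1 + x.n 2) := by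
  simp [formFun, Fin.sum_univ_three, gen, sym]
  ring

theorem real_quad_zero (x : JordanModel ℝ ψ) : gen ψ 0 * (gen ψ 0 * x) =
    (1 / 2 : ℝ) • (gen ψ 0 * x) + (1 / 2 : ℝ) • (formFun ψ (gen ψ 0) x • gen ψ 0) := by
  simp only [real_gen_zero_mul, real_form_gen_zero]
  apply ext_coords <;> simp [gen] <;> ring

set_option maxRecDepth 20000 in
set_option maxHeartbeats 4000000 in
-- Each coordinate is a polynomial identity in ψ and the coordinates of both vectors. It holds
-- without any relation on ψ, which is why the parameter stays free.
theorem real_flip_zero (x y : JordanModel ℝ ψ) : (4 : ℝ) • ((gen ψ 0 * x) * (gen ψ 0 * y)) =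
    x * (gen ψ 0 * y) + y * (gen ψ 0 * x) - gen ψ 0 * (x * y)
      + formFun ψ (gen ψ 0) y • (gen ψ 0 * x) + formFun ψ (gen ψ 0) x • (gen ψ 0 * y)
      + formFun ψ (gen ψ 0) (x * y) • gen ψ 0 := by
  have hg : gen ψ 0 = ⟨![1, 0, 0], 0, 0⟩ := by apply ext_coords <;> simp [gen]
  simp only [real_gen_zero_mul, real_form_gen_zero]
  rw [hg]
  apply ext_coords <;> simp only [mul_c, mul_m, mul_n, mulC, mulM, mulN, sym, add_c, add_m,
    add_n, sub_c, sub_m, sub_n, smul_c, smul_m, smul_n, Pi.add_apply, Pi.sub_apply, Pi.smul_apply,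
    smul_eq_mul, Fin.isValue, Fin.reduceAdd, Matrix.cons_val, Pi.zero_apply,
    zero_add, add_zero, mul_zero, zero_mul, sub_zero, Algebra.algebraMap_self, RingHom.id_apply] <;>
  ring

end Real

end JordanModel

/-! ### Ring structure, form and cyclic symmetry of the Jordan model. -/

namespace JordanModel

set_option linter.unusedSectionVars false

section Basic

variable {S : Type} [CommRing S] [Algebra ℝ S] {ψ : S}

theorem mul_comm' (x y : JordanModel S ψ) : x * y = y * x := by
  ext i <;> simp only [mul_c, mul_m, mul_n, mulC, mulM, mulN, sym] <;> algebra

theorem add_mul' (x y z : JordanModel S ψ) : (x + y) * z = x * z + y * z := by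
  ext i <;> simp only [mul_c, mul_m, mul_n, mulC, mulM, mulN, sym, add_c, add_m, add_n,
    Pi.add_apply] <;> algebra

noncomputable instance : NonUnitalNonAssocCommRing (JordanModel S ψ) where
  mul_comm := mul_comm'
  right_distrib := add_mul'
  left_distrib x y z := by rw [mul_comm', add_mul', mul_comm' x y, mul_comm' x z]
  zero_mul x := by
    have h := add_mul' 0 0 x
    rw [add_zero] at h
    exact left_eq_add.mp h
  mul_zero x := by
    have h := add_mul' 0 0 x
    rw [add_zero] at h
    rw [mul_comm', left_eq_add.mp h]

theorem smul_mul' (r : S) (x y : JordanModel S ψ) : (r • x) * y = r • (x * y) := by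
  ext i <;> simp only [mul_c, mul_m, mul_n, mulC, mulM, mulN, sym, smul_c, smul_m, smul_n,
    Pi.smul_apply, smul_eq_mul] <;> algebra

instance : IsScalarTower S (JordanModel S ψ) (JordanModel S ψ) where
  smul_assoc := smul_mul'

instance : SMulCommClass S (JordanModel S ψ) (JordanModel S ψ) where
  smul_comm r x y := by
    rw [smul_eq_mul, smul_eq_mul, mul_comm x (r • y), smul_mul', mul_comm]

theorem formFun_symm (x y : JordanModel S ψ) : formFun ψ x y = formFun ψ y x := by
  simp only [formFun, sym, Fin.sum_univ_three]
  algebra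

theorem formFun_add (x y z : JordanModel S ψ) :
    formFun ψ x (y + z) = formFun ψ x y + formFun ψ x z := by
  simp only [formFun, sym, Fin.sum_univ_three, add_c, add_m, add_n, Pi.add_apply]
  algebra

theorem formFun_smul (r : S) (x y : JordanModel S ψ) :
    formFun ψ x (r • y) = r * formFun ψ x y := by
  simp only [formFun, sym, Fin.sum_univ_three, smul_c, smul_m, smul_n, Pi.smul_apply, smul_eq_mul]
  algebra

/-- The normalized form as a bilinear map. -/
noncomputable def form (ψ : S) : JordanModel S ψ →ₗ[S] JordanModel S ψ →ₗ[S] S :=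
  LinearMap.mk₂ S (formFun ψ)
    (fun x y z => by rw [formFun_symm, formFun_add, formFun_symm z, formFun_symm z])
    (fun r x y => by rw [formFun_symm, formFun_smul, formFun_symm y, smul_eq_mul])
    formFun_add (fun r x y => formFun_smul r x y)

/-- Cyclic rotation of the coordinates. -/
def rot (x : JordanModel S ψ) : JordanModel S ψ :=
  ⟨fun i => x.c (i + 1), fun i => x.m (i + 1), fun i => x.n (i + 1)⟩

theorem rot_injective : Function.Injective (rot : JordanModel S ψ → JordanModel S ψ) := by
  intro x y h
  have h1 := fun i => congrFun (congrArg JordanModel.c h) (i - 1)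
  have h2 := fun i => congrFun (congrArg JordanModel.m h) (i - 1)
  have h3 := fun i => congrFun (congrArg JordanModel.n h) (i - 1)
  simp only [rot, sub_add_cancel] at h1 h2 h3
  exact JordanModel.ext (funext h1) (funext h2) (funext h3)

/-- The structure constants are invariant under a cyclic shift of indices, so identities have to be
verified for one idempotent only. -/
theorem rot_mul (x y : JordanModel S ψ) : rot (x * y) = rot x * rot y := by
  have h : ∀ i : Fin 3, i + 2 + 1 = i + 1 + 2 := by decide
  ext i <;> simp only [rot, mul_c, mul_m, mul_n, mulC, mulM, mulN, sym, h]

theorem rot_form (x y : JordanModel S ψ) : formFun ψ (rot x) (rot y) = formFun ψ x y := by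
  simp only [rot, formFun, sym, Fin.sum_univ_three, Fin.isValue, Fin.reduceAdd]
  algebra

theorem rot_gen (i : Fin 3) : rot (gen ψ (i + 1)) = gen ψ i := by
  ext j <;> simp [rot, gen, Pi.single_apply]

end Basic

section Real

variable {ψ : ℝ}

theorem real_quad (i : Fin 3) (x : JordanModel ℝ ψ) : gen ψ i * (gen ψ i * x) =
    (1 / 2 : ℝ) • (gen ψ i * x) + (1 / 2 : ℝ) • (formFun ψ (gen ψ i) x • gen ψ i) := by
  have step : ∀ j : Fin 3, (∀ x : JordanModel ℝ ψ, gen ψ j * (gen ψ j * x) =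
      (1 / 2 : ℝ) • (gen ψ j * x) + (1 / 2 : ℝ) • (formFun ψ (gen ψ j) x • gen ψ j)) →
      ∀ x : JordanModel ℝ ψ, gen ψ (j + 1) * (gen ψ (j + 1) * x) =
      (1 / 2 : ℝ) • (gen ψ (j + 1) * x)
        + (1 / 2 : ℝ) • (formFun ψ (gen ψ (j + 1)) x • gen ψ (j + 1)) := by
    intro j hj x
    apply rot_injective
    have h := hj (rot x)
    rw [← rot_gen j, rot_form] at h
    simp only [← rot_mul] at h
    exact h
  fin_cases i
  · exact real_quad_zero x
  · exact step 0 real_quad_zero x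
  · exact step 1 (step 0 real_quad_zero) x

theorem real_flip (i : Fin 3) (x y : JordanModel ℝ ψ) :
    (4 : ℝ) • ((gen ψ i * x) * (gen ψ i * y)) =
      x * (gen ψ i * y) + y * (gen ψ i * x) - gen ψ i * (x * y)
      + formFun ψ (gen ψ i) y • (gen ψ i * x) + formFun ψ (gen ψ i) x • (gen ψ i * y)
      + formFun ψ (gen ψ i) (x * y) • gen ψ i := by
  have step : ∀ j : Fin 3, (∀ x y : JordanModel ℝ ψ, (4 : ℝ) • ((gen ψ j * x) * (gen ψ j * y)) =
      x * (gen ψ j * y) + y * (gen ψ j * x) - gen ψ j * (x * y)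
      + formFun ψ (gen ψ j) y • (gen ψ j * x) + formFun ψ (gen ψ j) x • (gen ψ j * y)
      + formFun ψ (gen ψ j) (x * y) • gen ψ j) →
      ∀ x y : JordanModel ℝ ψ, (4 : ℝ) • ((gen ψ (j + 1) * x) * (gen ψ (j + 1) * y)) =
      x * (gen ψ (j + 1) * y) + y * (gen ψ (j + 1) * x) - gen ψ (j + 1) * (x * y)
      + formFun ψ (gen ψ (j + 1)) y • (gen ψ (j + 1) * x)
      + formFun ψ (gen ψ (j + 1)) x • (gen ψ (j + 1) * y)
      + formFun ψ (gen ψ (j + 1)) (x * y) • gen ψ (j + 1) := by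
    intro j hj x y
    apply rot_injective
    have h := hj (rot x) (rot y)
    rw [← rot_gen j, ← rot_mul x y, rot_form, rot_form, rot_form] at h
    simp only [← rot_mul] at h
    exact h
  fin_cases i
  · exact real_flip_zero x y
  · exact step 0 real_flip_zero x y
  · exact step 1 (step 0 real_flip_zero) x y

set_option maxRecDepth 20000 in
set_option maxHeartbeats 4000000 in
theorem real_form_assoc (x y z : JordanModel ℝ ψ) :
    formFun ψ x (y * z) = formFun ψ (x * y) z := by
  simp only [formFun, Fin.sum_univ_three, mul_c, mul_m, mul_n, mulC, mulM, mulN, sym, smul_eq_mul,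
    Fin.isValue, Fin.reduceAdd, Algebra.algebraMap_self, RingHom.id_apply]
  ring

end Real

end JordanModel

/-! ### Change of coefficients: from real parameters to polynomials. -/

namespace JordanModel

set_option linter.unusedSectionVars false

section Map

variable {S T : Type} [CommRing S] [Algebra ℝ S] [CommRing T] [Algebra ℝ T] {ψ : S}

/-- Change of the coefficient ring. -/
def map (φ : S →ₐ[ℝ] T) (x : JordanModel S ψ) : JordanModel T (φ ψ) :=
  ⟨fun i => φ (x.c i), fun i => φ (x.m i), fun i => φ (x.n i)⟩

variable (φ : S →ₐ[ℝ] T)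

theorem map_add (x y : JordanModel S ψ) : map φ (x + y) = map φ x + map φ y := by
  ext i <;> simp [map]

theorem map_sub (x y : JordanModel S ψ) : map φ (x - y) = map φ x - map φ y := by
  ext i <;> simp [map]

theorem map_real_smul (r : ℝ) (x : JordanModel S ψ) : map φ (r • x) = r • map φ x := by
  ext i <;> simp [map]

theorem map_smul (r : S) (x : JordanModel S ψ) : map φ (r • x) = φ r • map φ x := by
  ext i <;> simp [map]

theorem map_mul (x y : JordanModel S ψ) : map φ (x * y) = map φ x * map φ y := by
  ext i <;> simp [map, mul_c, mul_m, mul_n, mulC, mulM, mulN, sym]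

theorem map_form (x y : JordanModel S ψ) :
    formFun (φ ψ) (map φ x) (map φ y) = φ (formFun ψ x y) := by
  simp [map, formFun, sym, Fin.sum_univ_three]

theorem map_gen (i : Fin 3) : map φ (gen ψ i) = gen (φ ψ) i := by
  ext j <;> simp [map, gen, Pi.single_apply]

end Map

section Polynomial

open Polynomial

variable {ψ : ℝ[X]}

/-- A real polynomial is determined by its values, so identities over ℝ[X] follow from those over ℝ
for every specialization of ψ. -/
theorem eq_of_forall_map_aeval {x y : JordanModel ℝ[X] ψ}
    (h : ∀ r : ℝ, map (aeval r) x = map (aeval r) y) : x = y := by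
  have h1 := fun r i => congrFun (congrArg JordanModel.c (h r)) i
  have h2 := fun r i => congrFun (congrArg JordanModel.m (h r)) i
  have h3 := fun r i => congrFun (congrArg JordanModel.n (h r)) i
  simp only [map, coe_aeval_eq_eval] at h1 h2 h3
  ext1 <;> ext1 i
  · exact Polynomial.funext fun r => h1 r i
  · exact Polynomial.funext fun r => h2 r i
  · exact Polynomial.funext fun r => h3 r i

theorem gen_quad (i : Fin 3) (x : JordanModel ℝ[X] ψ) : gen ψ i * (gen ψ i * x) =
    (1 / 2 : ℝ) • (gen ψ i * x) + (1 / 2 : ℝ) • (form ψ (gen ψ i) x • gen ψ i) := by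
  refine eq_of_forall_map_aeval fun r => ?_
  have h := real_quad i (map (aeval r) x)
  simp only [← map_gen, ← map_form, map_mul, map_add, map_real_smul, map_smul, form,
    LinearMap.mk₂_apply] at h ⊢
  exact h

theorem gen_flip (i : Fin 3) (x y : JordanModel ℝ[X] ψ) :
    (4 : ℝ) • ((gen ψ i * x) * (gen ψ i * y)) =
      x * (gen ψ i * y) + y * (gen ψ i * x) - gen ψ i * (x * y)
      + form ψ (gen ψ i) y • (gen ψ i * x) + form ψ (gen ψ i) x • (gen ψ i * y)
      + form ψ (gen ψ i) (x * y) • gen ψ i := by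
  refine eq_of_forall_map_aeval fun r => ?_
  have h := real_flip i (map (aeval r) x) (map (aeval r) y)
  simp only [← map_gen, ← map_form, map_mul, map_add, map_sub, map_real_smul, map_smul, form,
    LinearMap.mk₂_apply] at h ⊢
  exact h

theorem form_assoc (x y z : JordanModel ℝ[X] ψ) : form ψ x (y * z) = form ψ (x * y) z := by
  refine Polynomial.funext fun r => ?_
  have h := real_form_assoc (ψ := aeval r ψ) (map (aeval r) x) (map (aeval r) y) (map (aeval r) z)
  rw [← map_mul, ← map_mul, map_form, map_form] at h
  exact h

end Polynomial

section Gen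

variable {S : Type} [CommRing S] [Algebra ℝ S] {ψ : S}

theorem form_symm (x y : JordanModel S ψ) : form ψ x y = form ψ y x := formFun_symm x y

theorem gen_mul_self (i : Fin 3) : gen ψ i * gen ψ i = gen ψ i := by
  apply ext_coords <;> fin_cases i <;>
    simp [mul_c, mul_m, mul_n, mulC, mulM, mulN, gen, sym, Pi.single_apply]

theorem form_gen_self (i : Fin 3) : form ψ (gen ψ i) (gen ψ i) = 1 := by
  fin_cases i <;> simp [form, formFun, Fin.sum_univ_three, gen, sym, Pi.single_apply]

theorem form_gen_gen {i j : Fin 3} (h : i ≠ j) :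
    form ψ (gen ψ i) (gen ψ j) = algebraMap ℝ S (1 / 16) := by
  rw [Algebra.algebraMap_eq_smul_one]
  revert h
  fin_cases i <;> fin_cases j <;>
    simp [form, formFun, Fin.sum_univ_three, gen, sym, Pi.single_apply]

theorem gen_one_mul_gen_two : gen ψ 1 * gen ψ 2 = ⟨0, Pi.single 0 1, 0⟩ := by
  apply ext_coords <;>
    simp [mul_c, mul_m, mul_n, mulC, mulM, mulN, gen, sym, Pi.single_apply]

theorem gen_zero_mul_gen_two : gen ψ 0 * gen ψ 2 = ⟨0, Pi.single 1 1, 0⟩ := by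
  apply ext_coords <;>
    simp [mul_c, mul_m, mul_n, mulC, mulM, mulN, gen, sym, Pi.single_apply]

theorem gen_zero_mul_gen_one : gen ψ 0 * gen ψ 1 = ⟨0, Pi.single 2 1, 0⟩ := by
  apply ext_coords <;>
    simp [mul_c, mul_m, mul_n, mulC, mulM, mulN, gen, sym, Pi.single_apply]

theorem gen_mul_single (i : Fin 3) :
    gen ψ i * ⟨0, Pi.single i 1, 0⟩ = ⟨0, 0, Pi.single i 1⟩ := by
  apply ext_coords <;> fin_cases i <;>
    simp [mul_c, mul_m, mul_n, mulC, mulM, mulN, gen, sym, Pi.single_apply]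

theorem form_gen_single (i : Fin 3) : form ψ (gen ψ i) ⟨0, Pi.single i 1, 0⟩ = ψ := by
  fin_cases i <;> simp [form, formFun, Fin.sum_univ_three, gen, sym, Pi.single_apply]

/-- This shows that the three idempotents generate the model. -/
theorem eq_sum (x : JordanModel S ψ) : x = x.c 0 • gen ψ 0 + x.c 1 • gen ψ 1 + x.c 2 • gen ψ 2
    + x.m 0 • (gen ψ 1 * gen ψ 2) + x.m 1 • (gen ψ 0 * gen ψ 2) + x.m 2 • (gen ψ 0 * gen ψ 1)
    + x.n 0 • (gen ψ 0 * (gen ψ 1 * gen ψ 2)) + x.n 1 • (gen ψ 1 * (gen ψ 0 * gen ψ 2))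
    + x.n 2 • (gen ψ 2 * (gen ψ 0 * gen ψ 1)) := by
  rw [gen_one_mul_gen_two, gen_zero_mul_gen_two, gen_zero_mul_gen_one, gen_mul_single,
    gen_mul_single, gen_mul_single]
  apply ext_coords <;> simp [gen, Pi.single_apply]

end Gen

end JordanModel

/-! ### The doubled model and the eigenspaces of its axes. -/

open Polynomial in
/-- The algebra of Monster type obtained by splitting each idempotent of a `JordanModel` into the
sum of two annihilating axes. The second component consists of the coordinates on the differences of
these axes. -/
def MonsterModel (ψ : ℝ[X]) : Type := JordanModel ℝ[X] ψ × (Fin 3 → ℝ[X])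

namespace MonsterModel

open Polynomial JordanModel

variable {ψ : ℝ[X]}

noncomputable instance : AddCommGroup (MonsterModel ψ) :=
  inferInstanceAs (AddCommGroup (JordanModel ℝ[X] ψ × (Fin 3 → ℝ[X])))

noncomputable instance : Module ℝ[X] (MonsterModel ψ) :=
  inferInstanceAs (Module ℝ[X] (JordanModel ℝ[X] ψ × (Fin 3 → ℝ[X])))

noncomputable instance : Module ℝ (MonsterModel ψ) :=
  inferInstanceAs (Module ℝ (JordanModel ℝ[X] ψ × (Fin 3 → ℝ[X])))

instance : IsScalarTower ℝ ℝ[X] (MonsterModel ψ) :=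
  inferInstanceAs (IsScalarTower ℝ ℝ[X] (JordanModel ℝ[X] ψ × (Fin 3 → ℝ[X])))

/-- The vector with given components. -/
def mk (p : JordanModel ℝ[X] ψ) (d : Fin 3 → ℝ[X]) : MonsterModel ψ := (p, d)

@[simp] theorem mk_fst (p : JordanModel ℝ[X] ψ) (d : Fin 3 → ℝ[X]) : (mk p d).1 = p := rfl

@[simp] theorem mk_snd (p : JordanModel ℝ[X] ψ) (d : Fin 3 → ℝ[X]) (i : Fin 3) :
    (mk p d).2 i = d i := rfl

/-- The product. -/
noncomputable def mul (x y : MonsterModel ψ) : MonsterModel ψ :=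
  -- This encodes d_i d_i = c_i, d_i d_j = 0 for i ≠ j, and d_i p = (c_i, p) d_i for p in the Jordan
  -- model.
  (x.1 * y.1 + ∑ i, (x.2 i * y.2 i) • gen ψ i,
    fun i => form ψ (gen ψ i) x.1 * y.2 i + form ψ (gen ψ i) y.1 * x.2 i)

noncomputable instance : Mul (MonsterModel ψ) := ⟨mul⟩

@[ext] theorem ext {x y : MonsterModel ψ} (h1 : x.1 = y.1) (h2 : ∀ i, x.2 i = y.2 i) : x = y :=
  Prod.ext h1 (funext h2)

@[simp] theorem zero_fst : (0 : MonsterModel ψ).1 = 0 := rfl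
@[simp] theorem zero_snd (i : Fin 3) : (0 : MonsterModel ψ).2 i = 0 := rfl
@[simp] theorem add_fst (x y : MonsterModel ψ) : (x + y).1 = x.1 + y.1 := rfl
@[simp] theorem add_snd (x y : MonsterModel ψ) (i : Fin 3) : (x + y).2 i = x.2 i + y.2 i := rfl
@[simp] theorem sub_fst (x y : MonsterModel ψ) : (x - y).1 = x.1 - y.1 := rfl
@[simp] theorem sub_snd (x y : MonsterModel ψ) (i : Fin 3) : (x - y).2 i = x.2 i - y.2 i := rfl
@[simp] theorem neg_fst (x : MonsterModel ψ) : (-x).1 = -x.1 := rfl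
@[simp] theorem neg_snd (x : MonsterModel ψ) (i : Fin 3) : (-x).2 i = -x.2 i := rfl
@[simp] theorem smul_fst (r : ℝ[X]) (x : MonsterModel ψ) : (r • x).1 = r • x.1 := rfl
@[simp] theorem smul_snd (r : ℝ[X]) (x : MonsterModel ψ) (i : Fin 3) :
    (r • x).2 i = r * x.2 i := rfl
@[simp] theorem real_smul_fst (r : ℝ) (x : MonsterModel ψ) : (r • x).1 = r • x.1 := rfl
@[simp] theorem real_smul_snd (r : ℝ) (x : MonsterModel ψ) (i : Fin 3) :
    (r • x).2 i = r • x.2 i := rfl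
theorem mul_fst (x y : MonsterModel ψ) :
    (x * y).1 = x.1 * y.1 + ∑ i, (x.2 i * y.2 i) • gen ψ i := rfl
theorem mul_snd (x y : MonsterModel ψ) (i : Fin 3) :
    (x * y).2 i = form ψ (gen ψ i) x.1 * y.2 i + form ψ (gen ψ i) y.1 * x.2 i := rfl

theorem mul_comm' (x y : MonsterModel ψ) : x * y = y * x := by
  ext1
  · simp only [mul_fst, mul_comm]
  · rename_i i
    rw [mul_snd, mul_snd, add_comm]

theorem add_mul' (x y z : MonsterModel ψ) : (x + y) * z = x * z + y * z := by
  ext1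
  · simp only [mul_fst, add_fst, add_snd, add_mul, add_smul, Finset.sum_add_distrib]
    abel
  · rename_i i
    simp only [mul_snd, add_snd, add_fst, _root_.map_add]
    ring

noncomputable instance : NonUnitalNonAssocCommRing (MonsterModel ψ) where
  mul_comm := mul_comm'
  right_distrib := add_mul'
  left_distrib x y z := by rw [mul_comm', add_mul', mul_comm' x y, mul_comm' x z]
  zero_mul x := by
    have h := add_mul' 0 0 x
    rw [add_zero] at h
    exact left_eq_add.mp h
  mul_zero x := by
    have h := add_mul' 0 0 x
    rw [add_zero] at h
    rw [mul_comm', left_eq_add.mp h]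

theorem smul_mul' (r : ℝ[X]) (x y : MonsterModel ψ) : (r • x) * y = r • (x * y) := by
  ext1
  · simp only [mul_fst, smul_fst, smul_snd, smul_mul_assoc, smul_add, Finset.smul_sum, smul_smul,
      mul_assoc]
  · rename_i i
    simp only [mul_snd, smul_snd, smul_fst, _root_.map_smul, smul_eq_mul]
    ring

instance : IsScalarTower ℝ[X] (MonsterModel ψ) (MonsterModel ψ) where
  smul_assoc := smul_mul'

instance : SMulCommClass ℝ[X] (MonsterModel ψ) (MonsterModel ψ) where
  smul_comm r x y := by
    rw [smul_eq_mul, smul_eq_mul, mul_comm x (r • y), smul_mul', mul_comm]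

/-- The Frobenius form. -/
noncomputable def bilin (ψ : ℝ[X]) : MonsterModel ψ →ₗ[ℝ[X]] MonsterModel ψ →ₗ[ℝ[X]] ℝ[X] :=
  -- The sum and the difference of two orthogonal axes of length 1 have length 2, whereas c_i has
  -- length 1 in the normalized form.
  LinearMap.mk₂ ℝ[X] (fun x y => 2 * form ψ x.1 y.1 + 2 * ∑ i, x.2 i * y.2 i)
    (fun x y z => by
      simp only [add_fst, add_snd, _root_.map_add, LinearMap.add_apply, add_mul, Finset.sum_add_distrib]
      ring)
    (fun r x y => by
      simp only [smul_fst, smul_snd, _root_.map_smul, LinearMap.smul_apply, smul_eq_mul, mul_assoc,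
        ← Finset.mul_sum]
      ring)
    (fun x y z => by
      simp only [add_fst, add_snd, _root_.map_add, mul_add, Finset.sum_add_distrib]
      ring)
    (fun r x y => by
      simp only [smul_fst, smul_snd, _root_.map_smul, smul_eq_mul, mul_left_comm _ r,
        ← Finset.mul_sum]
      ring)

theorem bilin_apply (x y : MonsterModel ψ) :
    bilin ψ x y = 2 * form ψ x.1 y.1 + 2 * ∑ i, x.2 i * y.2 i := rfl

theorem bilin_assoc (x y z : MonsterModel ψ) : bilin ψ x (y * z) = bilin ψ (x * y) z := by
  simp only [bilin_apply, mul_fst, mul_snd, _root_.map_add, LinearMap.add_apply, form_assoc, _root_.map_sum,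
    LinearMap.sum_apply, _root_.map_smul, LinearMap.smul_apply, smul_eq_mul, Fin.sum_univ_three,
    form_symm x.1 (gen ψ _)]
  ring

/-- The axis `(c i + e d i) / 2`, for a sign `e`. -/
noncomputable def axis (ψ : ℝ[X]) (i : Fin 3) (e : ℝ[X]) : MonsterModel ψ :=
  ((1 / 2 : ℝ) • gen ψ i, Pi.single i ((1 / 2 : ℝ) • e))

section Axis

variable (i : Fin 3) {e : ℝ[X]}

instance : IsScalarTower ℝ (JordanModel ℝ[X] ψ) (JordanModel ℝ[X] ψ) where
  smul_assoc r x y := by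
    rw [smul_eq_mul, smul_eq_mul, ← algebraMap_smul ℝ[X] r x, ← algebraMap_smul ℝ[X] r (x * y),
      smul_mul_assoc]

instance : SMulCommClass ℝ (JordanModel ℝ[X] ψ) (JordanModel ℝ[X] ψ) where
  smul_comm r x y := by
    rw [smul_eq_mul, smul_eq_mul, ← algebraMap_smul ℝ[X] r y, ← algebraMap_smul ℝ[X] r (x * y),
      mul_smul_comm]

@[simp] theorem axis_fst : (axis ψ i e).1 = (1 / 2 : ℝ) • gen ψ i := rfl

@[simp] theorem axis_snd_self : (axis ψ i e).2 i = (1 / 2 : ℝ) • e := Pi.single_eq_same i _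

@[simp] theorem axis_snd_of_ne {j : Fin 3} (h : j ≠ i) : (axis ψ i e).2 j = 0 :=
  Pi.single_eq_of_ne h _

theorem axis_mul_fst (x : MonsterModel ψ) : (axis ψ i e * x).1 =
    (1 / 2 : ℝ) • (gen ψ i * x.1) + (1 / 2 : ℝ) • ((e * x.2 i) • gen ψ i) := by
  rw [mul_fst, Finset.sum_eq_single i (fun j _ hj => by simp [axis, hj]) (by simp)]
  simp only [axis, Pi.single_eq_same]
  rw [smul_mul_assoc, ← smul_assoc, smul_mul_assoc]

theorem form_real_smul_left (r : ℝ) (x y : JordanModel ℝ[X] ψ) :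
    form ψ (r • x) y = r • form ψ x y := by
  rw [← algebraMap_smul ℝ[X] r x, _root_.map_smul, LinearMap.smul_apply, algebraMap_smul]

theorem form_real_smul_right (r : ℝ) (x y : JordanModel ℝ[X] ψ) :
    form ψ x (r • y) = r • form ψ x y := by
  rw [← algebraMap_smul ℝ[X] r y, _root_.map_smul, algebraMap_smul]

theorem axis_mul_snd (x : MonsterModel ψ) : (axis ψ i e * x).2 i =
    (1 / 2 : ℝ) • x.2 i + (1 / 2 : ℝ) • (e * form ψ (gen ψ i) x.1) := by
  rw [mul_snd]
  simp only [axis, Pi.single_eq_same, form_real_smul_right, form_gen_self]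
  algebra

theorem axis_mul_snd_of_ne {j : Fin 3} (h : j ≠ i) (x : MonsterModel ψ) :
    (axis ψ i e * x).2 j = (1 / 32 : ℝ) • x.2 j := by
  rw [mul_snd]
  simp only [axis, Pi.single_eq_of_ne h, form_real_smul_right, form_gen_gen h]
  algebra

variable {i}

/-- The inner product with `gen ψ i` of a product by `gen ψ i`. -/
theorem form_gen_mul_gen (p : JordanModel ℝ[X] ψ) :
    form ψ (gen ψ i) (gen ψ i * p) = form ψ (gen ψ i) p := by
  rw [form_assoc, gen_mul_self]

/-- The right side describes a vector killed by c_i plus a multiple of the opposite axis (c_i - e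
d_i)/2. -/
theorem axis_mul_eq_zero_iff (he : e * e = 1) {x : MonsterModel ψ} :
    axis ψ i e * x = (0 : ℝ) • x ↔ gen ψ i * x.1 = form ψ (gen ψ i) x.1 • gen ψ i ∧
      x.2 i = -(e * form ψ (gen ψ i) x.1) ∧ ∀ j, j ≠ i → x.2 j = 0 := by
  constructor
  · intro h
    have h1 := axis_mul_fst i x (e := e)
    have h2 := axis_mul_snd i x (e := e)
    have h3 := fun j (hj : j ≠ i) => axis_mul_snd_of_ne i hj x (e := e)
    rw [h] at h1 h2 h3
    simp only [zero_smul, zero_fst, zero_snd] at h1 h2 h3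
    have h4 : x.2 i = -(e * form ψ (gen ψ i) x.1) := by
      have : (1 / 2 : ℝ) • (x.2 i + e * form ψ (gen ψ i) x.1) = 0 := by rw [smul_add, ← h2]
      exact eq_neg_of_add_eq_zero_left ((smul_eq_zero.mp this).resolve_left (by norm_num))
    refine ⟨?_, h4, fun j hj => ((smul_eq_zero.mp (h3 j hj).symm).resolve_left (by norm_num))⟩
    rw [h4] at h1
    have : (1 / 2 : ℝ) • (gen ψ i * x.1 - form ψ (gen ψ i) x.1 • gen ψ i) = 0 := by
      rw [h1]
      match_scalars
      · algebra
      · linear_combination (norm := algebra) ((1 / 2 : ℝ) • form ψ (gen ψ i) x.1) * he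
    exact sub_eq_zero.mp ((smul_eq_zero.mp this).resolve_left (by norm_num))
  · rintro ⟨h1, h2, h3⟩
    rw [zero_smul]
    refine ext ?_ fun j => ?_
    · rw [axis_mul_fst, h1, h2, zero_fst]
      match_scalars
      linear_combination (norm := algebra) (-(1 / 2 : ℝ) • form ψ (gen ψ i) x.1) * he
    · by_cases hj : j = i
      · subst hj
        rw [axis_mul_snd, h2]
        simp
      · rw [axis_mul_snd_of_ne i hj, h3 j hj]
        simp

/-- These eigenvectors do not depend on the sign `e`, so the two axes of a pair share them. -/
theorem axis_mul_eq_quarter_iff (he : e * e = 1) {x : MonsterModel ψ} :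
    axis ψ i e * x = (1 / 4 : ℝ) • x ↔ gen ψ i * x.1 = (1 / 2 : ℝ) • x.1 ∧
      form ψ (gen ψ i) x.1 = 0 ∧ ∀ j, x.2 j = 0 := by
  constructor
  · intro h
    have h1 := axis_mul_fst i x (e := e)
    have h2 := axis_mul_snd i x (e := e)
    have h3 := fun j (hj : j ≠ i) => axis_mul_snd_of_ne i hj x (e := e)
    rw [h] at h1 h2 h3
    simp only [real_smul_fst, real_smul_snd] at h1 h2 h3
    have h4 : x.2 i = -(2 : ℝ) • (e * form ψ (gen ψ i) x.1) := by
      linear_combination (norm := algebra) -(4 : ℝ) • h2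
    have h5 : gen ψ i * x.1 = (1 / 2 : ℝ) • x.1 + (2 : ℝ) • form ψ (gen ψ i) x.1 • gen ψ i := by
      linear_combination (norm := skip) -(2 : ℝ) • h1
      rw [h4]
      match_scalars
      · algebra
      · linear_combination (norm := algebra) (2 : ℝ) • form ψ (gen ψ i) x.1 * he
      · algebra
    -- Pairing the previous formula with c_i gives ρ = ρ/2 + 2ρ for this inner product ρ.
    have h6 : form ψ (gen ψ i) x.1 = 0 := by
      have := form_gen_mul_gen (i := i) x.1
      rw [h5, _root_.map_add, form_real_smul_right, form_real_smul_right, _root_.map_smul,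
        form_gen_self] at this
      linear_combination (norm := (simp only [smul_eq_mul]; algebra)) (2 / 3 : ℝ) • this
    refine ⟨by simpa [h6] using h5, h6, fun j => ?_⟩
    by_cases hj : j = i
    · subst hj
      rw [h4, h6, mul_zero, smul_zero]
    · linear_combination (norm := algebra) (32 / 7 : ℝ) • h3 j hj
  · rintro ⟨h1, h2, h3⟩
    refine ext ?_ fun j => ?_
    · rw [axis_mul_fst, h1, h3, real_smul_fst, mul_zero, zero_smul, smul_zero, add_zero, smul_smul]
      norm_num
    · by_cases hj : j = i
      · subst hj
        rw [axis_mul_snd, h2, real_smul_snd, h3]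
        simp
      · rw [axis_mul_snd_of_ne i hj, real_smul_snd, h3 j]
        simp

/-- The solutions are the combinations of the d_j with j ≠ i. -/
theorem axis_mul_eq_thirtySecond_iff (he : e * e = 1) {x : MonsterModel ψ} :
    axis ψ i e * x = (1 / 32 : ℝ) • x ↔ x.1 = 0 ∧ x.2 i = 0 := by
  constructor
  · intro h
    have h1 := axis_mul_fst i x (e := e)
    have h2 := axis_mul_snd i x (e := e)
    rw [h] at h1 h2
    simp only [real_smul_fst, real_smul_snd] at h1 h2
    have h4 : x.2 i = -(16 / 15 : ℝ) • (e * form ψ (gen ψ i) x.1) := by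
      linear_combination (norm := algebra) -(32 / 15 : ℝ) • h2
    have h5 : gen ψ i * x.1 =
        (1 / 16 : ℝ) • x.1 + (16 / 15 : ℝ) • form ψ (gen ψ i) x.1 • gen ψ i := by
      linear_combination (norm := skip) -(2 : ℝ) • h1
      rw [h4]
      match_scalars
      · algebra
      · linear_combination (norm := algebra) (16 / 15 : ℝ) • form ψ (gen ψ i) x.1 * he
      · algebra
    have h6 : form ψ (gen ψ i) x.1 = 0 := by
      have := form_gen_mul_gen (i := i) x.1
      rw [h5, _root_.map_add, form_real_smul_right, form_real_smul_right, _root_.map_smul,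
        form_gen_self] at this
      linear_combination (norm := (simp only [smul_eq_mul]; algebra)) (240 / 31 : ℝ) • this
    refine ⟨?_, by rw [h4, h6, mul_zero, smul_zero]⟩
    have h7 : gen ψ i * x.1 = (1 / 16 : ℝ) • x.1 := by simpa [h6] using h5
    have h8 := gen_quad i x.1
    rw [h6, h7, mul_smul_comm, h7] at h8
    -- The value 1/16 is no eigenvalue of c_i: the quadratic equation leaves the factor 1/32 -
    -- 1/256.
    have h9 : (7 / 256 : ℝ) • x.1 = 0 := by
      linear_combination (norm := skip) -h8
      match_scalars <;> algebra
    exact (smul_eq_zero.mp h9).resolve_left (by norm_num)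
  · rintro ⟨h1, h2⟩
    refine ext ?_ fun j => ?_
    · rw [axis_mul_fst, h1, h2, real_smul_fst, h1]
      simp
    · by_cases hj : j = i
      · subst hj
        rw [axis_mul_snd, real_smul_snd, h1, h2]
        simp
      · rw [axis_mul_snd_of_ne i hj, real_smul_snd]

/-- The axis spans its `1`-eigenspace. -/
theorem axis_mul_eq_self_iff (he : e * e = 1) {x : MonsterModel ψ} :
    axis ψ i e * x = (1 : ℝ) • x ↔ ∃ r : ℝ[X], x = r • axis ψ i e := by
  constructor
  · intro h
    have h1 := axis_mul_fst i x (e := e)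
    have h2 := axis_mul_snd i x (e := e)
    have h3 := fun j (hj : j ≠ i) => axis_mul_snd_of_ne i hj x (e := e)
    rw [h] at h1 h2 h3
    simp only [real_smul_fst, real_smul_snd] at h1 h2 h3
    have h4 : x.2 i = e * form ψ (gen ψ i) x.1 := by
      linear_combination (norm := algebra) (2 : ℝ) • h2
    have h5 : gen ψ i * x.1 = (2 : ℝ) • x.1 - form ψ (gen ψ i) x.1 • gen ψ i := by
      linear_combination (norm := skip) -(2 : ℝ) • h1
      rw [h4]
      match_scalars
      · algebra
      · linear_combination (norm := algebra) -form ψ (gen ψ i) x.1 * he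
      · algebra
    have h6 : x.1 = form ψ (gen ψ i) x.1 • gen ψ i := by
      have h8 := gen_quad i x.1
      rw [h5, mul_sub, mul_smul_comm, mul_smul_comm, gen_mul_self, h5] at h8
      linear_combination (norm := skip) (1 / 3 : ℝ) • h8
      match_scalars <;> algebra
    refine ⟨(2 : ℝ) • form ψ (gen ψ i) x.1, ext ?_ fun j => ?_⟩
    · nth_rewrite 1 [h6]
      simp only [smul_fst, axis_fst]
      match_scalars
      algebra
    · by_cases hj : j = i
      · subst hj
        simp only [smul_snd, axis_snd_self]
        rw [h4]
        algebra
      · simp only [smul_snd, axis_snd_of_ne i hj]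
        linear_combination (norm := algebra) (32 / 31 : ℝ) • h3 j hj
  · rintro ⟨r, rfl⟩
    have h : axis ψ i e * axis ψ i e = axis ψ i e := by
      refine ext ?_ fun j => ?_
      · rw [axis_mul_fst]
        simp only [axis_fst, axis_snd_self, mul_smul_comm, gen_mul_self]
        match_scalars
        linear_combination (norm := algebra) (1 / 4 : ℝ) • he
      · by_cases hj : j = i
        · subst hj
          rw [axis_mul_snd]
          simp only [axis_fst, axis_snd_self, form_real_smul_right, form_gen_self]
          algebra
        · rw [axis_mul_snd_of_ne i hj]
          simp only [axis_snd_of_ne i hj, smul_zero]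
    rw [mul_smul_comm, h, one_smul]

/-- The decomposition into eigenvectors of an axis. -/
theorem exists_eigen_decomp (he : e * e = 1) (x : MonsterModel ψ) : ∃ (r : ℝ[X])
    (x₀ x₁ x₂ : MonsterModel ψ), axis ψ i e * x₀ = (0 : ℝ) • x₀ ∧
      axis ψ i e * x₁ = (1 / 4 : ℝ) • x₁ ∧ axis ψ i e * x₂ = (1 / 32 : ℝ) • x₂ ∧
      x = r • axis ψ i e + x₀ + x₁ + x₂ ∧ ((∀ j, j ≠ i → x.2 j = 0) → x₂ = 0) := by
  set p := x.1 with hp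
  set ρ := form ψ (gen ψ i) p with hρ
  have hq : gen ψ i * (gen ψ i * p) = (1 / 2 : ℝ) • (gen ψ i * p) + (1 / 2 : ℝ) • ρ • gen ψ i :=
    gen_quad i p
  have hf : form ψ (gen ψ i) (gen ψ i * p) = ρ := form_gen_mul_gen p
  -- The coefficient of the axis is its inner product with x. The 1/4-part is the 1/2-part 2 (c_i p
  -- - ρ c_i) of p under c_i. The 0-part is p - 2 c_i p + ρ c_i plus (ρ - e x_i) times the opposite
  -- axis, and the 1/32-part collects the d_j with j ≠ i.
  refine ⟨ρ + e * x.2 i,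
    mk (p - (1 / 2 : ℝ) • (ρ + e * x.2 i) • gen ψ i - (2 : ℝ) • (gen ψ i * p)
      + (2 : ℝ) • ρ • gen ψ i) (Pi.single i ((1 / 2 : ℝ) • (x.2 i - e * ρ))),
    mk ((2 : ℝ) • (gen ψ i * p - ρ • gen ψ i)) 0, mk 0 (x.2 - Pi.single i (x.2 i)), ?_, ?_, ?_,
    ?_, ?_⟩
  · refine (axis_mul_eq_zero_iff he).mpr ⟨?_, ?_, ?_⟩
    · simp only [mk_fst, mul_add, mul_sub, mul_smul_comm, gen_mul_self, hq, _root_.map_add,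
        _root_.map_sub, form_real_smul_right, _root_.map_smul, form_gen_self, hf, ← hρ, smul_eq_mul]
      match_scalars <;> algebra
    · simp only [mk_fst, mk_snd, Pi.single_eq_same, _root_.map_add,
        _root_.map_sub, form_real_smul_right, _root_.map_smul, form_gen_self, hf, ← hρ, smul_eq_mul]
      linear_combination (norm := algebra) (-(1 / 2 : ℝ) • x.2 i) * he
    · intro j hj
      simp [hj]
  · refine (axis_mul_eq_quarter_iff he).mpr ⟨?_, ?_, fun _ => rfl⟩
    · simp only [mk_fst, mul_sub, mul_smul_comm, gen_mul_self, hq]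
      match_scalars <;> algebra
    · simp only [mk_fst, _root_.map_sub, form_real_smul_right, _root_.map_smul, form_gen_self, hf,
        smul_eq_mul, mul_one, sub_self, smul_zero]
  · exact (axis_mul_eq_thirtySecond_iff he).mpr ⟨rfl, by simp⟩
  · refine ext ?_ fun j => ?_
    · simp only [add_fst, smul_fst, axis_fst, mk_fst, add_zero, ← hp]
      match_scalars <;> algebra
    · by_cases hj : j = i
      · subst hj
        simp only [add_snd, mk_snd, smul_snd, axis_snd_self, Pi.single_eq_same, Pi.zero_apply,
          Pi.sub_apply]
        linear_combination (norm := algebra) (-(1 / 2 : ℝ) • x.2 j) * he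
      · simp [hj]
  · intro h
    refine ext rfl fun j => ?_
    by_cases hj : j = i
    · subst hj
      simp
    · simp [hj, h j hj]

end Axis

end MonsterModel

/-! ### Independence of eigenspaces. -/

namespace MonsterEigenvalue

theorem val_injective : Function.Injective val := by
  intro e f h
  cases e <;> cases f <;> first | rfl | (norm_num [val] at h)

end MonsterEigenvalue

namespace MarkedFrobeniusAlgebra

/-- Eigenspaces for distinct eigenvalues are independent. -/
theorem iSupIndep_eigenspace (M : MarkedFrobeniusAlgebra) (a : M.V) :
    iSupIndep fun e : MonsterEigenvalue => M.eigenspace a e.val := by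
  -- The coefficient ring is arbitrary, but the eigenvalues are real, so independence can be taken
  -- from the real vector space.
  have h := (Module.End.eigenspaces_iSupIndep (LinearMap.mulLeft ℝ a)).comp
    MonsterEigenvalue.val_injective
  have key : ∀ e : MonsterEigenvalue, (M.eigenspace a e.val).restrictScalars ℝ =
      Module.End.eigenspace (LinearMap.mulLeft ℝ a) e.val := by
    intro e
    ext x
    rw [Submodule.restrictScalars_mem, Module.End.mem_eigenspace_iff]
    rfl
  rw [iSupIndep_def] at h ⊢
  intro e
  have he := h e
  rw [Submodule.disjoint_def] at he ⊢
  intro x hx hx'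
  refine he x ?_ ?_
  · rw [Function.comp_apply, ← key]
    exact hx
  · simp only [Function.comp_apply, ← key, ← Submodule.restrictScalars_iSup]
    exact hx'

end MarkedFrobeniusAlgebra

/-! ### Generation by the axes and the universal algebra. -/

namespace MonsterModel

open Polynomial JordanModel

variable {ψ : ℝ[X]}

/-- The vector with vanishing second component. -/
noncomputable def even (p : JordanModel ℝ[X] ψ) : MonsterModel ψ := mk p 0

/-- The difference of two axes. -/
noncomputable def odd (ψ : ℝ[X]) (i : Fin 3) : MonsterModel ψ := mk 0 (Pi.single i 1)

@[simp] theorem even_fst (p : JordanModel ℝ[X] ψ) : (even p).1 = p := rfl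
@[simp] theorem even_snd (p : JordanModel ℝ[X] ψ) (i : Fin 3) : (even p).2 i = 0 := rfl
@[simp] theorem odd_fst (i : Fin 3) : (odd ψ i).1 = 0 := rfl
@[simp] theorem odd_snd (i j : Fin 3) : (odd ψ i).2 j = (Pi.single i 1 : Fin 3 → ℝ[X]) j := rfl

theorem even_mul (p q : JordanModel ℝ[X] ψ) : even p * even q = even (p * q) :=
  ext (by simp [mul_fst]) fun i => by simp [mul_snd]

theorem even_add (p q : JordanModel ℝ[X] ψ) : even (p + q) = even p + even q :=
  ext (by simp) fun i => by simp

theorem even_smul (r : ℝ[X]) (p : JordanModel ℝ[X] ψ) : even (r • p) = r • even p :=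
  ext (by simp) fun i => by simp

theorem eq_even_add_odd (x : MonsterModel ψ) :
    x = even x.1 + x.2 0 • odd ψ 0 + x.2 1 • odd ψ 1 + x.2 2 • odd ψ 2 :=
  ext (by simp) fun i => by fin_cases i <;> simp

theorem axis_add (i : Fin 3) (e f : ℝ[X]) (h : e + f = 0) :
    axis ψ i e + axis ψ i f = even (gen ψ i) := by
  refine ext ?_ fun j => ?_
  · simp only [add_fst, axis_fst, even_fst]
    match_scalars
    algebra
  · by_cases hj : j = i
    · subst hj
      simp only [add_snd, axis_snd_self, even_snd, ← smul_add, h, smul_zero]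
    · simp [hj]

theorem axis_sub (i : Fin 3) : axis ψ i 1 - axis ψ i (-1) = odd ψ i := by
  refine ext ?_ fun j => ?_
  · simp
  · by_cases hj : j = i
    · subst hj
      simp only [sub_snd, axis_snd_self, odd_snd, Pi.single_eq_same]
      algebra
    · simp [hj]

/-- Sums and differences of opposite axes are the c_i and d_i, and products of the c_i span the
Jordan model. -/
theorem mem_of_axis_mem (S : NonUnitalSubalgebra ℝ[X] (MonsterModel ψ))
    (h : ∀ i, axis ψ i 1 ∈ S ∧ axis ψ i (-1) ∈ S) (x : MonsterModel ψ) : x ∈ S := by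
  have h1 (i) : even (gen ψ i) ∈ S := by
    rw [← axis_add i 1 (-1) (by ring)]
    exact add_mem (h i).1 (h i).2
  have h2 (i) : odd ψ i ∈ S := by
    rw [← axis_sub]
    exact sub_mem (h i).1 (h i).2
  have h3 {p q : JordanModel ℝ[X] ψ} (hp : even p ∈ S) (hq : even q ∈ S) : even (p * q) ∈ S := by
    rw [← even_mul]
    exact mul_mem hp hq
  have hs (r : ℝ[X]) {x : MonsterModel ψ} (hx : x ∈ S) : r • x ∈ S := S.smul_mem' r hx
  have h4 (p : JordanModel ℝ[X] ψ) : even p ∈ S := by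
    rw [eq_sum p]
    simp only [even_add, even_smul]
    refine add_mem (add_mem (add_mem (add_mem (add_mem (add_mem (add_mem (add_mem ?_ ?_) ?_) ?_) ?_)
      ?_) ?_) ?_) ?_
    exacts [hs _ (h1 0), hs _ (h1 1), hs _ (h1 2), hs _ (h3 (h1 1) (h1 2)), hs _ (h3 (h1 0) (h1 2)),
      hs _ (h3 (h1 0) (h1 1)), hs _ (h3 (h1 0) (h3 (h1 1) (h1 2))),
      hs _ (h3 (h1 1) (h3 (h1 0) (h1 2))), hs _ (h3 (h1 2) (h3 (h1 0) (h1 1)))]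
  rw [eq_even_add_odd x]
  exact add_mem (add_mem (add_mem (h4 _) (hs _ (h2 _)))
    (hs _ (h2 _))) (hs _ (h2 _))

/-- A sign as a polynomial. -/
noncomputable def sgn (ε : ℤˣ) : ℝ[X] := ((ε : ℤ) : ℝ[X])

@[simp] theorem sgn_one : sgn 1 = 1 := by simp [sgn]
@[simp] theorem sgn_neg (ε : ℤˣ) : sgn (-ε) = -sgn ε := by simp [sgn]

theorem sgn_mul_self (ε : ℤˣ) : sgn ε * sgn ε = 1 := by
  rcases Int.units_eq_one_or ε with rfl | rfl <;> simp [sgn]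

/-- The inner product of an idempotent and the product of the two others, in terms of
`t = ⟨a_1, v_{(2,3)}⟩`. -/
noncomputable def param : ℝ[X] := algebraMap ℝ ℝ[X] (1 / 64) - (3 / 16 : ℝ) • X

/-- A value of the form on monomials that recovers ψ. For the chosen parameter it recovers X, so
such values generate the coefficient ring. -/
theorem bilin_axis_axis_mul_axis : bilin ψ (axis ψ 0 1) (axis ψ 1 1 * axis ψ 2 1) =
    (1 / 4 : ℝ) • ψ := by
  have h0 : (axis ψ 1 1 * axis ψ 2 1).2 0 = 0 := by
    simp only [axis_mul_snd_of_ne 1 (by decide : (0 : Fin 3) ≠ 1),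
      axis_snd_of_ne 2 (by decide : (0 : Fin 3) ≠ 2), smul_zero]
  have h1 : (axis ψ 1 1 * axis ψ 2 1).1 = (1 / 4 : ℝ) • (gen ψ 1 * gen ψ 2) := by
    simp only [axis_mul_fst, axis_fst, axis_snd_of_ne 2 (by decide : (1 : Fin 3) ≠ 2), mul_zero,
      zero_smul, smul_zero, add_zero, mul_smul_comm, smul_smul]
    norm_num
  have h2 (y : MonsterModel ψ) : ∑ i, (axis ψ 0 1).2 i * y.2 i = (1 / 2 : ℝ) • y.2 0 := by
    rw [Finset.sum_eq_single 0 (fun j _ hj => by simp [hj]) (by simp), axis_snd_self,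
      smul_mul_assoc, one_mul]
  rw [bilin_apply, h2, h0, h1, axis_fst, form_real_smul_left, form_real_smul_right,
    gen_one_mul_gen_two, form_gen_single]
  algebra

theorem X_mem_of_param_mem (A : Subalgebra ℝ ℝ[X]) (hA : (1 / 4 : ℝ) • param ∈ A) :
    (X : ℝ[X]) ∈ A := by
  have h : (X : ℝ[X]) = algebraMap ℝ ℝ[X] (1 / 12) - (64 / 3 : ℝ) • (1 / 4 : ℝ) • param := by
    unfold param
    algebra
  rw [h]
  exact sub_mem (A.algebraMap_mem _) (A.smul_mem hA _)

/-- The universal algebra. -/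
noncomputable def univ : MarkedFrobeniusAlgebra where
  R := ℝ[X]
  V := MonsterModel param
  ax i ε := axis param i (sgn ε)
  form := bilin param
  form_assoc := bilin_assoc
  generated := by
    rw [eq_top_iff]
    intro x _
    refine mem_of_axis_mem _ (fun i => ⟨?_, ?_⟩) x
    · exact NonUnitalAlgebra.subset_adjoin _ ⟨i, 1, by simp⟩
    · exact NonUnitalAlgebra.subset_adjoin _ ⟨i, -1, by simp⟩
  ring_generated := by
    rw [eq_top_iff, ← Polynomial.adjoin_X, Algebra.adjoin_le_iff, Set.singleton_subset_iff]
    refine X_mem_of_param_mem _ (Algebra.subset_adjoin ⟨axis param 0 1,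
      Subsemigroup.subset_closure ⟨0, 1, by simp⟩, axis param 1 1 * axis param 2 1,
      mul_mem (Subsemigroup.subset_closure ⟨1, 1, by simp⟩)
        (Subsemigroup.subset_closure ⟨2, 1, by simp⟩), bilin_axis_axis_mul_axis.symm⟩)

end MonsterModel

/-! ### The fusion rule in the model. -/

namespace MonsterModel

open Polynomial JordanModel

variable {ψ : ℝ[X]}

section Fusion

variable {i : Fin 3} {e : ℝ[X]} (he : e * e = 1) {x y : MonsterModel ψ}
include he

/-- For c_i p = r c_i and c_i q = s c_i the flip identity reduces to c_i (p q) = r s c_i. The odd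
coordinates contribute another r s c_i to the product. -/
theorem zero_mul_zero (hx : axis ψ i e * x = (0 : ℝ) • x) (hy : axis ψ i e * y = (0 : ℝ) • y) :
    axis ψ i e * (x * y) = (0 : ℝ) • (x * y) := by
  obtain ⟨h1, h2, h3⟩ := (axis_mul_eq_zero_iff he).mp hx
  obtain ⟨k1, k2, k3⟩ := (axis_mul_eq_zero_iff he).mp hy
  have hxy : (x * y).1 = x.1 * y.1 +
      (form ψ (gen ψ i) x.1 * form ψ (gen ψ i) y.1) • gen ψ i := by
    rw [mul_fst, Finset.sum_eq_single i (fun j _ hj => by simp [h3 j hj]) (by simp), h2, k2]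
    congr 2
    linear_combination form ψ (gen ψ i) x.1 * form ψ (gen ψ i) y.1 * he
  have hf : form ψ (gen ψ i) (x.1 * y.1) = form ψ (gen ψ i) x.1 * form ψ (gen ψ i) y.1 := by
    rw [form_assoc, h1, _root_.map_smul, LinearMap.smul_apply, smul_eq_mul]
  have hflip := gen_flip i x.1 y.1
  rw [h1, k1] at hflip
  simp only [mul_smul_comm, smul_mul_assoc, gen_mul_self, mul_comm x.1 (gen ψ i),
    mul_comm y.1 (gen ψ i), h1, k1, hf] at hflip
  refine (axis_mul_eq_zero_iff he).mpr ⟨?_, ?_, fun j hj => ?_⟩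
  · simp only [hxy, mul_add, mul_smul_comm, gen_mul_self, _root_.map_add, _root_.map_smul,
      form_gen_self, hf, smul_eq_mul, mul_one]
    clear hxy hf
    generalize gen ψ i * (x.1 * y.1) = z at hflip ⊢
    generalize form ψ (gen ψ i) x.1 = r at hflip ⊢
    generalize form ψ (gen ψ i) y.1 = s at hflip ⊢
    generalize gen ψ i = c at hflip ⊢
    linear_combination (norm := skip) hflip
    match_scalars <;> algebra
  · simp only [hxy, mul_snd, h2, k2, _root_.map_add, _root_.map_smul, form_gen_self, hf,
      smul_eq_mul, mul_one]
    ring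
  · rw [mul_snd, h3 j hj, k3 j hj, mul_zero, mul_zero, add_zero]

theorem zero_mul_quarter (hx : axis ψ i e * x = (0 : ℝ) • x)
    (hy : axis ψ i e * y = (1 / 4 : ℝ) • y) : axis ψ i e * (x * y) = (1 / 4 : ℝ) • (x * y) := by
  obtain ⟨h1, h2, h3⟩ := (axis_mul_eq_zero_iff he).mp hx
  obtain ⟨k1, k2, k3⟩ := (axis_mul_eq_quarter_iff he).mp hy
  have hxy : (x * y).1 = x.1 * y.1 := by simp [mul_fst, k3]
  have hf : form ψ (gen ψ i) (x.1 * y.1) = 0 := by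
    rw [form_assoc, h1, _root_.map_smul, LinearMap.smul_apply, k2, smul_zero]
  have hflip := gen_flip i x.1 y.1
  rw [h1, k1] at hflip
  simp only [mul_smul_comm, smul_mul_assoc, k1, k2, mul_comm y.1 (gen ψ i), hf] at hflip
  refine (axis_mul_eq_quarter_iff he).mpr ⟨?_, ?_, fun j => ?_⟩
  · rw [hxy]
    linear_combination (norm := skip) hflip
    match_scalars <;> algebra
  · rw [hxy, hf]
  · by_cases hj : j = i
    · subst hj
      rw [mul_snd, k3, k2, mul_zero, zero_mul, add_zero]
    · rw [mul_snd, k3, h3 j hj, mul_zero, mul_zero, add_zero]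

/-- For 1/2-eigenvectors p, q of c_i orthogonal to c_i the flip identity reduces to c_i (p q) =
(c_i, p q) c_i, and this coefficient is the multiple of the axis to be removed. -/
theorem quarter_mul_quarter (hx : axis ψ i e * x = (1 / 4 : ℝ) • x)
    (hy : axis ψ i e * y = (1 / 4 : ℝ) • y) :
    ∃ r : ℝ[X], axis ψ i e * (x * y - r • axis ψ i e) = (0 : ℝ) • (x * y - r • axis ψ i e) := by
  obtain ⟨h1, h2, h3⟩ := (axis_mul_eq_quarter_iff he).mp hx
  obtain ⟨k1, k2, k3⟩ := (axis_mul_eq_quarter_iff he).mp hy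
  have hxy : (x * y).1 = x.1 * y.1 := by simp [mul_fst, k3]
  have hflip := gen_flip i x.1 y.1
  rw [h1, k1] at hflip
  simp only [mul_smul_comm, smul_mul_assoc, h2, k2, mul_comm y.1 x.1] at hflip
  refine ⟨form ψ (gen ψ i) (x.1 * y.1), (axis_mul_eq_zero_iff he).mpr ⟨?_, ?_, fun j hj => ?_⟩⟩
  · simp only [sub_fst, smul_fst, axis_fst, hxy, mul_sub, mul_smul_comm, gen_mul_self,
      _root_.map_sub, _root_.map_smul, form_real_smul_right, form_gen_self, smul_eq_mul]
    linear_combination (norm := skip) hflip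
    match_scalars <;> algebra
  · simp only [sub_fst, sub_snd, smul_snd, axis_snd_self, smul_fst, axis_fst, hxy, mul_snd, h3, k3,
      _root_.map_sub, _root_.map_smul, form_real_smul_right, form_gen_self, smul_eq_mul, mul_zero]
    algebra
  · simp [mul_snd, h3, k3, hj]

theorem mul_thirtySecond (hx : ∀ j, j ≠ i → x.2 j = 0) (hy : axis ψ i e * y = (1 / 32 : ℝ) • y) :
    axis ψ i e * (x * y) = (1 / 32 : ℝ) • (x * y) := by
  obtain ⟨k1, k2⟩ := (axis_mul_eq_thirtySecond_iff he).mp hy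
  refine (axis_mul_eq_thirtySecond_iff he).mpr ⟨?_, ?_⟩
  · rw [mul_fst, k1, mul_zero, zero_add]
    refine Finset.sum_eq_zero fun j _ => ?_
    by_cases hj : j = i
    · rw [hj, k2, mul_zero, zero_smul]
    · rw [hx j hj, zero_mul, zero_smul]
  · rw [mul_snd, k1, k2, _root_.map_zero, mul_zero, zero_mul, add_zero]

/-- A product of odd vectors is even, hence has no 1/32-component by the last clause of
`exists_eigen_decomp`. -/
theorem thirtySecond_mul_thirtySecond (hx : axis ψ i e * x = (1 / 32 : ℝ) • x)
    (hy : axis ψ i e * y = (1 / 32 : ℝ) • y) (j : Fin 3) : (x * y).2 j = 0 := by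
  obtain ⟨h1, h2⟩ := (axis_mul_eq_thirtySecond_iff he).mp hx
  obtain ⟨k1, k2⟩ := (axis_mul_eq_thirtySecond_iff he).mp hy
  rw [mul_snd, h1, k1, _root_.map_zero, zero_mul, zero_mul, add_zero]

end Fusion

end MonsterModel

namespace MarkedFrobeniusAlgebra

open MonsterEigenvalue

variable {M : MarkedFrobeniusAlgebra}

/-- Independence is automatic, the rules for the 1-eigenspace follow since it consists of multiples
of `a`, and commutativity leaves six products to check. -/
theorem isMonsterAxis_of {a : M.V} (idem : a * a = a)
    (prim : ∀ x ∈ M.eigenspace a 1, ∃ r : M.R, x = r • a)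
    (decomp : ∀ x : M.V, ∃ r : M.R, ∃ x₀ ∈ M.eigenspace a 0, ∃ x₁ ∈ M.eigenspace a (1 / 4),
      ∃ x₂ ∈ M.eigenspace a (1 / 32), x = r • a + x₀ + x₁ + x₂)
    (h00 : ∀ x ∈ M.eigenspace a 0, ∀ y ∈ M.eigenspace a 0, x * y ∈ M.eigenspace a 0)
    (h01 : ∀ x ∈ M.eigenspace a 0, ∀ y ∈ M.eigenspace a (1 / 4), x * y ∈ M.eigenspace a (1 / 4))
    (h11 : ∀ x ∈ M.eigenspace a (1 / 4), ∀ y ∈ M.eigenspace a (1 / 4),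
      ∃ r : M.R, x * y - r • a ∈ M.eigenspace a 0)
    (h02 : ∀ x ∈ M.eigenspace a 0, ∀ y ∈ M.eigenspace a (1 / 32),
      x * y ∈ M.eigenspace a (1 / 32))
    (h12 : ∀ x ∈ M.eigenspace a (1 / 4), ∀ y ∈ M.eigenspace a (1 / 32),
      x * y ∈ M.eigenspace a (1 / 32))
    (h22 : ∀ x ∈ M.eigenspace a (1 / 32), ∀ y ∈ M.eigenspace a (1 / 32), ∃ r : M.R,
      ∃ x₀ ∈ M.eigenspace a 0, ∃ x₁ ∈ M.eigenspace a (1 / 4), x * y = r • a + x₀ + x₁) :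
    M.IsMonsterAxis a := by
  have ha : a ∈ M.eigenspace a one.val := by rw [mem_eigenspace, idem, val, one_smul]
  refine ⟨idem, iSupIndep_eigenspace M a, ?_, ?_⟩
  · refine eq_top_iff.mpr fun x _ => ?_
    obtain ⟨r, x₀, h₀, x₁, h₁, x₂, h₂, rfl⟩ := decomp x
    have mem (g : MonsterEigenvalue) {z : M.V} (hz : z ∈ M.eigenspace a g.val) :
      z ∈ ⨆ e : MonsterEigenvalue, M.eigenspace a e.val := Submodule.mem_iSup_of_mem g hz
    exact add_mem (add_mem (add_mem (Submodule.smul_mem _ r (mem one ha)) (mem zero h₀))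
      (mem quarter h₁)) (mem thirtySecond h₂)
  · have key (e f : MonsterEigenvalue) (x y : M.V) (hx : x ∈ M.eigenspace a e.val)
        (hy : y ∈ M.eigenspace a f.val) (S : Submodule M.R M.V)
        (hS : ∀ g ∈ fusion e f, M.eigenspace a g.val ≤ S) : x * y ∈ S := by
      have one_mul {g : MonsterEigenvalue} {z w : M.V} (hz : z ∈ M.eigenspace a one.val)
          (hw : w ∈ M.eigenspace a g.val) :
          ∃ r : M.R, z * w = g.val • (r • w) := by
        obtain ⟨r, rfl⟩ := prim z hz
        exact ⟨r, by rw [smul_mul_assoc, mem_eigenspace.mp hw, smul_comm]⟩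
      have one_mul_mem {g : MonsterEigenvalue} {z w : M.V} (hz : z ∈ M.eigenspace a one.val)
          (hw : w ∈ M.eigenspace a g.val) (hg : M.eigenspace a g.val ≤ S) : z * w ∈ S := by
        obtain ⟨r, h⟩ := one_mul hz hw
        rw [h, ← algebraMap_smul M.R]
        exact Submodule.smul_mem _ _ (Submodule.smul_mem _ _ (hg hw))
      have one_mul_zero {z w : M.V} (hz : z ∈ M.eigenspace a one.val)
          (hw : w ∈ M.eigenspace a zero.val) : z * w = 0 := by
        obtain ⟨r, h⟩ := one_mul hz hw
        rw [h, val, zero_smul]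
      cases e <;> cases f <;> simp only [fusion, Set.mem_insert_iff, Set.mem_singleton_iff,
        forall_eq_or_imp, forall_eq, Set.mem_empty_iff_false, false_imp_iff, forall_const] at hS
      · exact one_mul_mem hx hy hS
      · rw [one_mul_zero hx hy]
        exact S.zero_mem
      · exact one_mul_mem hx hy hS
      · exact one_mul_mem hx hy hS
      · rw [mul_comm, one_mul_zero hy hx]
        exact S.zero_mem
      · exact hS (h00 x hx y hy)
      · exact hS (h01 x hx y hy)
      · exact hS (h02 x hx y hy)
      · rw [mul_comm]
        exact one_mul_mem hy hx hS
      · rw [mul_comm]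
        exact hS (h01 y hy x hx)
      · obtain ⟨r, h⟩ := h11 x hx y hy
        rw [← sub_add_cancel (x * y) (r • a)]
        exact add_mem (hS.2 h) (Submodule.smul_mem _ r (hS.1 ha))
      · exact hS (h12 x hx y hy)
      · rw [mul_comm]
        exact one_mul_mem hy hx hS
      · rw [mul_comm]
        exact hS (h02 y hy x hx)
      · rw [mul_comm]
        exact hS (h12 y hy x hx)
      · obtain ⟨r, x₀, h₀, x₁, h₁, h⟩ := h22 x hx y hy
        rw [h]
        exact add_mem (add_mem (Submodule.smul_mem _ r (hS.1 ha)) (hS.2.1 h₀)) (hS.2.2 h₁)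
    exact fun e f x hx y hy => key e f x y hx hy _ fun g hg => le_iSup₂_of_le g hg le_rfl

end MarkedFrobeniusAlgebra

/-! ### The model is primitive of Monster type and has property P. -/

namespace MonsterModel

open Polynomial JordanModel

variable {ψ : ℝ[X]}

theorem axis_mul_self (i : Fin 3) {e : ℝ[X]} (he : e * e = 1) :
    axis ψ i e * axis ψ i e = axis ψ i e := by
  have h := (axis_mul_eq_self_iff (i := i) (ψ := ψ) he).mpr ⟨1, (one_smul _ _).symm⟩
  rwa [one_smul] at h

theorem isMonsterAxis_univ (i : Fin 3) (ε : ℤˣ) : univ.IsMonsterAxis (univ.ax i ε) := by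
  have he := sgn_mul_self ε
  refine MarkedFrobeniusAlgebra.isMonsterAxis_of (axis_mul_self i he) ?_ ?_ ?_ ?_ ?_ ?_ ?_ ?_
  · exact fun x hx => (axis_mul_eq_self_iff he).mp hx
  · intro x
    obtain ⟨r, x₀, x₁, x₂, h₀, h₁, h₂, h, -⟩ := exists_eigen_decomp (i := i) he x
    exact ⟨r, x₀, h₀, x₁, h₁, x₂, h₂, h⟩
  · exact fun x hx y hy => zero_mul_zero he hx hy
  · exact fun x hx y hy => zero_mul_quarter he hx hy
  · exact fun x hx y hy => quarter_mul_quarter he hx hy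
  · exact fun x hx y hy => mul_thirtySecond he ((axis_mul_eq_zero_iff he).mp hx).2.2 hy
  · exact fun x hx y hy =>
      mul_thirtySecond he (fun j _ => ((axis_mul_eq_quarter_iff he).mp hx).2.2 j) hy
  · intro x hx y hy
    obtain ⟨r, x₀, x₁, x₂, h₀, h₁, h₂, h, h'⟩ := exists_eigen_decomp (i := i) he (x * y)
    rw [h' fun j _ => thirtySecond_mul_thirtySecond he hx hy j, add_zero] at h
    exact ⟨r, x₀, h₀, x₁, h₁, h⟩

theorem bilin_axis_self (i : Fin 3) {e : ℝ[X]} (he : e * e = 1) :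
    bilin ψ (axis ψ i e) (axis ψ i e) = 1 := by
  rw [bilin_apply, Finset.sum_eq_single i (fun j _ hj => by simp [hj]) (by simp), axis_fst,
    axis_snd_self, form_real_smul_left, form_real_smul_right, form_gen_self]
  linear_combination (norm := algebra) (1 / 2 : ℝ) • he

theorem isPrimitiveMonster_univ : univ.IsPrimitiveMonster where
  axis := isMonsterAxis_univ
  primitive i ε := by
    ext x
    rw [Submodule.mem_span_singleton]
    refine (axis_mul_eq_self_iff (sgn_mul_self ε)).trans ?_
    exact ⟨fun ⟨r, h⟩ => ⟨r, h.symm⟩, fun ⟨r, h⟩ => ⟨r, h.symm⟩⟩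
  norm i ε := bilin_axis_self i (sgn_mul_self ε)

/-- The map that negates all but one of the coordinates on the differences of the axes. -/
noncomputable def tau (ψ : ℝ[X]) (i : Fin 3) : MonsterModel ψ →ₗ[ℝ[X]] MonsterModel ψ where
  toFun x := mk x.1 fun j => if j = i then x.2 j else -x.2 j
  map_add' x y := ext rfl fun j => by
    simp only [mk_snd, add_snd]
    split_ifs <;> ring
  map_smul' r x := ext rfl fun j => by
    simp only [mk_snd, smul_snd, RingHom.id_apply]
    split_ifs <;> ring

theorem tau_fst (i : Fin 3) (x : MonsterModel ψ) : (tau ψ i x).1 = x.1 := rfl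

theorem tau_snd (i j : Fin 3) (x : MonsterModel ψ) :
    (tau ψ i x).2 j = if j = i then x.2 j else -x.2 j := rfl

theorem tau_eq_self {i : Fin 3} {x : MonsterModel ψ} (h : ∀ j, j ≠ i → x.2 j = 0) :
    tau ψ i x = x := by
  refine ext rfl fun j => ?_
  rw [tau_snd]
  split_ifs with hj
  · rfl
  · rw [h j hj, neg_zero]

theorem tau_eq_neg {i : Fin 3} {x : MonsterModel ψ} (h : x.1 = 0) (h' : x.2 i = 0) :
    tau ψ i x = -x := by
  refine ext ?_ fun j => ?_
  · rw [tau_fst, neg_fst, h, neg_zero]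
  · rw [tau_snd, neg_snd]
    split_ifs with hj
    · rw [hj, h', neg_zero]
    · rfl

theorem isMiyamoto_univ (i : Fin 3) (ε : ℤˣ) :
    univ.IsMiyamoto (univ.ax i ε) (tau param i) := by
  have he := sgn_mul_self ε
  refine ⟨fun x hx => ?_, fun x hx => ?_, fun x hx => ?_, fun x hx => ?_⟩
  · obtain ⟨r, rfl⟩ := (axis_mul_eq_self_iff he).mp hx
    exact tau_eq_self fun j hj => by rw [smul_snd, axis_snd_of_ne i hj, mul_zero]
  · exact tau_eq_self ((axis_mul_eq_zero_iff he).mp hx).2.2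
  · exact tau_eq_self fun j _ => ((axis_mul_eq_quarter_iff he).mp hx).2.2 j
  · obtain ⟨h, h'⟩ := (axis_mul_eq_thirtySecond_iff he).mp hx
    exact tau_eq_neg h h'

theorem tau_axis (i : Fin 3) (δ : ℤˣ) : tau param i (univ.ax i δ) = univ.ax i δ ∧
    ∀ j, j ≠ i → tau param i (univ.ax j δ) = univ.ax j (-δ) := by
  refine ⟨tau_eq_self fun j hj => axis_snd_of_ne i hj, fun j hj => ext rfl fun k => ?_⟩
  change (tau param i (axis param j (sgn δ))).2 k = (axis param j (sgn (-δ))).2 k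
  rw [tau_snd]
  by_cases hk : k = j
  · subst hk
    rw [if_neg hj, axis_snd_self, axis_snd_self, sgn_neg, smul_neg]
  · simp [axis_snd_of_ne j hk]

theorem propertyP_univ : univ.PropertyP := by
  refine ⟨fun i j ε δ h => ?_, tau param, fun i ε => ⟨isMiyamoto_univ i ε, tau_axis i⟩⟩
  have h2 : (axis param i (sgn ε)).2 i = (axis param j (sgn δ)).2 i :=
    congrArg (fun x : MonsterModel param => x.2 i) h
  have h0 : sgn ε ≠ 0 := fun h0 => by simpa [h0] using sgn_mul_self ε
  by_cases hij : i = j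
  · subst hij
    refine ⟨rfl, ?_⟩
    rw [axis_snd_self, axis_snd_self] at h2
    have h3 := smul_right_injective _ (by norm_num : (1 / 2 : ℝ) ≠ 0) h2
    exact Units.ext (Int.cast_injective h3)
  · rw [axis_snd_self, axis_snd_of_ne j hij] at h2
    exact absurd ((smul_eq_zero.mp h2).resolve_left (by norm_num)) h0

end MonsterModel

/-! ### The dihedral subalgebra of type 4A. -/

namespace MonsterModel

open Polynomial JordanModel

variable {ψ : ℝ[X]}

/-- The vectors of the subalgebra generated by the first two pairs of axes. -/
noncomputable def dihedral (ψ a b m d e : ℝ[X]) : MonsterModel ψ :=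
  mk ⟨![a, b, 0], ![0, 0, m], 0⟩ ![d, e, 0]

theorem ext_coords {x y : MonsterModel ψ} (c0 : x.1.c 0 = y.1.c 0) (c1 : x.1.c 1 = y.1.c 1)
    (c2 : x.1.c 2 = y.1.c 2) (m0 : x.1.m 0 = y.1.m 0) (m1 : x.1.m 1 = y.1.m 1)
    (m2 : x.1.m 2 = y.1.m 2) (n0 : x.1.n 0 = y.1.n 0) (n1 : x.1.n 1 = y.1.n 1)
    (n2 : x.1.n 2 = y.1.n 2) (d0 : x.2 0 = y.2 0) (d1 : x.2 1 = y.2 1) (d2 : x.2 2 = y.2 2) :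
    x = y :=
  ext (JordanModel.ext_coords c0 c1 c2 m0 m1 m2 n0 n1 n2) fun i => by fin_cases i <;> assumption

theorem dihedral_add (a b m d e a' b' m' d' e' : ℝ[X]) :
    dihedral ψ a b m d e + dihedral ψ a' b' m' d' e' =
      dihedral ψ (a + a') (b + b') (m + m') (d + d') (e + e') := by
  apply ext_coords <;> simp [dihedral]

theorem dihedral_smul (r a b m d e : ℝ[X]) : r • dihedral ψ a b m d e =
    dihedral ψ (r * a) (r * b) (r * m) (r * d) (r * e) := by
  apply ext_coords <;> simp [dihedral]

theorem dihedral_real_smul (r : ℝ) (a b m d e : ℝ[X]) : r • dihedral ψ a b m d e =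
    dihedral ψ (r • a) (r • b) (r • m) (r • d) (r • e) := by
  apply ext_coords <;> simp [dihedral]

theorem dihedral_sub (a b m d e a' b' m' d' e' : ℝ[X]) :
    dihedral ψ a b m d e - dihedral ψ a' b' m' d' e' =
      dihedral ψ (a - a') (b - b') (m - m') (d - d') (e - e') := by
  apply ext_coords <;> simp [dihedral]

theorem dihedral_mul (a b m d e a' b' m' d' e' : ℝ[X]) :
    dihedral ψ a b m d e * dihedral ψ a' b' m' d' e' = dihedral ψ
      (a * a' + (1 / 32 : ℝ) • (a * m' + m * a') + (1 / 64 : ℝ) • (m * m') + d * d')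
      (b * b' + (1 / 32 : ℝ) • (b * m' + m * b') + (1 / 64 : ℝ) • (m * m') + e * e')
      (a * b' + b * a' + (1 / 2 : ℝ) • (a * m' + m * a' + b * m' + m * b')
        + (1 / 32 : ℝ) • (m * m'))
      ((a + (1 / 16 : ℝ) • (b + m)) * d' + (a' + (1 / 16 : ℝ) • (b' + m')) * d)
      ((b + (1 / 16 : ℝ) • (a + m)) * e' + (b' + (1 / 16 : ℝ) • (a' + m')) * e) := by
  apply ext_coords <;> simp only [dihedral, mk_fst, mk_snd, mul_fst, mul_snd, mul_c, mul_m, mul_n,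
    mulC, mulM, mulN, sym, Fin.sum_univ_three, gen, add_c, add_m, add_n, smul_c, smul_m, smul_n,
    Pi.add_apply, Pi.smul_apply, form, LinearMap.mk₂_apply, formFun, Fin.isValue, Fin.reduceAdd,
    Matrix.cons_val, Pi.zero_apply, Pi.single_apply, smul_eq_mul] <;> simp <;> algebra

theorem bilin_dihedral (a b m d e a' b' m' d' e' : ℝ[X]) :
    bilin ψ (dihedral ψ a b m d e) (dihedral ψ a' b' m' d' e') =
      (2 : ℝ) • (a * a' + b * b' + (17 / 512 : ℝ) • (m * m') + (1 / 16 : ℝ) •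
        (a * b' + b * a' + a * m' + m * a' + b * m' + m * b') + d * d' + e * e') := by
  simp only [bilin_apply, dihedral, mk_fst, mk_snd, sym, Fin.sum_univ_three, form,
    LinearMap.mk₂_apply, formFun, Fin.isValue, Fin.reduceAdd, Matrix.cons_val, Pi.zero_apply, mul_zero, zero_mul, add_zero, zero_add, smul_zero]
  algebra

theorem axis_zero_eq (e : ℝ[X]) : axis ψ 0 e =
    dihedral ψ ((1 / 2 : ℝ) • 1) 0 0 ((1 / 2 : ℝ) • e) 0 := by
  apply ext_coords <;> simp [dihedral, gen, axis_snd_of_ne]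

theorem axis_one_eq (e : ℝ[X]) : axis ψ 1 e =
    dihedral ψ 0 ((1 / 2 : ℝ) • 1) 0 0 ((1 / 2 : ℝ) • e) := by
  apply ext_coords <;> simp [dihedral, gen, axis_snd_of_ne]

/-- The axis of type `4A` in the subalgebra generated by the first two pairs of axes. -/
noncomputable def dihedralAxis (ψ : ℝ[X]) : MonsterModel ψ :=
  dihedral ψ ((2 / 3 : ℝ) • 1) ((2 / 3 : ℝ) • 1) (-(16 / 3 : ℝ) • 1) 0 0

/-- The subalgebra of the vectors `dihedral ψ a b m d e`. -/
noncomputable def dihedralSubalgebra (ψ : ℝ[X]) : NonUnitalSubalgebra ℝ[X] (MonsterModel ψ) where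
  carrier := {x | ∃ a b m d e, x = dihedral ψ a b m d e}
  zero_mem' := ⟨0, 0, 0, 0, 0, by apply ext_coords <;> simp [dihedral]⟩
  add_mem' := by
    rintro _ _ ⟨a, b, m, d, e, rfl⟩ ⟨a', b', m', d', e', rfl⟩
    exact ⟨_, _, _, _, _, dihedral_add ..⟩
  mul_mem' := by
    rintro _ _ ⟨a, b, m, d, e, rfl⟩ ⟨a', b', m', d', e', rfl⟩
    exact ⟨_, _, _, _, _, dihedral_mul ..⟩
  smul_mem' := by
    rintro r _ ⟨a, b, m, d, e, rfl⟩
    exact ⟨_, _, _, _, _, dihedral_smul ..⟩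

theorem dihedral_inj {a b m d e a' b' m' d' e' : ℝ[X]}
    (h : dihedral ψ a b m d e = dihedral ψ a' b' m' d' e') :
    a = a' ∧ b = b' ∧ m = m' ∧ d = d' ∧ e = e' :=
  ⟨congrArg (fun x : MonsterModel ψ => x.1.c 0) h, congrArg (fun x : MonsterModel ψ => x.1.c 1) h,
    congrArg (fun x : MonsterModel ψ => x.1.m 2) h, congrArg (fun x : MonsterModel ψ => x.2 0) h,
    congrArg (fun x : MonsterModel ψ => x.2 1) h⟩

theorem dihedral_zero : dihedral ψ 0 0 0 0 0 = 0 := by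
  apply ext_coords <;> simp [dihedral]

/-- The 4A-axis v is (2/3)(c_0 + c_1) - (16/3) c_0 c_1, so c_0 c_1 = (1/8)(c_0 + c_1) - (3/16) v. -/
theorem dihedral_eq_combination (a b m d e : ℝ[X]) : dihedral ψ a b m d e =
    (a + d + (1 / 8 : ℝ) • m) • axis ψ 0 1 + (b + e + (1 / 8 : ℝ) • m) • axis ψ 1 1
    + (a - d + (1 / 8 : ℝ) • m) • axis ψ 0 (-1) + (b - e + (1 / 8 : ℝ) • m) • axis ψ 1 (-1)
    + (-(3 / 16 : ℝ) • m) • dihedralAxis ψ := by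
  simp only [axis_zero_eq, axis_one_eq, dihedralAxis, dihedral_smul, dihedral_add]
  congr 1 <;> algebra

/-- The subalgebra of two axes contains the opposite ones. Apply y ↦ x (x y) - (1/4) x y - (3/128)
x, where x, y are the two axes. The even part of y is annihilated by the quadratic equation, where
3/128 = (3/4)(1/32). Its odd part, half a difference of axes, is multiplied by 1/1024 - 1/128, which
leaves -7/2048 times that difference. -/
theorem odd_mem_of_axis_mem (S : NonUnitalSubalgebra ℝ[X] (MonsterModel ψ))
    (h0 : axis ψ 0 1 ∈ S) (h1 : axis ψ 1 1 ∈ S) :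
    dihedral ψ 0 0 0 1 0 ∈ S ∧ dihedral ψ 0 0 0 0 1 ∈ S := by
  have hs (r : ℝ) {x : MonsterModel ψ} (hx : x ∈ S) : r • x ∈ S := by
    rw [← algebraMap_smul ℝ[X] r x]
    exact S.smul_mem' _ hx
  have h2 := mul_mem h0 h1
  have key : ∀ x ∈ S, x * (axis ψ 0 1 * axis ψ 1 1) - (1 / 4 : ℝ) • (axis ψ 0 1 * axis ψ 1 1)
      - (3 / 128 : ℝ) • x ∈ S := fun x hx =>
    sub_mem (sub_mem (mul_mem hx h2) (hs _ h2)) (hs _ hx)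
  have k0 := hs (-(2048 / 7)) (key _ h0)
  have k1 := hs (-(2048 / 7)) (key _ h1)
  refine ⟨?_, ?_⟩
  · convert k1 using 1
    simp only [axis_zero_eq, axis_one_eq, dihedral_real_smul, dihedral_mul, dihedral_sub]
    congr 1 <;> algebra
  · convert k0 using 1
    simp only [axis_zero_eq, axis_one_eq, dihedral_real_smul, dihedral_mul, dihedral_sub]
    congr 1 <;> algebra

theorem adjoin_axis : (NonUnitalAlgebra.adjoin ℝ[X] {axis ψ 0 1, axis ψ 1 1}) =
    dihedralSubalgebra ψ := by
  refine le_antisymm (NonUnitalAlgebra.adjoin_le ?_) ?_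
  · rintro x (rfl | rfl)
    · exact ⟨_, _, _, _, _, axis_zero_eq 1⟩
    · exact ⟨_, _, _, _, _, axis_one_eq 1⟩
  · rintro _ ⟨a, b, m, d, e, rfl⟩
    set S := NonUnitalAlgebra.adjoin ℝ[X] {axis ψ 0 1, axis ψ 1 1}
    have h0 : axis ψ 0 1 ∈ S := NonUnitalAlgebra.subset_adjoin _ (Or.inl rfl)
    have h1 : axis ψ 1 1 ∈ S := NonUnitalAlgebra.subset_adjoin _ (Or.inr rfl)
    obtain ⟨k0, k1⟩ := odd_mem_of_axis_mem S h0 h1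
    have hs (r : ℝ[X]) {x : MonsterModel ψ} (hx : x ∈ S) : r • x ∈ S := S.smul_mem' r hx
    have h : dihedral ψ a b m d e = (4 * m) • (axis ψ 0 1 * axis ψ 1 1)
        + (2 * a) • axis ψ 0 1 + (2 * b) • axis ψ 1 1
        + (d - a - (1 / 16 : ℝ) • m) • dihedral ψ 0 0 0 1 0
        + (e - b - (1 / 16 : ℝ) • m) • dihedral ψ 0 0 0 0 1 := by
      simp only [axis_zero_eq, axis_one_eq, dihedral_smul, dihedral_mul, dihedral_add]
      congr 1 <;> algebra
    rw [h]
    exact add_mem (add_mem (add_mem (add_mem (hs _ (mul_mem h0 h1)) (hs _ h0)) (hs _ h1))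
      (hs _ k0)) (hs _ k1)

theorem span_dihedral : Submodule.span ℝ[X] {axis ψ 0 1, axis ψ 1 1, axis ψ 0 (-1), axis ψ 1 (-1),
    dihedralAxis ψ} = (dihedralSubalgebra ψ).toSubmodule := by
  refine le_antisymm (Submodule.span_le.mpr ?_) ?_
  · rintro x (rfl | rfl | rfl | rfl | rfl)
    · exact ⟨_, _, _, _, _, axis_zero_eq 1⟩
    · exact ⟨_, _, _, _, _, axis_one_eq 1⟩
    · exact ⟨_, _, _, _, _, axis_zero_eq (-1)⟩
    · exact ⟨_, _, _, _, _, axis_one_eq (-1)⟩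
    · exact ⟨_, _, _, _, _, rfl⟩
  · rintro _ ⟨a, b, m, d, e, rfl⟩
    rw [dihedral_eq_combination]
    have hs (r : ℝ[X]) {x : MonsterModel ψ} (hx : x ∈ ({axis ψ 0 1, axis ψ 1 1, axis ψ 0 (-1),
        axis ψ 1 (-1), dihedralAxis ψ} : Set (MonsterModel ψ))) :
        r • x ∈ Submodule.span ℝ[X] {axis ψ 0 1, axis ψ 1 1, axis ψ 0 (-1), axis ψ 1 (-1),
          dihedralAxis ψ} := Submodule.smul_mem _ r (Submodule.subset_span hx)
    exact add_mem (add_mem (add_mem (add_mem (hs _ (Or.inl rfl)) (hs _ (Or.inr (Or.inl rfl))))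
      (hs _ (Or.inr (Or.inr (Or.inl rfl))))) (hs _ (Or.inr (Or.inr (Or.inr (Or.inl rfl))))))
      (hs _ (Or.inr (Or.inr (Or.inr (Or.inr rfl)))))

theorem linearIndependent_dihedral : LinearIndependent ℝ[X]
    ![axis ψ 0 1, axis ψ 1 1, axis ψ 0 (-1), axis ψ 1 (-1), dihedralAxis ψ] := by
  rw [Fintype.linearIndependent_iff]
  intro g hg
  simp only [Fin.sum_univ_five, Matrix.cons_val, axis_zero_eq, axis_one_eq, dihedralAxis,
    dihedral_smul, dihedral_add] at hg
  obtain ⟨h0, h1, h2, h3, h4⟩ := dihedral_inj (hg.trans dihedral_zero.symm)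
  simp only [smul_neg] at h0 h1 h2 h3 h4
  have g4 : g 4 = 0 := by linear_combination (norm := algebra) -(3 / 16 : ℝ) • h2
  rw [g4] at h0 h1
  intro i
  fin_cases i
  · change g 0 = 0
    linear_combination (norm := algebra) h0 + h3
  · change g 1 = 0
    linear_combination (norm := algebra) h1 + h4
  · change g 2 = 0
    linear_combination (norm := algebra) h0 - h3
  · change g 3 = 0
    linear_combination (norm := algebra) h1 - h4
  · exact g4

end MonsterModel

namespace MonsterModel

open Polynomial JordanModel

theorem isType4A_univ : univ.IsType4A ![univ.ax 0 1, univ.ax 1 1, univ.ax 0 (-1), univ.ax 1 (-1)] := by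
  have e0 (ε) : univ.ax 0 ε = axis param 0 (sgn ε) := rfl
  have e1 (ε) : univ.ax 1 ε = axis param 1 (sgn ε) := rfl
  rw [e0, e0, e1, e1, sgn_neg, sgn_one]
  have main : ∀ b : Fin 4 → MonsterModel param,
      b = ![axis param 0 1, axis param 1 1, axis param 0 (-1), axis param 1 (-1)] → ∀ v, v = dihedralAxis param →
    (∀ i, b i * b i = b i) ∧
    (∀ i, b i * b (i + 1) =
      (1 / 64 : ℝ) • ((3 : ℝ) • b i + (3 : ℝ) • b (i + 1) + b (i + 2) + b (i + 3) - (3 : ℝ) • v)) ∧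
    (∀ i, b i * b (i + 2) = 0) ∧
    (∀ i, b i * v =
      (1 / 16 : ℝ) • ((5 : ℝ) • b i - (2 : ℝ) • b (i + 1) - b (i + 2) - (2 : ℝ) • b (i + 3)
        + (3 : ℝ) • v)) ∧
    v * v = v ∧
    (∀ i, bilin param (b i) (b i) = 1) ∧
    (∀ i, bilin param (b i) (b (i + 1)) = algebraMap ℝ ℝ[X] (1 / 32)) ∧
    (∀ i, bilin param (b i) (b (i + 2)) = 0) ∧
    (∀ i, bilin param (b i) v = algebraMap ℝ ℝ[X] (3 / 8)) ∧
    bilin param v v = 2 := by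
    rintro b rfl v rfl
    refine ⟨?_, ?_, ?_, ?_, ?_, ?_, ?_, ?_, ?_, ?_⟩
    all_goals simp only [Fin.forall_fin_succ, Fin.succ_zero_eq_one, Fin.succ_one_eq_two,
      IsEmpty.forall_iff, and_true, Fin.isValue, Fin.reduceAdd, Fin.reduceSucc,
      Matrix.cons_val, axis_zero_eq, axis_one_eq, dihedralAxis, bilin_dihedral,
      dihedral_mul, dihedral_add, dihedral_sub, dihedral_real_smul, ← dihedral_zero]
    · refine ⟨?_, ?_, ?_, ?_⟩ <;> congr 1 <;> algebra
    · refine ⟨?_, ?_, ?_, ?_⟩ <;> congr 1 <;> algebra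
    · refine ⟨?_, ?_, ?_, ?_⟩ <;> congr 1 <;> algebra
    · refine ⟨?_, ?_, ?_, ?_⟩ <;> congr 1 <;> algebra
    · congr 1 <;> algebra
    · refine ⟨?_, ?_, ?_, ?_⟩ <;> algebra
    · refine ⟨?_, ?_, ?_, ?_⟩ <;> algebra
    · refine ⟨?_, ?_, ?_, ?_⟩ <;> algebra
    · refine ⟨?_, ?_, ?_, ?_⟩ <;> algebra
    · algebra
  refine ⟨dihedralAxis param, linearIndependent_dihedral, ?_, main _ rfl _ rfl⟩
  exact span_dihedral.trans (congrArg _ adjoin_axis.symm)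

theorem inC4A_univ : univ.InC4A := ⟨isPrimitiveMonster_univ, propertyP_univ, isType4A_univ⟩

end MonsterModel

/-! ### Realization of the Jordan model in an arbitrary algebra. -/

namespace JordanTriple

open JordanModel

set_option linter.unusedSectionVars false

variable {R : Type} {V : Type*} [CommRing R] [Algebra ℝ R] [NonUnitalNonAssocCommRing V]
  [Module R V] [Module ℝ V] [IsScalarTower ℝ R V] [IsScalarTower ℝ V V] [SMulCommClass ℝ V V]
  [IsScalarTower R V V] [SMulCommClass R V V]

/-- The vector with given coordinates with respect to three idempotents and their products. -/
def realize (a b c : V) {ψ : R} (x : JordanModel R ψ) : V :=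
  x.c 0 • a + x.c 1 • b + x.c 2 • c + x.m 0 • (b * c) + x.m 1 • (a * c) + x.m 2 • (a * b)
    + x.n 0 • (a * (b * c)) + x.n 1 • (b * (a * c)) + x.n 2 • (c * (a * b))

theorem realize_add (a b c : V) {ψ : R} (x y : JordanModel R ψ) :
    realize a b c (x + y) = realize a b c x + realize a b c y := by
  simp only [realize, add_c, add_m, add_n, Pi.add_apply]
  match_scalars <;> algebra

theorem realize_smul (a b c : V) {ψ : R} (r : R) (x : JordanModel R ψ) :
    realize a b c (r • x) = r • realize a b c x := by
  simp only [realize, smul_c, smul_m, smul_n, Pi.smul_apply, smul_eq_mul]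
  match_scalars <;> algebra

variable {S : NonUnitalSubalgebra R V} {β : V →ₗ[R] V →ₗ[R] R} {a b c : V} {ψ : R}
  (h : JordanTriple S β a b c ψ)
include h

theorem realize_mem (x : JordanModel R ψ) : realize a b c x ∈ S := by
  have hs (r : R) {x : V} (hx : x ∈ S) : r • x ∈ S := S.smul_mem' r hx
  have hab := h.mem_ab
  have hbc := h.rotate.mem_ab
  have hac := h.swap.rotate.mem_ab
  exact add_mem (add_mem (add_mem (add_mem (add_mem (add_mem (add_mem (add_mem (hs _ h.mem_a)
    (hs _ h.mem_b)) (hs _ h.mem_c)) (hs _ hbc)) (hs _ hac)) (hs _ hab))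
    (hs _ (mul_mem h.mem_a hbc))) (hs _ (mul_mem h.mem_b hac))) (hs _ (mul_mem h.mem_c hab))

theorem form_realize (x : JordanModel R ψ) : β a (realize a b c x) = form ψ (gen ψ 0) x := by
  have h2 := h.rotate.swap.rotate.rotate.form_a_b_ac
  simp only [realize, _root_.map_add, _root_.map_smul, h.norm_a, h.form_ab, h.form_ac, h.form_abc, h.form_a_ab,
    h.form_a_ac, h.form_a_a_bc, h.form_a_b_ac, h2, form, LinearMap.mk₂_apply, formFun,
    Fin.sum_univ_three, gen, sym, Fin.isValue, Fin.reduceAdd, Pi.zero_apply, Pi.single_apply,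
    smul_eq_mul]
  simp
  algebra

omit h in
/-- A coordinate permutation that corresponds to exchanging idempotents. -/
theorem realize_rotate (x : JordanModel R ψ) : realize b c a (rot x) = realize a b c x := by
  simp only [realize, rot, Fin.isValue, Fin.reduceAdd, mul_comm c a, mul_comm b a]
  abel

set_option maxRecDepth 20000 in
set_option maxHeartbeats 4000000 in
-- By bilinearity this is the table of products of the nine spanning vectors, with permutations of
-- the idempotents covering the cases not stated separately.
theorem realize_mul (x y : JordanModel R ψ) :
    realize a b c (x * y) = realize a b c x * realize a b c y := by
  have ac := h.rotate.swap.rotate.rotate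
  have ba := h.swap
  have bc := h.rotate
  have ca := h.rotate.rotate
  have cb := h.rotate.swap
  have s1 := mul_comm b a
  have s2 := mul_comm c a
  have s3 := mul_comm c b
  have q11 := bc.mul_ab
  have q12 := bc.mul_b_ac
  have q13 := bc.mul_c_ab
  have q14 := ba.mul_ab
  have q15 := ca.mul_ab
  have q16 := cb.mul_ab
  have q17 := ca.mul_b_ac
  have q18 := ca.mul_c_ab
  have q19 := bc.mul_a_bc
  have q20 := ca.mul_a_bc
  have q21 := bc.mul_ab_ac
  have q22 := ca.mul_ab_ac
  have q23 := bc.mul_ab_ab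
  have q24 := ac.mul_ab_ab
  have q25 := ac.mul_ab_a_bc
  have q26 := ac.mul_ab_b_ac
  have q27 := ac.mul_ab_c_ab
  have q29 := ba.sq_a_bc
  have q30 := bc.mul_a_bc_c_ab
  have q31 := ca.mul_a_bc_c_ab
  simp only [s1, s2, s3] at q11 q12 q13 q14 q15 q16 q17 q18 q19 q20 q21 q22 q23 q24 q25 q26 q27 q29 q30 q31
  have r {u v w : V} (e : u * v = w) : v * u = w := (mul_comm v u).trans e
  have expand : realize a b c x * realize a b c y = realize a b c (x * y) := by
    simp only [realize, mul_add, add_mul, smul_mul_assoc, mul_smul_comm, smul_smul]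
    simp only [s1, s2, s3, mul_comm (b * c) a, mul_comm (a * c) b, mul_comm (a * b) c, h.idem_a, h.idem_b, h.idem_c,
      q11, q12, q13, q14, q15, q16, q17, q18, q19, q20, q21, q22, q23, q24, q25, q26, q27, q29, q30, q31, h.mul_ab, h.mul_ac, h.mul_a_bc, h.mul_b_ac, h.mul_c_ab, h.mul_ab_ac, h.mul_ab_a_bc, h.mul_ab_b_ac, h.mul_ab_c_ab, h.mul_ab_ab, h.sq_c_ab, h.sq_a_bc, h.mul_bc_b_ac, h.mul_bc_c_ab, h.mul_bc_a_bc, h.mul_a_bc_c_ab,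
      r q11, r q12, r q13, r q14, r q15, r q16, r q17, r q18, r q19, r q20, r q21, r q22, r q23, r q24, r q25, r q26, r q27, r q29, r q30, r q31, r h.mul_ab, r h.mul_ac, r h.mul_a_bc, r h.mul_b_ac, r h.mul_c_ab, r h.mul_ab_ac, r h.mul_ab_a_bc, r h.mul_ab_b_ac, r h.mul_ab_c_ab, r h.mul_ab_ab, r h.sq_c_ab, r h.sq_a_bc, r h.mul_bc_b_ac, r h.mul_bc_c_ab, r h.mul_bc_a_bc, r h.mul_a_bc_c_ab]
    simp only [mul_c, mul_m, mul_n, mulC, mulM, mulN, sym, Fin.isValue, Fin.reduceAdd]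
    generalize a * (b * c) = u
    generalize b * (a * c) = v
    generalize c * (a * b) = w
    generalize a * b = ab
    generalize a * c = ac
    generalize b * c = bc
    match_scalars <;> algebra
  exact expand.symm

end JordanTriple

namespace JordanTriple

open JordanModel

variable {R : Type} {V : Type*} [CommRing R] [Algebra ℝ R] [NonUnitalNonAssocCommRing V]
  [Module R V] [Module ℝ V] [IsScalarTower ℝ R V] [IsScalarTower ℝ V V] [SMulCommClass ℝ V V]
  [IsScalarTower R V V] [SMulCommClass R V V] {S : NonUnitalSubalgebra R V}
  {β : V →ₗ[R] V →ₗ[R] R}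

theorem form_rot {ψ : R} (i : Fin 3) (x : JordanModel R ψ) :
    form ψ (gen ψ i) (rot x) = form ψ (gen ψ (i + 1)) x := by
  rw [← rot_gen]
  exact rot_form _ _

/-- The inner products with the idempotents agree with those in the model. -/
theorem form_realize_all {c : Fin 3 → V} {ψ : R} (h : JordanTriple S β (c 0) (c 1) (c 2) ψ)
    (i : Fin 3) (x : JordanModel R ψ) :
    β (c i) (realize (c 0) (c 1) (c 2) x) = form ψ (gen ψ i) x := by
  have h0 := h.form_realize x
  have h1 := h.rotate.form_realize (rot x)
  have h2 := h.rotate.rotate.form_realize (rot (rot x))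
  rw [realize_rotate, form_rot] at h1
  rw [realize_rotate, realize_rotate, form_rot, form_rot] at h2
  fin_cases i
  · exact h0
  · exact h1
  · exact h2

theorem realize_gen (c : Fin 3 → V) {ψ : R} (i : Fin 3) :
    realize (c 0) (c 1) (c 2) (gen ψ i) = c i := by
  fin_cases i <;> simp [realize, gen]

end JordanTriple

/-! ### The even part of an arbitrary object of the category. -/

namespace MarkedFrobeniusAlgebra

variable {N : MarkedFrobeniusAlgebra}

/-- The sum of the two axes of a pair. -/
def c (N : MarkedFrobeniusAlgebra) (i : Fin 3) : N.V := N.ax i 1 + N.ax i (-1)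

/-- The difference of the two axes of a pair. -/
def d (N : MarkedFrobeniusAlgebra) (i : Fin 3) : N.V := N.ax i 1 - N.ax i (-1)

namespace InC4A

/-- The involutions in property P. -/
def IsInvolutions (τ : Fin 3 → N.V →ₗ[N.R] N.V) : Prop :=
  ∀ i ε, N.IsMiyamoto (N.ax i ε) (τ i) ∧
    ∀ δ, τ i (N.ax i δ) = N.ax i δ ∧ ∀ j, j ≠ i → τ i (N.ax j δ) = N.ax j (-δ)

variable (hN : N.InC4A) {τ : Fin 3 → N.V →ₗ[N.R] N.V} (hτ : IsInvolutions τ)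

include hN in
theorem symm (x y : N.V) : N.form x y = N.form y x :=
  form_comm (fun i ε => (hN.monster.axis i ε).idem) x y

include hN in
theorem idem (i : Fin 3) (ε : ℤˣ) : N.ax i ε * N.ax i ε = N.ax i ε := (hN.monster.axis i ε).idem

include hN hτ

theorem swappedPairs {i j : Fin 3} (h : i ≠ j) :
    SwappedPairs (N.ax i 1) (N.ax i (-1)) (N.ax j 1) (N.ax j (-1)) (τ i) (τ j) where
  symm := hN.symm
  axis_x := hN.monster.isUnitAxis i 1
  axis_x' := hN.monster.isUnitAxis i (-1)
  axis_y := hN.monster.isUnitAxis j 1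
  axis_y' := hN.monster.isUnitAxis j (-1)
  miyamoto_x := (hτ i 1).1
  miyamoto_x' := (hτ i (-1)).1
  miyamoto_y := (hτ j 1).1
  miyamoto_y' := (hτ j (-1)).1
  τx := ((hτ i 1).2 1).1
  τx' := ((hτ i 1).2 (-1)).1
  τy := ((hτ i 1).2 1).2 j h.symm
  τy' := by simpa using ((hτ i 1).2 (-1)).2 j h.symm
  σy := ((hτ j 1).2 1).1
  σy' := ((hτ j 1).2 (-1)).1
  σx := ((hτ j 1).2 1).2 i h
  σx' := by simpa using ((hτ j 1).2 (-1)).2 i h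

/-- The shape gives this for the first pair only; `pair_mul_eq_zero` carries it to the others. -/
theorem ax_mul_ax_neg (i : Fin 3) : N.ax i 1 * N.ax i (-1) = 0 := by
  obtain ⟨v, -, -, -, -, h, -⟩ := hN.shape
  have h0 : N.ax 0 1 * N.ax 0 (-1) = 0 := h 0
  by_cases hi : i = 0
  · rw [hi, h0]
  · exact (hN.swappedPairs hτ (Ne.symm hi)).pair_mul_eq_zero h0

theorem form_ax_ax_neg (i : Fin 3) : N.form (N.ax i 1) (N.ax i (-1)) = 0 := by
  rw [← hN.idem i (-1), N.form_assoc, hN.ax_mul_ax_neg hτ, map_zero, LinearMap.zero_apply]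

theorem form_ax_ax {i j : Fin 3} (h : i ≠ j) (ε δ : ℤˣ) :
    N.form (N.ax i ε) (N.ax j δ) = algebraMap ℝ N.R (1 / 32) := by
  have hs := hN.swappedPairs hτ h
  have h0 := hs.form_eq (hN.ax_mul_ax_neg hτ i)
  rcases Int.units_eq_one_or ε with rfl | rfl <;> rcases Int.units_eq_one_or δ with rfl | rfl
  · exact h0
  · rw [hs.form_xy', h0]
  · rw [hs.form_x'y, h0]
  · rw [hs.form_x'y', h0]

theorem cross_ax {i j : Fin 3} (h : i ≠ j) (ε δ : ℤˣ) :
    N.ax i ε * N.ax j δ = cross (N.ax i 1) (N.ax j 1) + (1 / 32 : ℝ) • (N.ax i ε + N.ax j δ) := by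
  have hs := hN.swappedPairs hτ h
  suffices hc : cross (N.ax i ε) (N.ax j δ) = cross (N.ax i 1) (N.ax j 1) by
    rw [← hc, cross, sub_add_cancel]
  rcases Int.units_eq_one_or ε with rfl | rfl <;> rcases Int.units_eq_one_or δ with rfl | rfl
  · rfl
  · exact hs.cross_neg_right
  · exact hs.cross_neg_left
  · exact hs.cross_neg_neg

theorem c_mul_c_self (i : Fin 3) : N.c i * N.c i = N.c i := by
  have h := hN.ax_mul_ax_neg hτ i
  have h' := mul_comm (N.ax i (-1)) (N.ax i 1)
  rw [h] at h'
  rw [c, mul_add, add_mul, add_mul, hN.idem, hN.idem, h, h', add_zero, zero_add]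

theorem d_mul_d_self (i : Fin 3) : N.d i * N.d i = N.c i := by
  have h := hN.ax_mul_ax_neg hτ i
  have h' := mul_comm (N.ax i (-1)) (N.ax i 1)
  rw [h] at h'
  rw [c, d, mul_sub, sub_mul, sub_mul, hN.idem, hN.idem, h, h']
  abel

/-- All four products of axes involve the same cross vector, which cancels along with the axes. -/
theorem d_mul_d {i j : Fin 3} (hij : i ≠ j) : N.d i * N.d j = 0 := by
  rw [d, d, mul_sub, sub_mul, sub_mul]
  simp only [hN.cross_ax hτ hij]
  match_scalars <;> algebra

/-- The common fixed vectors of the involutions on which the axes of each pair act alike. -/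
def evenPart : NonUnitalSubalgebra N.R N.V where
  carrier := {x | (∀ i, τ i x = x) ∧ ∀ i, N.ax i 1 * x - N.form (N.ax i 1) x • N.ax i 1 =
    N.ax i (-1) * x - N.form (N.ax i (-1)) x • N.ax i (-1)}
  zero_mem' := ⟨by simp, by simp⟩
  add_mem' := by
    rintro x y ⟨hx, hx'⟩ ⟨hy, hy'⟩
    refine ⟨fun i => by rw [map_add, hx, hy], fun i => ?_⟩
    simp only [mul_add, map_add, add_smul]
    rw [add_sub_add_comm, hx', hy', ← add_sub_add_comm]
  smul_mem' := by
    rintro r x ⟨hx, hx'⟩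
    refine ⟨fun i => by rw [map_smul, hx], fun i => ?_⟩
    simp only [mul_smul_comm, map_smul, smul_assoc, ← smul_sub, hx']
  mul_mem' := by
    rintro x y ⟨hx, hx'⟩ ⟨hy, hy'⟩
    have ha (i ε) := hN.monster.isUnitAxis i ε
    refine ⟨fun i => by rw [(ha i 1).miyamoto_mul (hτ i 1).1, hx, hy], fun i => ?_⟩
    -- The flips of the two axes of a pair are multiplicative on fixed vectors and agree on `x` and
    -- `y`, so they agree on the product.
    have h1 := (ha i 1).flip_mul (hτ i 1).1 (hx i) (hy i)
    have h2 := (ha i (-1)).flip_mul (hτ i (-1)).1 (hx i) (hy i)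
    have key (z : N.V) (ε) : z - (8 : ℝ) • (N.ax i ε * z) + (8 : ℝ) • (N.form (N.ax i ε) z • N.ax i ε)
        = z - (8 : ℝ) • (N.ax i ε * z - N.form (N.ax i ε) z • N.ax i ε) := by
      rw [smul_sub, sub_sub_eq_add_sub, add_sub_right_comm]
    rw [key, key, key] at h1 h2
    rw [hx', hy', ← h2] at h1
    exact smul_right_injective _ (by norm_num : (8 : ℝ) ≠ 0) (sub_right_injective h1)

theorem c_mem (j : Fin 3) : N.c j ∈ evenPart hN hτ := by
  refine ⟨fun i => ?_, fun i => ?_⟩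
  · by_cases hij : j = i
    · rw [hij, c, map_add, ((hτ i 1).2 1).1, ((hτ i 1).2 (-1)).1]
    · rw [c, map_add, ((hτ i 1).2 1).2 j hij, ((hτ i 1).2 (-1)).2 j hij, neg_neg, add_comm]
  · by_cases hij : i = j
    · subst hij
      rw [c, mul_add, mul_add, map_add, map_add, hN.idem, hN.idem, mul_comm (N.ax i (-1)),
        hN.ax_mul_ax_neg hτ, hN.symm (N.ax i (-1)) (N.ax i 1), hN.form_ax_ax_neg hτ,
        hN.monster.norm, hN.monster.norm]
      simp
    · simp only [c, mul_add, map_add, hN.form_ax_ax hτ hij, hN.cross_ax hτ hij]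
      match_scalars <;> algebra

section Even

variable {x : N.V} (hx : x ∈ evenPart hN hτ)
include hx

/-- The involution of another pair swaps these two axes, fixes `x` and preserves the form. -/
theorem form_ax_neg_even (i : Fin 3) : N.form (N.ax i (-1)) x = N.form (N.ax i 1) x := by
  obtain ⟨j, hj⟩ := exists_ne i
  have h := (hN.monster.isUnitAxis j 1).form_miyamoto (hτ j 1).1 (N.ax i 1) x
  rwa [((hτ j 1).2 1).2 i hj.symm, hx.1 j] at h

theorem form_c_even (i : Fin 3) : N.form (N.c i) x = (2 : ℝ) • N.form (N.ax i 1) x := by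
  rw [c, map_add, LinearMap.add_apply, hN.form_ax_neg_even hτ hx, two_smul]

theorem d_mul_even (i : Fin 3) : N.d i * x = N.form (N.ax i 1) x • N.d i := by
  have h := hx.2 i
  rw [hN.form_ax_neg_even hτ hx] at h
  rw [d, sub_mul, smul_sub]
  linear_combination (norm := abel) h

theorem ax_mul_even (i : Fin 3) (ε : ℤˣ) : N.ax i ε * x = N.form (N.ax i 1) x • N.ax i ε +
    (1 / 2 : ℝ) • (N.c i * x - N.form (N.ax i 1) x • N.c i) := by
  have h := hx.2 i
  rw [hN.form_ax_neg_even hτ hx] at h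
  rcases Int.units_eq_one_or ε with rfl | rfl
  · rw [c, add_mul]
    linear_combination (norm := skip) (1 / 2 : ℝ) • h
    match_scalars <;> algebra
  · rw [c, add_mul]
    linear_combination (norm := skip) -(1 / 2 : ℝ) • h
    match_scalars <;> algebra

theorem c_mul_c_mul_even (i : Fin 3) : N.c i * (N.c i * x) =
    (1 / 2 : ℝ) • (N.c i * x) + (1 / 2 : ℝ) • (N.form (N.ax i 1) x • N.c i) := by
  -- By `ax_mul_even`, both axes act on `x` with this same remainder. It is a 1/4-eigenvector of
  -- each, hence a 1/2-eigenvector of their sum.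
  set w := (1 / 2 : ℝ) • (N.c i * x - N.form (N.ax i 1) x • N.c i) with hw
  have h1 (ε) : N.ax i ε * w = (1 / 4 : ℝ) • w := by
    have h := (hN.monster.isUnitAxis i ε).mul_mul_of_fixed (hτ i ε).1 (hx.1 i)
    have hf : N.form (N.ax i ε) x = N.form (N.ax i 1) x := by
      rcases Int.units_eq_one_or ε with rfl | rfl
      · rfl
      · exact hN.form_ax_neg_even hτ hx i
    rw [hN.ax_mul_even hτ hx i ε, ← hw, mul_add, mul_smul_comm, hN.idem, hf] at h
    linear_combination (norm := skip) h
    match_scalars <;> algebra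
  have h2 : N.c i * w = (1 / 2 : ℝ) • w := by
    rw [c, add_mul, h1, h1]
    match_scalars <;> algebra
  have h3 : N.c i * x = (2 : ℝ) • w + N.form (N.ax i 1) x • N.c i := by
    rw [hw]
    match_scalars <;> algebra
  clear_value w
  rw [h3, mul_add, mul_smul_comm, mul_smul_comm, h2, hN.c_mul_c_self hτ]
  match_scalars <;> algebra

theorem flip_even {y : N.V} (hy : y ∈ evenPart hN hτ) (i : Fin 3) :
    (4 : ℝ) • ((N.c i * x) * (N.c i * y)) = x * (N.c i * y) + y * (N.c i * x) - N.c i * (x * y)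
      + N.form (N.ax i 1) y • (N.c i * x) + N.form (N.ax i 1) x • (N.c i * y)
      + N.form (N.ax i 1) (x * y) • N.c i := by
  -- On the even part the flip of a_i is x - 4 c_i x + 4 ⟨a_i, x⟩ c_i, so its multiplicativity
  -- becomes an identity in c_i alone.
  have h := (hN.monster.isUnitAxis i 1).flip_mul (hτ i 1).1 (hx.1 i) (hy.1 i)
  rw [hN.ax_mul_even hτ hx, hN.ax_mul_even hτ hy, hN.ax_mul_even hτ (mul_mem hx hy)] at h
  have key (z w : N.V) (r : N.R) : z - (8 : ℝ) • (r • N.ax i 1 + (1 / 2 : ℝ) • (w - r • N.c i))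
      + (8 : ℝ) • (r • N.ax i 1) = z - (4 : ℝ) • w + ((4 : ℝ) • r) • N.c i := by
    match_scalars <;> algebra
  rw [key, key, key] at h
  have e1 : N.c i * x * N.c i = N.c i * (N.c i * x) := mul_comm _ _
  simp only [mul_add, add_mul, mul_sub, sub_mul, smul_mul_assoc, mul_smul_comm, e1,
    hN.c_mul_c_mul_even hτ hx, hN.c_mul_c_mul_even hτ hy, hN.c_mul_c_self hτ,
    mul_comm x (N.c i), mul_comm (N.c i * x) y] at h
  generalize N.c i * (x * y) = z1 at h ⊢
  linear_combination (norm := skip) (-1 / 4 : ℝ) • h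
  match_scalars <;> algebra

end Even

end InC4A

end MarkedFrobeniusAlgebra

/-! ### The morphism from the universal algebra. -/

namespace MarkedFrobeniusAlgebra

variable {N : MarkedFrobeniusAlgebra}

namespace InC4A

open Polynomial MonsterModel
open JordanModel hiding map map_add map_sub map_smul map_mul map_form form form_symm form_assoc

variable (hN : N.InC4A) {τ : Fin 3 → N.V →ₗ[N.R] N.V} (hτ : IsInvolutions τ)

/-- The homomorphism from the polynomial ring that sends the variable to `t`. -/
noncomputable def ringHom (N : MarkedFrobeniusAlgebra) : ℝ[X] →ₐ[ℝ] N.R := aeval N.t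

include hN hτ

theorem c_mul_c {i j : Fin 3} (h : i ≠ j) : N.c i * N.c j =
    (4 : ℝ) • cross (N.ax i 1) (N.ax j 1) + (1 / 16 : ℝ) • (N.c i + N.c j) := by
  simp only [c, mul_add, add_mul, hN.cross_ax hτ h]
  match_scalars <;> algebra

theorem v_eq {i j : Fin 3} (h : i ≠ j) :
    N.v i j = (2 / 3 : ℝ) • (N.c i + N.c j) - (16 / 3 : ℝ) • (N.c i * N.c j) := by
  rw [hN.c_mul_c hτ h, v, hN.cross_ax hτ h, c, c]
  match_scalars <;> algebra

theorem form_ax_c {i j : Fin 3} (h : i ≠ j) (ε : ℤˣ) :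
    N.form (N.ax i ε) (N.c j) = algebraMap ℝ N.R (1 / 16) := by
  rw [c, map_add, hN.form_ax_ax hτ h, hN.form_ax_ax hτ h]
  algebra

theorem form_ax_d {i j : Fin 3} (h : i ≠ j) (ε : ℤˣ) : N.form (N.ax i ε) (N.d j) = 0 := by
  rw [d, map_sub, hN.form_ax_ax hτ h, hN.form_ax_ax hτ h, sub_self]

theorem form_ax_d_self (i : Fin 3) (ε : ℤˣ) :
    N.form (N.ax i ε) (N.d i) = ringHom N (sgn ε) := by
  rcases Int.units_eq_one_or ε with rfl | rfl
  · rw [d, map_sub, hN.monster.norm, hN.form_ax_ax_neg hτ]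
    simp
  · rw [d, map_sub, hN.monster.norm, hN.symm, hN.form_ax_ax_neg hτ]
    simp

/-- Expanding v_{(2,3)} in the c_i gives t = 1/12 - (16/3) ⟨a_1, c_2 c_3⟩, which `param` inverts. -/
theorem form_ax_c_mul_c :
    N.form (N.ax 0 1) (N.c 1 * N.c 2) = ringHom N param := by
  have h : N.t = (1 / 12 : ℝ) • 1 - (16 / 3 : ℝ) • N.form (N.ax 0 1) (N.c 1 * N.c 2) := by
    rw [t, hN.v_eq hτ (by decide), map_sub, form_real_smul_right, form_real_smul_right, map_add,
      hN.form_ax_c hτ (by decide), hN.form_ax_c hτ (by decide)]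
    algebra
  simp only [ringHom, param, map_sub, map_smul, aeval_X, AlgHom.commutes, h]
  algebra

/-- Half the form. -/
noncomputable def halfForm (N : MarkedFrobeniusAlgebra) : N.V →ₗ[N.R] N.V →ₗ[N.R] N.R :=
  algebraMap ℝ N.R (1 / 2) • N.form

omit hN hτ in
theorem halfForm_apply (x y : N.V) : halfForm N x y = (1 / 2 : ℝ) • N.form x y := by
  rw [halfForm, LinearMap.smul_apply, LinearMap.smul_apply, smul_eq_mul, Algebra.smul_def]

/-- The two axes of a pair have equal inner products with an even vector; halving the form
compensates for the two summands of c_i. -/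
theorem halfForm_c_even {x : N.V} (hx : x ∈ evenPart hN hτ) (i : Fin 3) :
    halfForm N (N.c i) x = N.form (N.ax i 1) x := by
  rw [halfForm_apply, hN.form_c_even hτ hx, smul_smul]
  norm_num

theorem form_ax_c_self (i : Fin 3) : N.form (N.ax i 1) (N.c i) = 1 := by
  rw [c, map_add, hN.monster.norm, hN.form_ax_ax_neg hτ, add_zero]

theorem jordanTriple :
    JordanTriple (evenPart hN hτ) (halfForm N) (N.c 0) (N.c 1) (N.c 2) (ringHom N param) where
  symm x y := by rw [halfForm_apply, halfForm_apply, hN.symm]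
  assoc x y z := by rw [halfForm_apply, halfForm_apply, N.form_assoc]
  mem_a := hN.c_mem hτ 0
  mem_b := hN.c_mem hτ 1
  mem_c := hN.c_mem hτ 2
  norm_a := by rw [hN.halfForm_c_even hτ (hN.c_mem hτ 0), hN.form_ax_c_self hτ]
  norm_b := by rw [hN.halfForm_c_even hτ (hN.c_mem hτ 1), hN.form_ax_c_self hτ]
  norm_c := by rw [hN.halfForm_c_even hτ (hN.c_mem hτ 2), hN.form_ax_c_self hτ]
  form_ab := by rw [hN.halfForm_c_even hτ (hN.c_mem hτ 1), hN.form_ax_c hτ (by decide)]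
  form_ac := by rw [hN.halfForm_c_even hτ (hN.c_mem hτ 2), hN.form_ax_c hτ (by decide)]
  form_bc := by rw [hN.halfForm_c_even hτ (hN.c_mem hτ 2), hN.form_ax_c hτ (by decide)]
  form_abc := by
    rw [hN.halfForm_c_even hτ (mul_mem (hN.c_mem hτ 1) (hN.c_mem hτ 2)), hN.form_ax_c_mul_c hτ]
  idem_a := hN.c_mul_c_self hτ 0
  idem_b := hN.c_mul_c_self hτ 1
  idem_c := hN.c_mul_c_self hτ 2
  quad := by
    rintro u hu x hx
    obtain ⟨i, rfl⟩ : ∃ i, u = N.c i := by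
      rcases hu with rfl | rfl | rfl <;> exact ⟨_, rfl⟩
    rw [hN.halfForm_c_even hτ hx, hN.c_mul_c_mul_even hτ hx]
  flip := by
    rintro u hu x hx y hy
    obtain ⟨i, rfl⟩ : ∃ i, u = N.c i := by
      rcases hu with rfl | rfl | rfl <;> exact ⟨_, rfl⟩
    rw [hN.halfForm_c_even hτ hx, hN.halfForm_c_even hτ hy,
      hN.halfForm_c_even hτ (mul_mem hx hy), hN.flip_even hτ hx hy]

omit hN hτ

/-- The image in `N` of a vector without coordinates on the differences of axes. -/
noncomputable def evenHom (N : MarkedFrobeniusAlgebra) (p : JordanModel ℝ[X] param) : N.V :=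
  JordanTriple.realize (N.c 0) (N.c 1) (N.c 2) (JordanModel.map (ringHom N) p)

/-- The homomorphism of algebras from the universal algebra. -/
noncomputable def algHom (N : MarkedFrobeniusAlgebra) (x : MonsterModel param) : N.V :=
  evenHom N x.1 + ∑ i, ringHom N (x.2 i) • N.d i

theorem algHom_add (x y : MonsterModel param) : algHom N (x + y) = algHom N x + algHom N y := by
  simp only [algHom, evenHom, add_fst, add_snd, JordanModel.map_add, JordanTriple.realize_add,
    _root_.map_add, add_smul, Finset.sum_add_distrib]
  abel

theorem algHom_smul (r : ℝ[X]) (x : MonsterModel param) :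
    algHom N (r • x) = ringHom N r • algHom N x := by
  simp only [algHom, evenHom, smul_fst, smul_snd, JordanModel.map_smul, JordanTriple.realize_smul,
    _root_.map_mul, mul_smul, smul_add, Finset.smul_sum]

theorem evenHom_gen (i : Fin 3) : evenHom N (gen param i) = N.c i := by
  rw [evenHom, map_gen, JordanTriple.realize_gen N.c]

theorem evenHom_smul (r : ℝ[X]) (p : JordanModel ℝ[X] param) :
    evenHom N (r • p) = ringHom N r • evenHom N p := by
  rw [evenHom, JordanModel.map_smul, JordanTriple.realize_smul, evenHom]

theorem evenHom_add (p q : JordanModel ℝ[X] param) :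
    evenHom N (p + q) = evenHom N p + evenHom N q := by
  rw [evenHom, JordanModel.map_add, JordanTriple.realize_add, evenHom, evenHom]

include hN hτ

theorem evenHom_mem (p : JordanModel ℝ[X] param) : evenHom N p ∈ evenPart hN hτ :=
  (hN.jordanTriple hτ).realize_mem _

theorem evenHom_mul (p q : JordanModel ℝ[X] param) :
    evenHom N (p * q) = evenHom N p * evenHom N q := by
  rw [evenHom, JordanModel.map_mul, (hN.jordanTriple hτ).realize_mul, evenHom, evenHom]

theorem form_ax_evenHom (i : Fin 3) (ε : ℤˣ) (p : JordanModel ℝ[X] param) :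
    N.form (N.ax i ε) (evenHom N p) = ringHom N (JordanModel.form param (gen param i) p) := by
  have h1 : N.form (N.ax i ε) (evenHom N p) = N.form (N.ax i 1) (evenHom N p) := by
    rcases Int.units_eq_one_or ε with rfl | rfl
    · rfl
    · exact hN.form_ax_neg_even hτ (hN.evenHom_mem hτ p) i
  rw [h1, ← hN.halfForm_c_even hτ (hN.evenHom_mem hτ p), evenHom,
    (hN.jordanTriple hτ).form_realize_all, ← map_gen]
  exact JordanModel.map_form _ _ _

theorem d_mul_evenHom (i : Fin 3) (p : JordanModel ℝ[X] param) :
    N.d i * evenHom N p = ringHom N (JordanModel.form param (gen param i) p) • N.d i := by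
  rw [hN.d_mul_even hτ (hN.evenHom_mem hτ p), hN.form_ax_evenHom hτ]

/-- The product of the model copies the relations among the d_i and the even vectors, and on even
vectors this is `realize_mul`. -/
theorem algHom_mul (x y : MonsterModel param) :
    algHom N (x * y) = algHom N x * algHom N y := by
  have h00 := hN.d_mul_d_self hτ 0
  have h11 := hN.d_mul_d_self hτ 1
  have h22 := hN.d_mul_d_self hτ 2
  have h01 := hN.d_mul_d hτ (by decide : (0 : Fin 3) ≠ 1)
  have h02 := hN.d_mul_d hτ (by decide : (0 : Fin 3) ≠ 2)
  have h12 := hN.d_mul_d hτ (by decide : (1 : Fin 3) ≠ 2)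
  have h10 := hN.d_mul_d hτ (by decide : (1 : Fin 3) ≠ 0)
  have h20 := hN.d_mul_d hτ (by decide : (2 : Fin 3) ≠ 0)
  have h21 := hN.d_mul_d hτ (by decide : (2 : Fin 3) ≠ 1)
  have hd' (i : Fin 3) (p : JordanModel ℝ[X] param) :
      evenHom N p * N.d i = ringHom N (JordanModel.form param (gen param i) p) • N.d i := by
    rw [mul_comm, hN.d_mul_evenHom hτ]
  simp only [algHom, mul_fst, mul_snd, Fin.sum_univ_three, evenHom_add, hN.evenHom_mul hτ,
    evenHom_smul, evenHom_gen, mul_add, add_mul, smul_mul_assoc, mul_smul_comm, h00, h11, h22, h01,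
    h02, h12, h10, h20, h21, hd', hN.d_mul_evenHom hτ, smul_zero, _root_.map_add, _root_.map_mul]
  match_scalars <;> ring

theorem algHom_axis (i : Fin 3) (ε : ℤˣ) : algHom N (axis param i (sgn ε)) = N.ax i ε := by
  rw [algHom, Finset.sum_eq_single i (fun j _ hj => by rw [axis_snd_of_ne i hj]; simp) (by simp),
    axis_fst, axis_snd_self, ← algebraMap_smul ℝ[X] (1 / 2 : ℝ) (gen param i), evenHom_smul,
    evenHom_gen, AlgHom.commutes, algebraMap_smul, _root_.map_smul, c, d]
  rcases Int.units_eq_one_or ε with rfl | rfl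
  · simp only [sgn_one, map_one]
    match_scalars <;> algebra
  · simp only [sgn_neg, sgn_one, map_neg, map_one]
    match_scalars <;> algebra

theorem form_ax_algHom (i : Fin 3) (ε : ℤˣ) (y : MonsterModel param) :
    N.form (N.ax i ε) (algHom N y) = ringHom N (bilin param (axis param i (sgn ε)) y) := by
  rw [algHom, _root_.map_add, map_sum, Finset.sum_eq_single i
    (fun j _ hj => by rw [_root_.map_smul, hN.form_ax_d hτ hj.symm, smul_zero]) (by simp),
    hN.form_ax_evenHom hτ, _root_.map_smul, hN.form_ax_d_self hτ, bilin_apply,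
    Finset.sum_eq_single i (fun j _ hj => by rw [axis_snd_of_ne i hj, zero_mul]) (by simp),
    axis_fst, axis_snd_self, MonsterModel.form_real_smul_left, smul_eq_mul, ← _root_.map_mul, ← _root_.map_add]
  congr 1
  algebra

/-- The vectors `x` that satisfy this for all `y` form a subalgebra, because both forms associate
with the product. It contains the axes, hence is everything. -/
theorem form_algHom (x y : MonsterModel param) :
    N.form (algHom N x) (algHom N y) = ringHom N (bilin param x y) := by
  let S : NonUnitalSubalgebra ℝ[X] (MonsterModel param) :=
    { carrier := {x | ∀ y, N.form (algHom N x) (algHom N y) = ringHom N (bilin param x y)}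
      zero_mem' := fun y => by
        have h := algHom_smul (N := N) 0 0
        rw [zero_smul, _root_.map_zero, zero_smul] at h
        rw [h, _root_.map_zero, LinearMap.zero_apply, _root_.map_zero, LinearMap.zero_apply,
          _root_.map_zero]
      add_mem' := fun {x x'} hx hx' y => by
        rw [algHom_add, _root_.map_add, LinearMap.add_apply, hx, hx', _root_.map_add,
          LinearMap.add_apply, _root_.map_add]
      smul_mem' := fun r x hx y => by
        rw [algHom_smul, _root_.map_smul, LinearMap.smul_apply, hx, _root_.map_smul,
          LinearMap.smul_apply, smul_eq_mul, smul_eq_mul, _root_.map_mul]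
      mul_mem' := fun {x x'} hx hx' y => by
        rw [hN.algHom_mul hτ, ← N.form_assoc, ← hN.algHom_mul hτ, hx, bilin_assoc] }
  have h (i ε) : axis param i (sgn ε) ∈ S := fun y => by
    rw [hN.algHom_axis hτ, hN.form_ax_algHom hτ]
  refine mem_of_axis_mem S (fun i => ⟨?_, ?_⟩) x y
  · simpa using h i 1
  · simpa using h i (-1)

theorem nonempty_hom : Nonempty (Hom univ N) := ⟨{
  onRing := ringHom N
  onAlg :=
    { toFun := algHom N
      map_mul' := hN.algHom_mul hτ
      map_zero' := by
        have := algHom_smul (N := N) 0 0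
        rwa [zero_smul, _root_.map_zero, zero_smul] at this
      map_add' := algHom_add }
  map_smul := algHom_smul
  map_form := hN.form_algHom hτ
  map_ax := hN.algHom_axis hτ }⟩

end InC4A

end MarkedFrobeniusAlgebra

/-! ### Coordinates of the twelve marked vectors. -/

namespace MonsterModel

open Polynomial JordanModel

variable {ψ : ℝ[X]}

/-- The vector with given coordinates. -/
noncomputable def vec (ψ : ℝ[X]) (c m n d : Fin 3 → ℝ[X]) : MonsterModel ψ := mk ⟨c, m, n⟩ d

theorem vec_add (c m n d c' m' n' d' : Fin 3 → ℝ[X]) :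
    vec ψ c m n d + vec ψ c' m' n' d' = vec ψ (c + c') (m + m') (n + n') (d + d') := rfl

theorem vec_smul (r : ℝ[X]) (c m n d : Fin 3 → ℝ[X]) :
    r • vec ψ c m n d = vec ψ (r • c) (r • m) (r • n) (r • d) := rfl

theorem vec_inj {c m n d c' m' n' d' : Fin 3 → ℝ[X]} (h : vec ψ c m n d = vec ψ c' m' n' d') :
    c = c' ∧ m = m' ∧ n = n' ∧ d = d' :=
  ⟨congrArg (fun x : MonsterModel ψ => x.1.c) h, congrArg (fun x : MonsterModel ψ => x.1.m) h,
    congrArg (fun x : MonsterModel ψ => x.1.n) h, congrArg (fun x : MonsterModel ψ => x.2) h⟩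

theorem axis_eq_vec (i : Fin 3) (e : ℝ[X]) : axis ψ i e =
    vec ψ (Pi.single i ((1 / 2 : ℝ) • 1)) 0 0 (Pi.single i ((1 / 2 : ℝ) • e)) := by
  refine ext (JordanModel.ext ?_ ?_ ?_) fun j => rfl
  · change (1 / 2 : ℝ) • (Pi.single i 1 : Fin 3 → ℝ[X]) = _
    rw [← Pi.single_smul]
    rfl
  · exact smul_zero _
  · exact smul_zero _

theorem c_univ (i : Fin 3) : univ.c i = even (gen param i) := by
  have h := axis_add (ψ := param) i 1 (-1) (by ring)
  rw [← sgn_one, ← sgn_neg] at h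
  exact h

theorem v_univ {i j : Fin 3} (h : i ≠ j) : univ.v i j =
    even ((2 / 3 : ℝ) • (gen param i + gen param j) - (16 / 3 : ℝ) • (gen param i * gen param j)) := by
  have h1 := inC4A_univ.v_eq (fun i ε => ⟨isMiyamoto_univ i ε, tau_axis i⟩) h
  rw [c_univ, c_univ] at h1
  refine h1.trans ?_
  change (2 / 3 : ℝ) • (even (gen param i) + even (gen param j))
    - (16 / 3 : ℝ) • (even (gen param i) * even (gen param j)) = _
  rw [even_mul, ← even_add]
  exact ext rfl fun j => by simp

theorem v_univ_zero_one : univ.v 0 1 =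
    vec param ![(2 / 3 : ℝ) • 1, (2 / 3 : ℝ) • 1, 0] ![0, 0, -(16 / 3 : ℝ) • 1] 0 0 := by
  rw [v_univ (by decide), gen_zero_mul_gen_one]
  apply ext_coords <;> simp [vec, gen]

theorem v_univ_zero_two : univ.v 0 2 =
    vec param ![(2 / 3 : ℝ) • 1, 0, (2 / 3 : ℝ) • 1] ![0, -(16 / 3 : ℝ) • 1, 0] 0 0 := by
  rw [v_univ (by decide), gen_zero_mul_gen_two]
  apply ext_coords <;> simp [vec, gen]

theorem v_univ_one_two : univ.v 1 2 =
    vec param ![0, (2 / 3 : ℝ) • 1, (2 / 3 : ℝ) • 1] ![-(16 / 3 : ℝ) • 1, 0, 0] 0 0 := by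
  rw [v_univ (by decide), gen_one_mul_gen_two]
  apply ext_coords <;> simp [vec, gen]

theorem X_eq : (1 / 12 : ℝ) • 1 - (16 / 3 : ℝ) • param = X := by
  unfold param
  algebra

/-- The odd coordinate is half of `e` times the normalized inner product of c_1 and v_{(2,3)}, which
is t when ψ is `param`. -/
theorem axis_zero_mul_vec (e : ℝ[X]) : axis ψ 0 e *
    vec ψ ![0, (2 / 3 : ℝ) • 1, (2 / 3 : ℝ) • 1] ![-(16 / 3 : ℝ) • 1, 0, 0] 0 0 =
    vec ψ 0 ![0, (1 / 3 : ℝ) • 1, (1 / 3 : ℝ) • 1] ![-(8 / 3 : ℝ) • 1, 0, 0]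
      ![(1 / 2 : ℝ) • (((1 / 12 : ℝ) • 1 - (16 / 3 : ℝ) • ψ) * e), 0, 0] := by
  rw [axis_eq_vec]
  apply ext_coords <;> simp only [vec, mk_fst, mk_snd, mul_fst, mul_snd, mul_c, mul_m, mul_n,
    mulC, mulM, mulN, sym, Fin.sum_univ_three, gen, add_c, add_m, add_n, smul_c, smul_m, smul_n,
    Pi.add_apply, Pi.smul_apply, form, LinearMap.mk₂_apply, formFun, Fin.isValue, Fin.reduceAdd,
    Matrix.cons_val, Pi.zero_apply, Pi.single_apply, smul_eq_mul] <;>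
    simp [-mul_eq_mul_left_iff, -mul_eq_mul_right_iff] <;> algebra

theorem axis_one_mul_vec (e : ℝ[X]) : axis ψ 1 e *
    vec ψ ![(2 / 3 : ℝ) • 1, 0, (2 / 3 : ℝ) • 1] ![0, -(16 / 3 : ℝ) • 1, 0] 0 0 =
    vec ψ 0 ![(1 / 3 : ℝ) • 1, 0, (1 / 3 : ℝ) • 1] ![0, -(8 / 3 : ℝ) • 1, 0]
      ![0, (1 / 2 : ℝ) • (((1 / 12 : ℝ) • 1 - (16 / 3 : ℝ) • ψ) * e), 0] := by
  rw [axis_eq_vec]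
  apply ext_coords <;> simp only [vec, mk_fst, mk_snd, mul_fst, mul_snd, mul_c, mul_m, mul_n,
    mulC, mulM, mulN, sym, Fin.sum_univ_three, gen, add_c, add_m, add_n, smul_c, smul_m, smul_n,
    Pi.add_apply, Pi.smul_apply, form, LinearMap.mk₂_apply, formFun, Fin.isValue, Fin.reduceAdd,
    Matrix.cons_val, Pi.zero_apply, Pi.single_apply, smul_eq_mul] <;>
    simp [-mul_eq_mul_left_iff, -mul_eq_mul_right_iff] <;> algebra

theorem axis_two_mul_vec (e : ℝ[X]) : axis ψ 2 e *
    vec ψ ![(2 / 3 : ℝ) • 1, (2 / 3 : ℝ) • 1, 0] ![0, 0, -(16 / 3 : ℝ) • 1] 0 0 =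
    vec ψ 0 ![(1 / 3 : ℝ) • 1, (1 / 3 : ℝ) • 1, 0] ![0, 0, -(8 / 3 : ℝ) • 1]
      ![0, 0, (1 / 2 : ℝ) • (((1 / 12 : ℝ) • 1 - (16 / 3 : ℝ) • ψ) * e)] := by
  rw [axis_eq_vec]
  apply ext_coords <;> simp only [vec, mk_fst, mk_snd, mul_fst, mul_snd, mul_c, mul_m, mul_n,
    mulC, mulM, mulN, sym, Fin.sum_univ_three, gen, add_c, add_m, add_n, smul_c, smul_m, smul_n,
    Pi.add_apply, Pi.smul_apply, form, LinearMap.mk₂_apply, formFun, Fin.isValue, Fin.reduceAdd,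
    Matrix.cons_val, Pi.zero_apply, Pi.single_apply, smul_eq_mul] <;>
    simp [-mul_eq_mul_left_iff, -mul_eq_mul_right_iff] <;> algebra

theorem bilin_axis_vec : bilin ψ (axis ψ 0 1)
    (vec ψ ![0, (2 / 3 : ℝ) • 1, (2 / 3 : ℝ) • 1] ![-(16 / 3 : ℝ) • 1, 0, 0] 0 0) =
    (1 / 12 : ℝ) • 1 - (16 / 3 : ℝ) • ψ := by
  rw [bilin_apply, axis_eq_vec]
  simp only [vec, mk_fst, mk_snd, sym, Fin.sum_univ_three, Pi.single_apply, form,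
    LinearMap.mk₂_apply, formFun, Fin.isValue, Fin.reduceAdd, Matrix.cons_val, Pi.zero_apply]
  simp
  algebra

theorem t_univ : univ.t = X := by
  have h : univ.t = bilin param (axis param 0 1) (univ.v 1 2) := by
    rw [← sgn_one]
    rfl
  rw [h, v_univ_one_two, bilin_axis_vec, X_eq]

/-- The coordinates of the marked basis vectors of the universal algebra. -/
theorem basisVectors_univ : univ.basisVectors =
    ![vec param ![(1 / 2 : ℝ) • 1, 0, 0] 0 0 ![(1 / 2 : ℝ) • 1, 0, 0],
      vec param ![(1 / 2 : ℝ) • 1, 0, 0] 0 0 ![-(1 / 2 : ℝ) • 1, 0, 0],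
      vec param ![0, (1 / 2 : ℝ) • 1, 0] 0 0 ![0, (1 / 2 : ℝ) • 1, 0],
      vec param ![0, (1 / 2 : ℝ) • 1, 0] 0 0 ![0, -(1 / 2 : ℝ) • 1, 0],
      vec param ![0, 0, (1 / 2 : ℝ) • 1] 0 0 ![0, 0, (1 / 2 : ℝ) • 1],
      vec param ![0, 0, (1 / 2 : ℝ) • 1] 0 0 ![0, 0, -(1 / 2 : ℝ) • 1],
      vec param ![(2 / 3 : ℝ) • 1, (2 / 3 : ℝ) • 1, 0] ![0, 0, -(16 / 3 : ℝ) • 1] 0 0,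
      vec param ![(2 / 3 : ℝ) • 1, 0, (2 / 3 : ℝ) • 1] ![0, -(16 / 3 : ℝ) • 1, 0] 0 0,
      vec param ![0, (2 / 3 : ℝ) • 1, (2 / 3 : ℝ) • 1] ![-(16 / 3 : ℝ) • 1, 0, 0] 0 0,
      vec param 0 ![0, (1 / 3 : ℝ) • 1, (1 / 3 : ℝ) • 1] ![-(8 / 3 : ℝ) • 1, 0, 0]
        ![(1 / 2 : ℝ) • X, 0, 0],
      vec param 0 ![(1 / 3 : ℝ) • 1, 0, (1 / 3 : ℝ) • 1] ![0, -(8 / 3 : ℝ) • 1, 0]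
        ![0, (1 / 2 : ℝ) • X, 0],
      vec param 0 ![(1 / 3 : ℝ) • 1, (1 / 3 : ℝ) • 1, 0] ![0, 0, -(8 / 3 : ℝ) • 1]
        ![0, 0, (1 / 2 : ℝ) • X]] := by
  have ha (i ε) : univ.ax i ε = axis param i (sgn ε) := rfl
  have h0 := axis_zero_mul_vec (ψ := param) (sgn 1)
  have h1 := axis_one_mul_vec (ψ := param) (sgn 1)
  have h2 := axis_two_mul_vec (ψ := param) (sgn 1)
  rw [← v_univ_one_two] at h0
  rw [← v_univ_zero_two] at h1
  rw [← v_univ_zero_one] at h2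
  have s0 (x : ℝ[X]) : (Pi.single 0 x : Fin 3 → ℝ[X]) = ![x, 0, 0] := by
    ext i; fin_cases i <;> simp
  have s1 (x : ℝ[X]) : (Pi.single 1 x : Fin 3 → ℝ[X]) = ![0, x, 0] := by
    ext i; fin_cases i <;> simp
  have s2 (x : ℝ[X]) : (Pi.single 2 x : Fin 3 → ℝ[X]) = ![0, 0, x] := by
    ext i; fin_cases i <;> simp
  funext k
  fin_cases k
  · exact (axis_eq_vec _ _).trans (by rw [s0, s0, sgn_one]; rfl)
  · exact (axis_eq_vec _ _).trans (by rw [s0, s0, sgn_neg, sgn_one, smul_neg, ← neg_smul]; rfl)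
  · exact (axis_eq_vec _ _).trans (by rw [s1, s1, sgn_one]; rfl)
  · exact (axis_eq_vec _ _).trans (by rw [s1, s1, sgn_neg, sgn_one, smul_neg, ← neg_smul]; rfl)
  · exact (axis_eq_vec _ _).trans (by rw [s2, s2, sgn_one]; rfl)
  · exact (axis_eq_vec _ _).trans (by rw [s2, s2, sgn_neg, sgn_one, smul_neg, ← neg_smul]; rfl)
  · exact v_univ_zero_one
  · exact v_univ_zero_two
  · exact v_univ_one_two
  · exact h0.trans (by rw [X_eq, sgn_one, mul_one]; rfl)
  · exact h1.trans (by rw [X_eq, sgn_one, mul_one]; rfl)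
  · exact h2.trans (by rw [X_eq, sgn_one, mul_one]; rfl)

theorem _root_.Fin.sum_univ_twelve {A : Type*} [AddCommMonoid A] (f : Fin 12 → A) :
    ∑ k, f k = f 0 + f 1 + f 2 + f 3 + f 4 + f 5 + f 6 + f 7 + f 8 + f 9 + f 10 + f 11 := by
  simp only [Fin.sum_univ_castSucc, Fin.sum_univ_zero, zero_add]
  rfl

/-- A linear combination of the marked basis vectors. -/
theorem combination_univ (g : Fin 12 → ℝ[X]) :
    (∑ k, (show univ.R from g k) • univ.basisVectors k : univ.V) = vec param
      ![(1 / 2 : ℝ) • (g 0 + g 1) + (2 / 3 : ℝ) • (g 6 + g 7),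
        (1 / 2 : ℝ) • (g 2 + g 3) + (2 / 3 : ℝ) • (g 6 + g 8),
        (1 / 2 : ℝ) • (g 4 + g 5) + (2 / 3 : ℝ) • (g 7 + g 8)]
      ![-(16 / 3 : ℝ) • g 8 + (1 / 3 : ℝ) • (g 10 + g 11),
        -(16 / 3 : ℝ) • g 7 + (1 / 3 : ℝ) • (g 9 + g 11),
        -(16 / 3 : ℝ) • g 6 + (1 / 3 : ℝ) • (g 9 + g 10)]
      ![-(8 / 3 : ℝ) • g 9, -(8 / 3 : ℝ) • g 10, -(8 / 3 : ℝ) • g 11]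
      ![(1 / 2 : ℝ) • (g 0 - g 1 + X * g 9), (1 / 2 : ℝ) • (g 2 - g 3 + X * g 10),
        (1 / 2 : ℝ) • (g 4 - g 5 + X * g 11)] := by
  have key : ∀ b : Fin 12 → MonsterModel param, b = univ.basisVectors →
      (∑ k, (show univ.R from g k) • univ.basisVectors k : univ.V) = ∑ k, g k • b k := by
    rintro b rfl
    rfl
  rw [key _ basisVectors_univ.symm]
  rw [Fin.sum_univ_twelve]
  simp only [Matrix.cons_val, Fin.isValue, vec_smul, vec_add]
  congr 1 <;> funext i <;> fin_cases i <;> simp <;> algebra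

/-- The system is triangular: the triple products see only the last three coefficients, then the
double products give the three for v_{(i,j)}, and sums and differences give those of the axes. -/
theorem eq_zero_of_combination_univ (g : Fin 12 → univ.R)
    (h : ∑ k, g k • univ.basisVectors k = 0) (k : Fin 12) : g k = 0 := by
  obtain ⟨hc, hm, hn, hd⟩ := vec_inj
    (c' := 0) (m' := 0) (n' := 0) (d' := 0) ((combination_univ g).symm.trans h)
  have main : ∀ g : Fin 12 → ℝ[X],
      ![(1 / 2 : ℝ) • (g 0 + g 1) + (2 / 3 : ℝ) • (g 6 + g 7),
        (1 / 2 : ℝ) • (g 2 + g 3) + (2 / 3 : ℝ) • (g 6 + g 8),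
        (1 / 2 : ℝ) • (g 4 + g 5) + (2 / 3 : ℝ) • (g 7 + g 8)] = 0 →
      ![-(16 / 3 : ℝ) • g 8 + (1 / 3 : ℝ) • (g 10 + g 11),
        -(16 / 3 : ℝ) • g 7 + (1 / 3 : ℝ) • (g 9 + g 11),
        -(16 / 3 : ℝ) • g 6 + (1 / 3 : ℝ) • (g 9 + g 10)] = 0 →
      ![-(8 / 3 : ℝ) • g 9, -(8 / 3 : ℝ) • g 10, -(8 / 3 : ℝ) • g 11] = 0 →
      ![(1 / 2 : ℝ) • (g 0 - g 1 + X * g 9), (1 / 2 : ℝ) • (g 2 - g 3 + X * g 10),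
        (1 / 2 : ℝ) • (g 4 - g 5 + X * g 11)] = 0 → ∀ k, g k = 0 := by
    intro g hc hm hn hd
    have n0 : -(8 / 3 : ℝ) • g 9 = 0 := congrFun hn 0
    have n1 : -(8 / 3 : ℝ) • g 10 = 0 := congrFun hn 1
    have n2 : -(8 / 3 : ℝ) • g 11 = 0 := congrFun hn 2
    have g9 := (smul_eq_zero.mp n0).resolve_left (by norm_num)
    have g10 := (smul_eq_zero.mp n1).resolve_left (by norm_num)
    have g11 := (smul_eq_zero.mp n2).resolve_left (by norm_num)
    have m0 : -(16 / 3 : ℝ) • g 8 + (1 / 3 : ℝ) • (g 10 + g 11) = 0 := congrFun hm 0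
    have m1 : -(16 / 3 : ℝ) • g 7 + (1 / 3 : ℝ) • (g 9 + g 11) = 0 := congrFun hm 1
    have m2 : -(16 / 3 : ℝ) • g 6 + (1 / 3 : ℝ) • (g 9 + g 10) = 0 := congrFun hm 2
    rw [g10, g11, add_zero, smul_zero, add_zero] at m0
    rw [g9, g11, add_zero, smul_zero, add_zero] at m1
    rw [g9, g10, add_zero, smul_zero, add_zero] at m2
    have g8 := (smul_eq_zero.mp m0).resolve_left (by norm_num)
    have g7 := (smul_eq_zero.mp m1).resolve_left (by norm_num)
    have g6 := (smul_eq_zero.mp m2).resolve_left (by norm_num)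
    have c0 : (1 / 2 : ℝ) • (g 0 + g 1) + (2 / 3 : ℝ) • (g 6 + g 7) = 0 := congrFun hc 0
    have c1 : (1 / 2 : ℝ) • (g 2 + g 3) + (2 / 3 : ℝ) • (g 6 + g 8) = 0 := congrFun hc 1
    have c2 : (1 / 2 : ℝ) • (g 4 + g 5) + (2 / 3 : ℝ) • (g 7 + g 8) = 0 := congrFun hc 2
    have d0 : (1 / 2 : ℝ) • (g 0 - g 1 + X * g 9) = 0 := congrFun hd 0
    have d1 : (1 / 2 : ℝ) • (g 2 - g 3 + X * g 10) = 0 := congrFun hd 1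
    have d2 : (1 / 2 : ℝ) • (g 4 - g 5 + X * g 11) = 0 := congrFun hd 2
    rw [g6, g7] at c0
    rw [g6, g8] at c1
    rw [g7, g8] at c2
    rw [g9] at d0
    rw [g10] at d1
    rw [g11] at d2
    intro k
    fin_cases k
    · linear_combination (norm := algebra) c0 + d0
    · linear_combination (norm := algebra) c0 - d0
    · linear_combination (norm := algebra) c1 + d1
    · linear_combination (norm := algebra) c1 - d1
    · linear_combination (norm := algebra) c2 + d2
    · linear_combination (norm := algebra) c2 - d2
    · exact g6
    · exact g7
    · exact g8
    · exact g9
    · exact g10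
    · exact g11
  exact main g hc hm hn hd k

theorem exists_combination_univ (x : univ.V) :
    ∃ g : Fin 12 → univ.R, ∑ k, g k • univ.basisVectors k = x := by
  have main : ∀ x : MonsterModel param, ∃ g : Fin 12 → ℝ[X],
      (∑ k, (show univ.R from g k) • univ.basisVectors k : univ.V) = x := by
    intro x
    -- The triangular system is solved in the same order. Only nonzero real constants are inverted,
    -- so the solution exists over ℝ[X].
    set g9 := -(3 / 8 : ℝ) • x.1.n 0
    set g10 := -(3 / 8 : ℝ) • x.1.n 1
    set g11 := -(3 / 8 : ℝ) • x.1.n 2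
    set g6 := -(3 / 16 : ℝ) • (x.1.m 2 - (1 / 3 : ℝ) • (g9 + g10)) with h6
    set g7 := -(3 / 16 : ℝ) • (x.1.m 1 - (1 / 3 : ℝ) • (g9 + g11)) with h7
    set g8 := -(3 / 16 : ℝ) • (x.1.m 0 - (1 / 3 : ℝ) • (g10 + g11)) with h8
    refine ⟨![x.1.c 0 - (2 / 3 : ℝ) • (g6 + g7) + (x.2 0 - (1 / 2 : ℝ) • (X * g9)),
      x.1.c 0 - (2 / 3 : ℝ) • (g6 + g7) - (x.2 0 - (1 / 2 : ℝ) • (X * g9)),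
      x.1.c 1 - (2 / 3 : ℝ) • (g6 + g8) + (x.2 1 - (1 / 2 : ℝ) • (X * g10)),
      x.1.c 1 - (2 / 3 : ℝ) • (g6 + g8) - (x.2 1 - (1 / 2 : ℝ) • (X * g10)),
      x.1.c 2 - (2 / 3 : ℝ) • (g7 + g8) + (x.2 2 - (1 / 2 : ℝ) • (X * g11)),
      x.1.c 2 - (2 / 3 : ℝ) • (g7 + g8) - (x.2 2 - (1 / 2 : ℝ) • (X * g11)),
      g6, g7, g8, g9, g10, g11], (combination_univ _).trans ?_⟩
    have e9 : -(8 / 3 : ℝ) • g9 = x.1.n 0 := by rw [smul_smul]; norm_num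
    have e10 : -(8 / 3 : ℝ) • g10 = x.1.n 1 := by rw [smul_smul]; norm_num
    have e11 : -(8 / 3 : ℝ) • g11 = x.1.n 2 := by rw [smul_smul]; norm_num
    clear_value g9 g10 g11
    refine ext_coords ?_ ?_ ?_ ?_ ?_ ?_ e9 e10 e11 ?_ ?_ ?_ <;>
      simp only [vec, mk_fst, mk_snd, Matrix.cons_val, Fin.isValue, h6, h7, h8] <;> algebra
  exact main x

end MonsterModel

/-! ### Uniqueness of morphisms and transfer to any initial object. -/

namespace MarkedFrobeniusAlgebra

namespace Hom

variable {M N P : MarkedFrobeniusAlgebra}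

theorem onAlg_eq_of_mem_closure (f g : Hom M N) {x : M.V}
    (hx : x ∈ Subsemigroup.closure {x : M.V | ∃ i ε, x = M.ax i ε}) : f.onAlg x = g.onAlg x := by
  induction hx using Subsemigroup.closure_induction with
  | mem x hx =>
    obtain ⟨i, ε, rfl⟩ := hx
    rw [f.map_ax, g.map_ax]
  | mul x y _ _ hx hy => rw [map_mul, map_mul, hx, hy]

/-- The images of monomials in the axes are forced. Their form values generate the coefficient ring,
so the ring map is forced, and then so is the semilinear map. -/
instance : Subsingleton (Hom M N) where
  allEq f g := by
    have hR : f.onRing = g.onRing := by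
      refine AlgHom.ext_of_adjoin_eq_top M.ring_generated ?_
      rintro r ⟨x, hx, y, hy, rfl⟩
      rw [← f.map_form, ← g.map_form, onAlg_eq_of_mem_closure f g hx,
        onAlg_eq_of_mem_closure f g hy]
    refine Hom.ext hR (NonUnitalRingHom.ext fun x => ?_)
    have hx : x ∈ NonUnitalAlgebra.adjoin M.R {x : M.V | ∃ i ε, x = M.ax i ε} := by
      rw [M.generated]; trivial
    induction hx using NonUnitalAlgebra.adjoin_induction with
    | mem x hx =>
      obtain ⟨i, ε, rfl⟩ := hx
      rw [f.map_ax, g.map_ax]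
    | add x y _ _ hx hy => rw [map_add, map_add, hx, hy]
    | zero => rw [map_zero, map_zero]
    | mul x y _ _ hx hy => rw [map_mul, map_mul, hx, hy]
    | smul r x _ hx => rw [f.map_smul, g.map_smul, hx, hR]

/-- The identity. -/
def id (M : MarkedFrobeniusAlgebra) : Hom M M where
  onRing := AlgHom.id ℝ M.R
  onAlg := NonUnitalRingHom.id M.V
  map_smul _ _ := rfl
  map_form _ _ := rfl
  map_ax _ _ := rfl

/-- The composition. -/
def comp (g : Hom N P) (f : Hom M N) : Hom M P where
  onRing := g.onRing.comp f.onRing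
  onAlg := g.onAlg.comp f.onAlg
  map_smul r x := by
    change g.onAlg (f.onAlg (r • x)) = _
    rw [f.map_smul, g.map_smul]
    rfl
  map_form x y := by
    change P.form (g.onAlg (f.onAlg x)) (g.onAlg (f.onAlg y)) = _
    rw [g.map_form, f.map_form]
    rfl
  map_ax i ε := by
    change g.onAlg (f.onAlg (M.ax i ε)) = _
    rw [f.map_ax, g.map_ax]

/-- The composite is an endomorphism, and there is only one. -/
theorem onAlg_onAlg (f : Hom M N) (g : Hom N M) (x : M.V) : g.onAlg (f.onAlg x) = x :=
  congrArg (fun h : Hom M M => h.onAlg x) (Subsingleton.elim (g.comp f) (id M))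

theorem onRing_onRing (f : Hom M N) (g : Hom N M) (r : M.R) : g.onRing (f.onRing r) = r :=
  congrArg (fun h : Hom M M => h.onRing r) (Subsingleton.elim (g.comp f) (id M))

theorem map_real_smul (f : Hom M N) (r : ℝ) (x : M.V) : f.onAlg (r • x) = r • f.onAlg x := by
  rw [← algebraMap_smul M.R r x, f.map_smul, AlgHom.commutes, algebraMap_smul]

theorem map_v (f : Hom M N) (i j : Fin 3) : f.onAlg (M.v i j) = N.v i j := by
  simp only [v, map_sub, map_add, map_mul, map_real_smul, map_ax]

theorem map_t (f : Hom M N) : f.onRing M.t = N.t := by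
  rw [t, ← f.map_form, f.map_ax, f.map_v, t]

theorem map_basisVectors (f : Hom M N) (k : Fin 12) :
    f.onAlg (M.basisVectors k) = N.basisVectors k := by
  fin_cases k
  · exact f.map_ax 0 1
  · exact f.map_ax 0 (-1)
  · exact f.map_ax 1 1
  · exact f.map_ax 1 (-1)
  · exact f.map_ax 2 1
  · exact f.map_ax 2 (-1)
  · exact f.map_v 0 1
  · exact f.map_v 0 2
  · exact f.map_v 1 2
  · exact (map_mul f.onAlg _ _).trans (by rw [f.map_ax, f.map_v]; rfl)
  · exact (map_mul f.onAlg _ _).trans (by rw [f.map_ax, f.map_v]; rfl)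
  · exact (map_mul f.onAlg _ _).trans (by rw [f.map_ax, f.map_v]; rfl)

theorem map_combination (f : Hom M N) (g : Fin 12 → M.R) :
    f.onAlg (∑ k, g k • M.basisVectors k) = ∑ k, f.onRing (g k) • N.basisVectors k := by
  rw [map_sum]
  exact Finset.sum_congr rfl fun k _ => by rw [f.map_smul, f.map_basisVectors]

end Hom

open MonsterModel

theorem isUniversal4A_univ : univ.IsUniversal4A := by
  refine ⟨inC4A_univ, fun N hN => ?_⟩
  obtain ⟨-, τ, hτ⟩ := hN.propertyP
  obtain ⟨f⟩ := hN.nonempty_hom hτ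
  exact ⟨⟨⟨f⟩, fun g => Subsingleton.elim g f⟩⟩

section Basis

variable {M : MarkedFrobeniusAlgebra} (f : Hom M univ) (g : Hom univ M)
include f g

theorem linearIndependent_basisVectors : LinearIndependent M.R M.basisVectors := by
  rw [Fintype.linearIndependent_iff]
  intro r hr k
  have h := congrArg f.onAlg hr
  rw [f.map_combination, map_zero] at h
  have hk := eq_zero_of_combination_univ (fun k => f.onRing (r k)) h k
  rw [← f.onRing_onRing g (r k), hk, map_zero]

theorem span_basisVectors : ⊤ ≤ Submodule.span M.R (Set.range M.basisVectors) := by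
  intro x _
  obtain ⟨r, hr⟩ := exists_combination_univ (f.onAlg x)
  rw [← f.onAlg_onAlg g x, ← hr, g.map_combination]
  exact Submodule.sum_mem _ fun k _ => Submodule.smul_mem _ _ (Submodule.subset_span ⟨k, rfl⟩)

/-- The ring map of `f` sends t to X, hence is a left inverse of the evaluation; being bijective, it
is a two-sided one. -/
theorem bijective_aeval_t :
    Function.Bijective (Polynomial.aeval M.t : Polynomial ℝ →ₐ[ℝ] M.R) := by
  have h (p : Polynomial ℝ) : f.onRing (Polynomial.aeval M.t p) = p := by
    rw [← Polynomial.aeval_algHom_apply, f.map_t, t_univ]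
    exact Polynomial.aeval_X_left_apply p
  refine ⟨Function.LeftInverse.injective h, fun r => ⟨f.onRing r, ?_⟩⟩
  have h1 := congrArg g.onRing (h (f.onRing r))
  rwa [f.onRing_onRing g, f.onRing_onRing g] at h1

end Basis

end MarkedFrobeniusAlgebra

theorem theorem5p1 :
    (∃ M : MarkedFrobeniusAlgebra, M.IsUniversal4A) ∧
    ∀ M : MarkedFrobeniusAlgebra, M.IsUniversal4A →
      (∃ B : Module.Basis (Fin 12) M.R M.V, ∀ k, B k = M.basisVectors k) ∧
      Module.finrank M.R M.V = 12 ∧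
      Function.Bijective (Polynomial.aeval M.t : Polynomial ℝ →ₐ[ℝ] M.R) := by
  refine ⟨⟨_, MarkedFrobeniusAlgebra.isUniversal4A_univ⟩, fun M hM => ?_⟩
  -- Initiality of both objects gives morphisms in both directions, which are mutually inverse.
  obtain ⟨hf⟩ := hM.2 _ MonsterModel.inC4A_univ
  obtain ⟨hg⟩ := MarkedFrobeniusAlgebra.isUniversal4A_univ.2 _ hM.1
  have f := hf.default
  have g := hg.default
  let B := Module.Basis.mk (MarkedFrobeniusAlgebra.linearIndependent_basisVectors f g)
    (MarkedFrobeniusAlgebra.span_basisVectors f g)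
  refine ⟨⟨B, fun k => Module.Basis.mk_apply _ _ k⟩, ?_,
    MarkedFrobeniusAlgebra.bijective_aeval_t f g⟩
  rw [Module.finrank_eq_card_basis B, Fintype.card_fin]
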